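/- Let $d\ge 1$, let $\Theta\subset\mathbb{R}^d$ be a Borel set equipped with the Lebesgue measure, let $\alpha\in(0,1)$, let $\mathcal{Y}$ be a measurable space with a $\sigma$-finite measure $\mu$, and let $\ell(y\mid\theta)$ be a jointly measurable likelihood satisfying the following classical regularity conditions. There is an open set $U\supset\Theta$ such that: (a) for $\mu$-a.e. $y$, $\theta\mapsto\ell(y\mid\theta)$ is positive and twice continuously differentiable on $U$; (b) $\int\ell(y\mid\theta)\,d\mu(y)=1$ for $\theta\in U$; (c) for $\theta_1\neq\theta_2$ in $\Theta$ the densities $\ell(\cdot\mid\theta_1)$, $\ell(\cdot\mid\theta_2)$ are not $\mu$-a.e. equal; (d) for $\theta\in\Theta$ the Fisher information matrix $\mathcal{I}(\theta)_{ij}=-\int\partial^2_{\theta_i\theta_j}\log\ell(y\mid\theta)\,\ell(y\mid\theta)\,d\mu(y)$ is positive definite; (e) every $\theta_0\in\Theta$ is the centre of an open ball $B\subset U$ for which there is a $\mu$-integrable $G$ such that, for $\mu$-a.e. $y$ and all $\theta,\theta'\in B$, $\ell(y\mid\theta)\|\nabla_\theta\log\ell(y\mid\theta')\|^2\le G(y)$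 and $\ell(y\mid\theta)\|\nabla^2_\theta\log\ell(y\mid\theta')\|\le G(y)$. A *prior* is an equivalence class, up to multiplication by a positive constant, of non-null measures on $\Theta$ having a non-negative, measurable, locally bounded and a.e. continuous density with respect to the Lebesgue measure on $\Theta$; a *class of priors* is a set of priors. For a compact $K\subset\Theta$ with $\pi(K)>0$, the *renormalised restriction* of $\pi$ to $K$ is the probability measure $\pi(\cdot\cap K)/\pi(K)$. An *openly increasing compact exhaustion* of $\Theta$ is a sequence $(\Theta_i)_{i\in\mathbb{N}}$ of compact subsets of $\Theta$ with $\bigcup_i\Theta_i=\Theta$ for which there are $i_0\ge0$ and relatively open subsets $V_i$ of $\Theta$ ($i\ge i_0$) with $\Theta_i\subset V_i\subset\Theta_{i+1}$ for all $i\ge i_0$. For a probability measure $\pi$ on $\Theta$ and $k\in\mathbb{N}$ put $\ell_k(\mathbf{y}\mid\theta)=\prod_{j=1}^k\ell(y_j\mid\theta)$, $p_k(\mathbf{y})=\int_\Theta\ell_k(\mathbf{y}\mid\theta)\,d\pi(\theta)$ and $$I_{D_\alpha}(\pi\mid k)=\int_\Theta\int_{\mathcal{Y}^k} f_\alpha\!\left(\frac{p_k(\mathbf{y})}{\ell_k(\mathbf{y}\mid\theta)}\right)\ell_k(\mathbf{y}\mid\theta)\,d\mu^{\otimes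 k}(\mathbf{y})\,d\pi(\theta),\qquad f_\alpha(x)=\frac{x^\alpha-\alpha x-(1-\alpha)}{\alpha(\alpha-1)}.$$ Given a class $\mathcal{P}$ and a sequence $(\Theta_i)$, let $\mathcal{P}_i=\{\pi\in\mathcal{P}:\pi(\Theta_i)>0\}$ and write $\pi_i$ for the renormalised restriction of $\pi$ to $\Theta_i$. A prior $\pi^*\in\mathcal{P}$ is a *$D_\alpha$-reference prior over $\mathcal{P}$* (with rate $k^{d\alpha/2}$) if there is an openly increasing compact exhaustion $(\Theta_i)$ of $\Theta$ with $\pi^*(\Theta_i)>0$ for all $i$ such that, for every $i$ and every $\pi\in\mathcal{P}_i$, the limit $$\lim_{k\to\infty}k^{d\alpha/2}\bigl(I_{D_\alpha}(\pi_i^*\mid k)-I_{D_\alpha}(\pi_i\mid k)\bigr)$$ exists in $\mathbb{R}$ and is $\ge0$. For a probability measure $\pi$ on $\Theta$ with Lebesgue density $\pi(\theta)$ let $$l(\pi)=C_\alpha\int_\Theta\pi(\theta)^{1+\alpha}\,|\det\mathcal{I}(\theta)|^{-\alpha/2}\,d\theta,\qquad C_\alpha=\frac{(2\pi)^{d\alpha/2}(1-\alpha)^{-d/2}}{\alpha(\alpha-1)},$$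 where $\pi$ in the constant $C_\alpha$ is the number $3.14\ldots$ **Proposition.** Let $\mathcal{P}$ be a class of priors and $\pi^*\in\mathcal{P}$. Then $\pi^*$ is a $D_\alpha$-reference prior over $\mathcal{P}$ if and only if there is an openly increasing compact exhaustion $(\Theta_i)_{i\in\mathbb{N}}$ of $\Theta$ with $\pi^*(\Theta_i)>0$ for all $i$ such that, for every $i\in\mathbb{N}$, $\pi^*\in\arg\max_{\pi\in\mathcal{P}_i}l(\pi_i)$, that is, $l(\pi_i)\le l(\pi^*_i)$ for all $\pi\in\mathcal{P}_i$. -/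

import Mathlib

open MeasureTheory ProbabilityTheory Filter Topology
open scoped NNReal ENNReal

noncomputable section

namespace RefPrior

/-- The Euclidean space `ℝ^d` in which the parameter set lives. -/
abbrev Param (d : ℕ) : Type := EuclideanSpace ℝ (Fin d)

section Priors

variable {d : ℕ}

/-- The Lebesgue measure on `Θ`, as a measure on the subtype. -/
def lebesgueOn (Θ : Set (Param d)) : Measure Θ :=
  Measure.comap ((↑) : Θ → Param d) volume

/-- Non-null measures on `Θ` with a non-negative, measurable, locally bounded and a.e. continuous
density with respect to the Lebesgue measure of `Θ` (`lebesgueOn Θ`).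
Such a measure is automatically `σ`-finite. -/
def IsPriorMeasure (Θ : Set (Param d)) (π : Measure Θ) : Prop :=
  π ≠ 0 ∧ ∃ f : Θ → ℝ,
    Measurable f ∧ (∀ θ, 0 ≤ f θ) ∧
    (∀ θ, ∃ s ∈ 𝓝 θ, BddAbove (f '' s)) ∧
    (∀ᵐ θ ∂(lebesgueOn Θ), ContinuousAt f θ) ∧
    π = (lebesgueOn Θ).withDensity (fun θ => ENNReal.ofReal (f θ))

/-- Equality of measures up to a positive multiplicative constant. -/
def priorSetoid (Θ : Set (Param d)) : Setoid {π : Measure Θ // IsPriorMeasure Θ π} where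
  r π₁ π₂ := ∃ δ : ℝ≥0, 0 < δ ∧ π₁.1 = δ • π₂.1
  iseqv :=
    { refl := fun π => ⟨1, one_pos, by simp⟩
      symm := by
        rintro π₁ π₂ ⟨δ, hδ, h⟩
        refine ⟨δ⁻¹, inv_pos.mpr hδ, ?_⟩
        rw [h, smul_smul, inv_mul_cancel₀ hδ.ne', one_smul]
      trans := by
        rintro π₁ π₂ π₃ ⟨δ, hδ, h⟩ ⟨ε, hε, h'⟩
        exact ⟨δ * ε, mul_pos hδ hε, by rw [h, h', smul_smul]⟩ }

/-- A (possibly improper) prior on `Θ`: a class of prior measures up to proportionality. -/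
def Prior (Θ : Set (Param d)) : Type := Quotient (priorSetoid Θ)

/-- `π(K) > 0`, which does not depend on the representative of the prior. -/
def Prior.Charges {Θ : Set (Param d)} (π : Prior Θ) (K : Set Θ) : Prop :=
  Quotient.lift (s := priorSetoid Θ) (fun m => 0 < m.1 K) (by
    rintro m₁ m₂ ⟨δ, hδ, h⟩
    have hδ' : (δ : ℝ≥0∞) ≠ 0 := by exact_mod_cast hδ.ne'
    simp only [h, Measure.smul_apply, pos_iff_ne_zero, ENNReal.smul_def, smul_eq_mul, ne_eq,
      mul_eq_zero, hδ', false_or]) π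

theorem cond_smul_eq {Ω : Type*} [MeasurableSpace Ω] (m : Measure Ω) (K : Set Ω) (δ : ℝ≥0)
    (hδ : 0 < δ) : ProbabilityTheory.cond (δ • m) K = ProbabilityTheory.cond m K := by
  have h0 : (δ : ℝ≥0∞) ≠ 0 := by exact_mod_cast hδ.ne'
  have h1 : (δ : ℝ≥0∞) ≠ ∞ := ENNReal.coe_ne_top
  have h2 : δ • m = (δ : ℝ≥0∞) • m := rfl
  rw [h2, ProbabilityTheory.cond, ProbabilityTheory.cond, Measure.restrict_smul, smul_smul, Measure.smul_apply, smul_eq_mul,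
    ENNReal.mul_inv (Or.inl h0) (Or.inl h1), mul_right_comm, ENNReal.inv_mul_cancel h0 h1, one_mul]

/-- The re-normalised restriction `π(· ∩ K) / π(K)` of a prior `π` to `K`
(a probability measure on `Θ`, carried by `K`, when `K` is compact and charged by `π`). -/
def Prior.restrictNorm {Θ : Set (Param d)} (π : Prior Θ) (K : Set Θ) : Measure Θ :=
  Quotient.lift (s := priorSetoid Θ) (fun m => ProbabilityTheory.cond m.1 K) (by
    rintro m₁ m₂ ⟨δ, hδ, h⟩
    simp only [h]
    exact cond_smul_eq m₂.1 K δ hδ) π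

/-- An openly increasing sequence of compact subsets of `Θ` whose union is `Θ`; openness is
relative to `Θ`. -/
def IsOpenlyIncreasingExhaustion {Θ : Set (Param d)} (K : ℕ → Set Θ) : Prop :=
  (∀ i, IsCompact (K i)) ∧ (⋃ i, K i) = Set.univ ∧
    ∃ (i₀ : ℕ) (V : ℕ → Set Θ), ∀ i, i₀ ≤ i → IsOpen (V i) ∧ K i ⊆ V i ∧ V i ⊆ K (i + 1)

end Priors

section Model

variable {d : ℕ} {Y : Type*} [MeasurableSpace Y]

/-- The joint likelihood `ℓ_k(y | θ) = ∏ ℓ(y_i | θ)` of `k` observations. -/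
def jointLik (ℓ : Param d → Y → ℝ) (k : ℕ) (θ : Param d) (y : Fin k → Y) : ℝ :=
  ∏ i, ℓ θ (y i)

/-- The marginal density `p_k(y) = ∫ ℓ_k(y | θ) dπ(θ)` under a proper prior `π`. -/
def marginal (ℓ : Param d → Y → ℝ) {Θ : Set (Param d)} (π : Measure Θ) (k : ℕ)
    (y : Fin k → Y) : ℝ :=
  ∫ θ : Θ, jointLik ℓ k θ y ∂π

/-- The function `f_α` of the `α`-divergence. -/
def fAlpha (α x : ℝ) : ℝ := (x ^ α - α * x - (1 - α)) / (α * (α - 1))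

/-- The `α`-divergence `D_α(P_θ^{⊗k} ‖ P_{Y_k})`. -/
def alphaDiv (α : ℝ) (μ : Measure Y) [SigmaFinite μ] (ℓ : Param d → Y → ℝ) {Θ : Set (Param d)}
    (π : Measure Θ) (k : ℕ) (θ : Param d) : ℝ :=
  ∫ y, fAlpha α (marginal ℓ π k y / jointLik ℓ k θ y) * jointLik ℓ k θ y
    ∂(Measure.pi fun _ : Fin k => μ)

/-- The `D_α`-mutual information `I_{D_α}(π | k)` of a proper prior `π`. -/
def mutualInfo (α : ℝ) (μ : Measure Y) [SigmaFinite μ] (ℓ : Param d → Y → ℝ) {Θ : Set (Param d)}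
    (π : Measure Θ) (k : ℕ) : ℝ :=
  ∫ θ : Θ, alphaDiv α μ ℓ π k θ ∂π

/-- The derivative in `θ` of the log-likelihood of one observation. -/
def score (ℓ : Param d → Y → ℝ) (y : Y) (θ : Param d) : Param d →L[ℝ] ℝ :=
  fderiv ℝ (fun t => Real.log (ℓ t y)) θ

/-- The second derivative in `θ` of the log-likelihood of one observation. -/
def scoreDeriv (ℓ : Param d → Y → ℝ) (y : Y) (θ : Param d) : Param d →L[ℝ] Param d →L[ℝ] ℝ :=
  fderiv ℝ (score ℓ y) θ

/-- The Fisher information matrix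
`I(θ)_{ij} = - ∫ (∂²_{θ_i θ_j} log ℓ(y | θ)) ℓ(y | θ) dμ(y)`. -/
def fisher (μ : Measure Y) (ℓ : Param d → Y → ℝ) (θ : Param d) : Matrix (Fin d) (Fin d) ℝ :=
  Matrix.of fun i j => -∫ y, scoreDeriv ℓ y θ (EuclideanSpace.single i 1)
    (EuclideanSpace.single j 1) * ℓ θ y ∂μ

/-- Classical regularity of the statistical model on `Θ`, seen as part of a model with
parameter in an open set `U ⊇ Θ`: positive, twice continuously differentiable probability
densities, identifiability on `Θ`, positive definite Fisher information on `Θ`, and local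
domination of the first two derivatives of the log-likelihood. -/
structure IsRegularOn (μ : Measure Y) (ℓ : Param d → Y → ℝ) (Θ U : Set (Param d)) : Prop where
  isOpen : IsOpen U
  subset : Θ ⊆ U
  measurable : Measurable (Function.uncurry ℓ)
  pos : ∀ᵐ y ∂μ, ∀ θ ∈ U, 0 < ℓ θ y
  contDiff : ∀ᵐ y ∂μ, ContDiffOn ℝ 2 (fun θ => ℓ θ y) U
  density : ∀ θ ∈ U, ∫⁻ y, ENNReal.ofReal (ℓ θ y) ∂μ = 1
  identifiable : ∀ θ₁ ∈ Θ, ∀ θ₂ ∈ Θ, ℓ θ₁ =ᵐ[μ] ℓ θ₂ → θ₁ = θ₂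
  fisher_posDef : ∀ θ ∈ Θ, (fisher μ ℓ θ).PosDef
  dominated : ∀ θ₀ ∈ Θ, ∃ r > 0, Metric.ball θ₀ r ⊆ U ∧ ∃ G : Y → ℝ, Integrable G μ ∧
    ∀ᵐ y ∂μ, ∀ θ ∈ Metric.ball θ₀ r, ∀ θ' ∈ Metric.ball θ₀ r,
      ℓ θ y * ‖score ℓ y θ'‖ ^ 2 ≤ G y ∧ ℓ θ y * ‖scoreDeriv ℓ y θ'‖ ≤ G y

/-- The model is regular on `Θ` if it is so inside some open set containing `Θ`. -/
def IsRegularModel (μ : Measure Y) (ℓ : Param d → Y → ℝ) (Θ : Set (Param d)) : Prop :=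
  ∃ U, IsRegularOn μ ℓ Θ U

/-- The constant `C_α = (2π)^{dα/2} (1-α)^{-d/2} / (α(α-1))` (a negative number). -/
def constC (d : ℕ) (α : ℝ) : ℝ :=
  (2 * Real.pi) ^ ((d : ℝ) * α / 2) * (1 - α) ^ (-(d : ℝ) / 2) / (α * (α - 1))

/-- The functional `l(π) = C_α ∫ π(θ)^{1+α} |I(θ)|^{-α/2} dθ`, where `π(θ)` is the density of
the measure `π` with respect to the Lebesgue measure and `|I(θ)|` is the determinant. -/
def limitFunctional (α : ℝ) (μ : Measure Y) (ℓ : Param d → Y → ℝ) {Θ : Set (Param d)}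
    (π : Measure Θ) : ℝ :=
  constC d α * ∫ θ : Θ, (π.rnDeriv (lebesgueOn Θ) θ).toReal ^ (1 + α) *
    |(fisher μ ℓ (θ : Param d)).det| ^ (-α / 2)
    ∂(lebesgueOn Θ)

/-- `πs` is a `D_α`-reference prior over the class `P` with rate `φ`. -/
def IsReferencePrior (α : ℝ) (μ : Measure Y) [SigmaFinite μ] (ℓ : Param d → Y → ℝ)
    {Θ : Set (Param d)} (φ : ℕ → ℝ) (P : Set (Prior Θ)) (πs : Prior Θ) : Prop :=
  πs ∈ P ∧ ∃ K : ℕ → Set Θ, IsOpenlyIncreasingExhaustion K ∧ (∀ i, πs.Charges (K i)) ∧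
    ∀ i, ∀ π ∈ P, π.Charges (K i) →
      ∃ L : ℝ, 0 ≤ L ∧ Tendsto (fun k : ℕ => φ k *
        (mutualInfo α μ ℓ (πs.restrictNorm (K i)) k - mutualInfo α μ ℓ (π.restrictNorm (K i)) k))
        atTop (𝓝 L)

end Model

end RefPrior

end

noncomputable section

namespace RefPrior

/-! ### Affinity against L¹ distance, and tensorisation over mixtures. -/

section Affinity

/-! Expand `fAlpha` and use that the marginal and the likelihood both integrate to one: for a prior
density g carried by a compact set, the mutual information is (A_k(g) - 1)/(α(α-1)), where A_k(g) =
∫ g(θ) ∫ (∫ g ℓ_k)^α ℓ_k(·|θ)^(1-α) dμ^k dθ is a mean affinity (`mutualInfo_eq`). The heart of the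
matter is the limit k^(dα/2) A_k(g) → m ∫ g^(1+α) |det I|^(-α/2), with a universal m = `gaussMoment
d α` in (0, ∞) (`IsRegularOn.tendsto_mixtureAffinity`). Rescaled differences of mutual informations
therefore always converge, to a positive multiple of the difference of the values of
`limitFunctional`. Being a reference prior and maximising the functional then become the same
condition, along the same exhaustion. The value of m is never needed, only that it is positive and
finite.

The substitution θ' = θ + v/√k in the mixture produces the factor k^(dα/2). On a bounded range of v,
local asymptotic normality (`ae_expansion`, from the strong law, and `tendsto_integral_normSum`, the
central limit theorem) gives the limit in law of the integrated likelihood ratio, namely ∫ exp(⟨x,v⟩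
- vᵀJv/2) dv with x of law N(0,J) and J the Fisher information. As α < 1, bounded first moments turn
this into convergence of α-th moments (`tendsto_lintegral_rpow_of_min`). The change of variables by
J^(1/2) extracts |det J|^(-α/2) (`lintegral_quadExpFull`). The prior density is frozen at its value
at θ, which is legitimate at Lebesgue points (`ae_tendsto_oscillation`).

For large v a tail bound uniform in k and θ is needed. On a compact set the L¹ distance of densities
is comparable with the Euclidean distance of parameters (`IsRegularOn.exists_isBiLipschitzOn`).
Hence the one-observation affinity between θ and any mixture over a unit cell at distance about ‖v‖
is at most 1 - c‖v‖²/k. This bound tensorises to exp(-c‖v‖²), and the cells are summed using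
subadditivity of t ↦ t^α (`tail_affinity_le`). The same bound dominates the integrand in θ. -/

theorem rpow_mul_rpow_add_le {α x y s : ℝ} (hα₀ : 0 < α) (hα₁ : α < 1) (hx : 0 ≤ x) (hy : 0 ≤ y) :
    x ^ α * y ^ (1 - α) + min α (1 - α) * (2 * s * |x - y|) ≤
      α * x + (1 - α) * y + min α (1 - α) * (2 * s ^ 2 * (x + y)) := by
  -- Weighted AM-GM for √x√y with weight 2β and y with weight 1 - 2β: the mean 2β√x√y + (1-2β)y is
  -- exactly the right-hand side, so the Hellinger term comes for free. The restriction β ≤ 1/2 is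
  -- lifted below by exchanging x and y.
  have key : ∀ {β x y : ℝ}, 0 < β → β ≤ 1 / 2 → 0 ≤ x → 0 ≤ y →
      x ^ β * y ^ (1 - β) ≤ β * x + (1 - β) * y - β * (√x - √y) ^ 2 := by
    intro β x y hβ hβ' hx hy
    have h := Real.geom_mean_le_arith_mean2_weighted (w₁ := 2 * β) (w₂ := 1 - 2 * β)
      (p₁ := √x * √y) (p₂ := y) (by linarith) (by linarith) (by positivity) hy (by ring)
    have e : (√x * √y) ^ (2 * β) * y ^ (1 - 2 * β) = x ^ β * y ^ (1 - β) := by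
      rw [Real.mul_rpow (Real.sqrt_nonneg _) (Real.sqrt_nonneg _), Real.rpow_mul (Real.sqrt_nonneg _),
        Real.rpow_mul (Real.sqrt_nonneg _)]
      simp only [Real.rpow_two, Real.sq_sqrt hx, Real.sq_sqrt hy]
      rw [mul_assoc, ← Real.rpow_add_of_nonneg hy hβ.le (by linarith)]
      congr 2
      ring
    rw [e] at h
    nlinarith [Real.sq_sqrt hx, Real.sq_sqrt hy]
  have h1 : x ^ α * y ^ (1 - α) ≤
      α * x + (1 - α) * y - min α (1 - α) * (√x - √y) ^ 2 := by
    rcases le_total α (1 / 2) with h | h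
    · rw [min_eq_left (by linarith)]
      exact key hα₀ h hx hy
    · rw [min_eq_right (by linarith)]
      have := key (β := 1 - α) (by linarith) (by linarith) hy hx
      rw [sub_sub_cancel] at this
      nlinarith
  -- Factor x - y = (√x-√y)(√x+√y) and apply 2uv ≤ u² + v². The free parameter s keeps the bound
  -- linear in |x - y|, so it can be integrated pointwise and s chosen afterwards, in place of
  -- Cauchy–Schwarz.
  have h2 : 2 * s * |x - y| ≤ (√x - √y) ^ 2 + 2 * s ^ 2 * (x + y) := by
    have e : x - y = (√x - √y) * (√x + √y) := by
      nlinarith [Real.sq_sqrt hx, Real.sq_sqrt hy]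
    have hb : 0 ≤ √x + √y := by positivity
    rw [e, abs_mul, abs_of_nonneg hb, ← sq_abs (√x - √y)]
    have : (√x + √y) ^ 2 ≤ 2 * (x + y) := by
      nlinarith [Real.sq_sqrt hx, Real.sq_sqrt hy, sq_nonneg (√x - √y)]
    nlinarith [sq_nonneg (|√x - √y| - s * (√x + √y)), sq_nonneg s]
  have hκ : 0 ≤ min α (1 - α) := le_min hα₀.le (by linarith)
  nlinarith

variable {Y : Type*} [MeasurableSpace Y] {μ : Measure Y}

/-- The `L¹` distance of two densities. -/
def l1Dist (μ : Measure Y) (f g : Y → ℝ≥0∞) : ℝ≥0∞ := ∫⁻ y, ((f y - g y) + (g y - f y)) ∂μ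

theorem l1Dist_comm (f g : Y → ℝ≥0∞) : l1Dist μ f g = l1Dist μ g f := by
  simp only [l1Dist, add_comm]

theorem l1Dist_triangle {f g h : Y → ℝ≥0∞} (hf : Measurable f) (hg : Measurable g) :
    l1Dist μ f h ≤ l1Dist μ f g + l1Dist μ g h := by
  rw [l1Dist, l1Dist, l1Dist, ← lintegral_add_left (by fun_prop)]
  refine lintegral_mono fun y => ?_
  calc (f y - h y) + (h y - f y) ≤ ((f y - g y) + (g y - h y)) + ((h y - g y) + (g y - f y)) :=
        add_le_add tsub_le_tsub_add_tsub tsub_le_tsub_add_tsub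
    _ = _ := by ring

theorem rpow_mul_rpow_add_le_ennreal {α s : ℝ} {x y : ℝ≥0∞} (hα₀ : 0 < α) (hα₁ : α < 1)
    (hx : x ≠ ∞) (hy : y ≠ ∞) (hs : 0 ≤ s) :
    x ^ α * y ^ (1 - α) + ENNReal.ofReal (min α (1 - α) * (2 * s)) * ((x - y) + (y - x)) ≤
      ENNReal.ofReal α * x + ENNReal.ofReal (1 - α) * y +
        ENNReal.ofReal (min α (1 - α) * (2 * s ^ 2)) * (x + y) := by
  have hκ : 0 ≤ min α (1 - α) := le_min hα₀.le (by linarith)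
  have hα₁' : 0 ≤ 1 - α := by linarith
  lift x to ℝ≥0 using hx
  lift y to ℝ≥0 using hy
  have h := rpow_mul_rpow_add_le (s := s) hα₀ hα₁ x.2 y.2
  have e : ((x : ℝ≥0∞) - y) + (y - x) = ENNReal.ofReal |(x : ℝ) - y| := by
    rcases le_total x y with hxy | hxy
    · rw [tsub_eq_zero_of_le (by exact_mod_cast hxy), zero_add,
        abs_of_nonpos (sub_nonpos.2 (by exact_mod_cast hxy)), neg_sub, ENNReal.ofReal_sub _ x.coe_nonneg]
      simp
    · rw [tsub_eq_zero_of_le (a := (y : ℝ≥0∞)) (by exact_mod_cast hxy), add_zero,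
        abs_of_nonneg (sub_nonneg.2 (by exact_mod_cast hxy)), ENNReal.ofReal_sub _ y.coe_nonneg]
      simp
  have e1 : ∀ z : ℝ≥0, (z : ℝ≥0∞) = ENNReal.ofReal (z : ℝ) := fun z => by simp
  rw [e, e1 x, e1 y, ENNReal.ofReal_rpow_of_nonneg x.coe_nonneg hα₀.le, ENNReal.ofReal_rpow_of_nonneg y.coe_nonneg hα₁',
    ← ENNReal.ofReal_mul (by positivity), ← ENNReal.ofReal_mul (by positivity),
    ← ENNReal.ofReal_add (by positivity) (by positivity), ← ENNReal.ofReal_mul hα₀.le,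
    ← ENNReal.ofReal_mul hα₁', ← ENNReal.ofReal_add (by positivity) (by positivity),
    ← ENNReal.ofReal_add (by positivity) (by positivity), ← ENNReal.ofReal_mul (by positivity),
    ← ENNReal.ofReal_add (by positivity) (by positivity)]
  refine ENNReal.ofReal_le_ofReal ?_
  simp only [← mul_assoc] at h ⊢
  exact h

/-- With κ = min α (1-α), integrating the pointwise inequality gives 1 + 4κs² - 2κsD, whose minimum
over s is at s = D/4 and equals 1 - κD²/4. -/
theorem lintegral_rpow_mul_rpow_le {α D : ℝ} (hα₀ : 0 < α) (hα₁ : α < 1) (hD : 0 ≤ D)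
    {f g : Y → ℝ≥0∞} (hf : Measurable f) (hg : Measurable g) (hf1 : ∫⁻ y, f y ∂μ = 1)
    (hg1 : ∫⁻ y, g y ∂μ = 1) (h : ENNReal.ofReal D ≤ l1Dist μ f g) :
    ∫⁻ y, f y ^ α * g y ^ (1 - α) ∂μ ≤ ENNReal.ofReal (1 - min α (1 - α) * D ^ 2 / 4) := by
  have hκ : 0 ≤ min α (1 - α) := le_min hα₀.le (by linarith)
  have hα₁' : 0 ≤ 1 - α := by linarith
  have h1 : ∫⁻ y, (f y ^ α * g y ^ (1 - α) +
        ENNReal.ofReal (min α (1 - α) * (2 * (D / 4))) * ((f y - g y) + (g y - f y))) ∂μ ≤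
      ∫⁻ y, (ENNReal.ofReal α * f y + ENNReal.ofReal (1 - α) * g y +
        ENNReal.ofReal (min α (1 - α) * (2 * (D / 4) ^ 2)) * (f y + g y)) ∂μ := by
    refine lintegral_mono_ae ?_
    filter_upwards [ae_lt_top hf (by simp [hf1]), ae_lt_top hg (by simp [hg1])] with y hy hy'
    exact rpow_mul_rpow_add_le_ennreal hα₀ hα₁ hy.ne hy'.ne (by positivity)
  rw [lintegral_add_left (by fun_prop), lintegral_const_mul _ (by fun_prop), ← l1Dist,
    lintegral_add_left (by fun_prop), lintegral_add_left (by fun_prop),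
    lintegral_const_mul _ hf, lintegral_const_mul _ hg,
    lintegral_const_mul (f := fun y => f y + g y) _ (by fun_prop), lintegral_add_left hf, hf1, hg1] at h1
  have h2 : ∫⁻ y, f y ^ α * g y ^ (1 - α) ∂μ + ENNReal.ofReal (min α (1 - α) * D ^ 2 / 2) ≤
      ENNReal.ofReal (1 + min α (1 - α) * D ^ 2 / 4) := by
    calc _ ≤ ∫⁻ y, f y ^ α * g y ^ (1 - α) ∂μ +
          ENNReal.ofReal (min α (1 - α) * (2 * (D / 4))) * l1Dist μ f g := by
          gcongr
          refine le_trans (le_of_eq ?_) (mul_le_mul_right h _)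
          rw [← ENNReal.ofReal_mul (by positivity)]
          congr 1
          ring
      _ ≤ _ := h1
      _ = _ := by
          rw [mul_one, mul_one, ← ENNReal.ofReal_add hα₀.le hα₁', show (1 + 1 : ℝ≥0∞) =
            ENNReal.ofReal 2 by norm_num, ← ENNReal.ofReal_mul (by positivity),
            ← ENNReal.ofReal_add (by linarith) (by positivity)]
          congr 1
          ring
  have h3 := ENNReal.le_sub_of_add_le_right ENNReal.ofReal_ne_top h2
  rw [← ENNReal.ofReal_sub _ (by positivity)] at h3
  refine h3.trans (ENNReal.ofReal_le_ofReal ?_)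
  linarith

/-- Convexity of the L¹ distance: the truncated differences pass under the integral in t, and
Tonelli exchanges the integrals. -/
theorem l1Dist_mixture_le {T : Type*} [MeasurableSpace T] [SFinite μ] {q : T → Y → ℝ≥0∞}
    (hq : Measurable (Function.uncurry q)) (ν : Measure T) [IsProbabilityMeasure ν]
    {g : Y → ℝ≥0∞} (hg : Measurable g) {B : ℝ≥0∞} (hB : ∀ᵐ t ∂ν, l1Dist μ (q t) g ≤ B) :
    l1Dist μ (fun y => ∫⁻ t, q t y ∂ν) g ≤ B := by
  have hqy : ∀ y, Measurable fun t => q t y := fun y =>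
    hq.comp (measurable_id.prodMk measurable_const)
  calc l1Dist μ (fun y => ∫⁻ t, q t y ∂ν) g
      ≤ ∫⁻ y, ∫⁻ t, ((q t y - g y) + (g y - q t y)) ∂ν ∂μ := by
        refine lintegral_mono fun y => ?_
        rw [lintegral_add_left ((hqy y).sub_const _)]
        have e : g y = ∫⁻ _, g y ∂ν := by simp
        gcongr
        · conv_lhs => rw [e]
          exact lintegral_sub_le' _ _ (by fun_prop)
        · conv_lhs => rw [e]
          exact lintegral_sub_le _ _ (hqy y)
    _ = ∫⁻ t, l1Dist μ (q t) g ∂ν := by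
        refine lintegral_lintegral_swap ?_
        have : Measurable fun p : Y × T => q p.2 p.1 := hq.comp measurable_swap
        have h2 : Measurable fun p : Y × T => g p.1 := hg.comp measurable_fst
        exact ((this.sub h2).add (h2.sub this)).aemeasurable
    _ ≤ ∫⁻ _, B ∂ν := lintegral_mono_ae hB
    _ = B := by simp

/-- Affinity of a mixture of densities close to `q₁` and of a density far from `q₁`. -/
theorem affinity_mixture_le {T : Type*} [MeasurableSpace T] [SFinite μ] {q : T → Y → ℝ≥0∞}
    (hq : Measurable (Function.uncurry q)) {α A B : ℝ} (hα₀ : 0 < α) (hα₁ : α < 1)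
    (hB₀ : 0 ≤ B) (hAB : B ≤ A) {g q₁ : Y → ℝ≥0∞} (hg : Measurable g) (hq₁ : Measurable q₁)
    (hg1 : ∫⁻ y, g y ∂μ = 1) (hA : ENNReal.ofReal A ≤ l1Dist μ q₁ g)
    (hρ : 0 < 1 - min α (1 - α) * (A - B) ^ 2 / 4) (ν : Measure T) [SFinite ν]
    (hqν : ∀ᵐ t ∂ν, ∫⁻ y, q t y ∂μ = 1)
    (hB : ∀ᵐ t ∂ν, l1Dist μ (q t) q₁ ≤ ENNReal.ofReal B) :
    ∫⁻ y, (∫⁻ t, q t y ∂ν) ^ α * g y ^ (1 - α) ∂μ ≤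
      ENNReal.ofReal (1 - min α (1 - α) * (A - B) ^ 2 / 4) * ν Set.univ ^ α := by
  -- The tensorisation applies this bound to tilted measures whose total mass is not controlled, so
  -- the masses ∞ and 0 must be covered. For mass ∞, strict positivity of the factor makes the
  -- right-hand side infinite.
  rcases eq_or_ne (ν Set.univ) ∞ with h | h
  · rw [h, ENNReal.top_rpow_of_pos hα₀, ENNReal.mul_top (by simpa using hρ)]
    exact le_top
  rcases eq_or_ne (ν Set.univ) 0 with h0 | h0
  · rw [Measure.measure_univ_eq_zero] at h0
    simp [h0, ENNReal.zero_rpow_of_pos hα₀]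
  set w := ν Set.univ with hw
  have hfin : IsFiniteMeasure ν := ⟨lt_top_iff_ne_top.2 h⟩
  have hne : NeZero ν := ⟨fun h' => h0 (by rw [hw, h']; simp)⟩
  set ν' := w⁻¹ • ν with hν'
  have hprob : IsProbabilityMeasure ν' := by
    rw [hν', hw]; exact isProbabilityMeasureSMul
  have hac : ν' ≪ ν := Measure.smul_absolutelyContinuous
  have hm : Measurable fun y => ∫⁻ t, q t y ∂ν' :=
    (hq.comp measurable_swap).lintegral_prod_right'
  have hm1 : ∫⁻ y, ∫⁻ t, q t y ∂ν' ∂μ = 1 := by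
    rw [lintegral_lintegral_swap (f := fun y t => q t y) (hq.comp measurable_swap).aemeasurable,
      lintegral_congr_ae (hac.ae_le hqν)]
    simp
  -- The normalised mixture stays within B of `q₁` by convexity, hence at distance at least A - B
  -- from g. Both sides of the claim are α-homogeneous in ν, so the normalisation costs nothing.
  have hd : ENNReal.ofReal (A - B) ≤ l1Dist μ (fun y => ∫⁻ t, q t y ∂ν') g := by
    rw [ENNReal.ofReal_sub _ hB₀, tsub_le_iff_right]
    refine hA.trans ?_
    rw [add_comm]
    refine (l1Dist_triangle hq₁ hm).trans (add_le_add_left ?_ _)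
    rw [l1Dist_comm]
    exact l1Dist_mixture_le hq ν' hq₁ (hac.ae_le hB)
  have h1 := lintegral_rpow_mul_rpow_le hα₀ hα₁ (sub_nonneg.2 hAB) hm hg hm1 hg1 hd
  have e : ∀ y, (∫⁻ t, q t y ∂ν) ^ α * g y ^ (1 - α) =
      w ^ α * ((∫⁻ t, q t y ∂ν') ^ α * g y ^ (1 - α)) := by
    intro y
    rw [← mul_assoc, ← ENNReal.mul_rpow_of_nonneg _ _ hα₀.le, hν', lintegral_smul_measure,
      smul_eq_mul, ← mul_assoc, ENNReal.mul_inv_cancel h0 h, one_mul]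
  simp_rw [e]
  rw [lintegral_const_mul _ (by fun_prop), mul_comm]
  gcongr

theorem lintegral_pi_fin_succ [SigmaFinite μ] {k : ℕ} {F : (Fin (k + 1) → Y) → ℝ≥0∞}
    (hF : Measurable F) : ∫⁻ y, F y ∂(Measure.pi fun _ => μ) =
      ∫⁻ y₀, ∫⁻ y : Fin k → Y, F (Fin.cons y₀ y) ∂(Measure.pi fun _ => μ) ∂μ := by
  rw [← ((measurePreserving_piFinSuccAbove (fun _ : Fin (k + 1) => μ) 0).symm).lintegral_comp hF]
  refine (lintegral_prod (μ := μ) (ν := Measure.pi fun _ : Fin k => μ) (fun p => F ((MeasurableEquiv.piFinSuccAbove (fun _ => Y) 0).symm p))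
    (hF.comp (MeasurableEquiv.measurable _)).aemeasurable).trans ?_
  simp
  rfl

/-- Tensorisation of a bound on affinities between mixtures over `T` and a density `g`. -/
theorem affinity_pi_le {T : Type*} [MeasurableSpace T] [SigmaFinite μ] {q : T → Y → ℝ≥0∞}
    (hq : Measurable (Function.uncurry q)) {α : ℝ} (hα₁ : α < 1) {ρ : ℝ≥0∞}
    {g : Y → ℝ≥0∞} (hg : Measurable g) {S : Set T}
    (hρ : ∀ (ν : Measure T) [SFinite ν], (∀ᵐ t ∂ν, t ∈ S) →
      ∫⁻ y, (∫⁻ t, q t y ∂ν) ^ α * g y ^ (1 - α) ∂μ ≤ ρ * ν Set.univ ^ α) (k : ℕ)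
    (ν : Measure T) [SFinite ν] (hν : ∀ᵐ t ∂ν, t ∈ S) :
    ∫⁻ y : Fin k → Y, (∫⁻ t, ∏ i, q t (y i) ∂ν) ^ α * (∏ i, g (y i)) ^ (1 - α)
      ∂(Measure.pi fun _ => μ) ≤ ρ ^ k * ν Set.univ ^ α := by
  induction k generalizing ν with
  | zero => simp
  | succ k ih =>
    have hqy : ∀ y, Measurable fun t => q t y := fun y =>
    hq.comp (measurable_id.prodMk measurable_const)
    have mjoint : ∀ n, Measurable fun p : (Fin n → Y) × T => ∏ i, q p.2 (p.1 i) := fun n =>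
      Finset.measurable_prod _ fun i _ =>
        hq.comp (measurable_snd.prodMk ((measurable_pi_apply i).comp measurable_fst))
    have mF : Measurable fun y : Fin (k + 1) → Y =>
        (∫⁻ t, ∏ i, q t (y i) ∂ν) ^ α * (∏ i, g (y i)) ^ (1 - α) :=
      ((mjoint _).lintegral_prod_right'.pow_const _).mul (by fun_prop)
    rw [lintegral_pi_fin_succ mF]
    -- Given the first observation, the remaining integral is the same quantity for ν tilted by q(·,
    -- y₀), which is still carried by S and has mass ∫ q(t, y₀) dν. This is why `hρ` is demanded for
    -- every s-finite measure on S: a bound for ν alone would not propagate.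
    have step : ∀ y₀ : Y, ∫⁻ y : Fin k → Y, (∫⁻ t, q t y₀ * ∏ i, q t (y i) ∂ν) ^ α *
        (g y₀ * ∏ i, g (y i)) ^ (1 - α) ∂(Measure.pi fun _ => μ) ≤
        ρ ^ k * ((∫⁻ t, q t y₀ ∂ν) ^ α * g y₀ ^ (1 - α)) := by
      intro y₀
      have := ih (ν.withDensity fun t => q t y₀)
        ((withDensity_absolutelyContinuous _ _).ae_le hν)
      rw [withDensity_apply _ MeasurableSet.univ, setLIntegral_univ] at this
      have e : ∀ y : Fin k → Y, ∫⁻ t, ∏ i, q t (y i) ∂(ν.withDensity fun t => q t y₀) =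
          ∫⁻ t, q t y₀ * ∏ i, q t (y i) ∂ν := fun y =>
        lintegral_withDensity_eq_lintegral_mul _ (hqy y₀)
          (Finset.measurable_prod _ fun i _ => hqy (y i))
      simp_rw [e] at this
      simp_rw [ENNReal.mul_rpow_of_nonneg _ _ (sub_nonneg.2 hα₁.le), mul_left_comm _ (g y₀ ^ (1 - α))]
      rw [lintegral_const_mul]
      · calc _ ≤ g y₀ ^ (1 - α) * (ρ ^ k * (∫⁻ t, q t y₀ ∂ν) ^ α) := by gcongr
          _ = _ := by ring
      · refine ((Measurable.lintegral_prod_right' (f := fun p : (Fin k → Y) × T =>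
          q p.2 y₀ * ∏ i, q p.2 (p.1 i)) ?_).pow_const _).mul (by fun_prop)
        exact (hq.comp (measurable_snd.prodMk measurable_const)).mul (mjoint k)
    calc _ = ∫⁻ y₀, ∫⁻ y : Fin k → Y, (∫⁻ t, q t y₀ * ∏ i, q t (y i) ∂ν) ^ α *
        (g y₀ * ∏ i, g (y i)) ^ (1 - α) ∂(Measure.pi fun _ => μ) ∂μ := by
          simp [Fin.prod_univ_succ]
      _ ≤ ∫⁻ y₀, ρ ^ k * ((∫⁻ t, q t y₀ ∂ν) ^ α * g y₀ ^ (1 - α)) ∂μ := lintegral_mono step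
      _ = ρ ^ k * ∫⁻ y₀, (∫⁻ t, q t y₀ ∂ν) ^ α * g y₀ ^ (1 - α) ∂μ := by
          rw [lintegral_const_mul]
          exact ((hq.comp measurable_swap).lintegral_prod_right'.pow_const _).mul (by fun_prop)
      _ ≤ ρ ^ k * (ρ * ν Set.univ ^ α) := by gcongr; exact hρ ν hν
      _ = _ := by ring

end Affinity

/-! ### Gaussian tail bound by summation over unit cells. -/

section Tail

theorem ENNReal_tsum_rpow_le {ι : Type*} (a : ι → ℝ≥0∞) {α : ℝ} (hα₀ : 0 < α) (hα₁ : α ≤ 1) :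
    (∑' n, a n) ^ α ≤ ∑' n, a n ^ α := by
  rw [← ENNReal.le_rpow_inv_iff hα₀, ENNReal.tsum_eq_iSup_sum]
  refine iSup_le fun s => ?_
  rw [ENNReal.le_rpow_inv_iff hα₀]
  refine le_trans ?_ (ENNReal.sum_le_tsum s)
  classical
  induction s using Finset.induction_on with
  | empty => simp [hα₀]
  | insert i s hi ih =>
    rw [Finset.sum_insert hi, Finset.sum_insert hi]
    exact (ENNReal.rpow_add_le_add_rpow _ _ hα₀.le hα₁).trans (add_le_add_right ih _)

variable {d : ℕ}

/-- The unit cell of the integer lattice containing a point. -/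
def cellIndex (h : Param d) : Fin d → ℤ := fun i => ⌊h i⌋

theorem measurable_cellIndex : Measurable (cellIndex (d := d)) :=
  measurable_pi_lambda _ fun i => Int.measurable_floor.comp (by fun_prop)

/-- A cell of the integer lattice. -/
def unitCell (n : Fin d → ℤ) : Set (Param d) := cellIndex ⁻¹' {n}

theorem measurableSet_unitCell (n : Fin d → ℤ) : MeasurableSet (unitCell n) :=
  measurable_cellIndex (measurableSet_singleton n)

theorem iUnion_unitCell : ⋃ n, unitCell n = (Set.univ : Set (Param d)) :=
  Set.eq_univ_of_forall fun h => Set.mem_iUnion.2 ⟨cellIndex h, rfl⟩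

theorem pairwise_disjoint_unitCell :
    Pairwise (Function.onFun Disjoint (unitCell (d := d))) := by
  intro m n hmn
  refine Set.disjoint_left.2 fun h hm hn => hmn ?_
  exact hm.symm.trans hn

theorem volume_unitCell (n : Fin d → ℤ) : volume (unitCell n) = 1 := by
  have e : unitCell n = (WithLp.ofLp : Param d → Fin d → ℝ) ⁻¹'
      (Set.univ.pi fun i => Set.Ico (n i : ℝ) (n i + 1)) := by
    ext h
    simp only [unitCell, cellIndex, Set.mem_preimage, Set.mem_singleton_iff, funext_iff,
      Int.floor_eq_iff, Set.mem_pi, Set.mem_univ, true_implies, Set.mem_Ico]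
  rw [e, (PiLp.volume_preserving_ofLp (Fin d)).measure_preimage
    (MeasurableSet.univ_pi fun i => measurableSet_Ico).nullMeasurableSet, volume_pi_pi]
  simp

theorem norm_sub_le_of_mem_unitCell {n : Fin d → ℤ} {h h' : Param d} (hn : h ∈ unitCell n)
    (hn' : h' ∈ unitCell n) : ‖h - h'‖ ≤ √d := by
  rw [EuclideanSpace.norm_eq]
  refine Real.sqrt_le_sqrt ?_
  have : ∀ i, ‖(h - h') i‖ ^ 2 ≤ 1 := by
    intro i
    have h1 := (Int.floor_eq_iff (a := h i)).1 (congrFun hn i)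
    have h2 := (Int.floor_eq_iff (a := h' i)).1 (congrFun hn' i)
    rw [Real.norm_eq_abs, sq_abs, PiLp.sub_apply]
    nlinarith
  exact (Finset.sum_le_sum fun i _ => this i).trans (by simp)

variable {Y : Type*} [MeasurableSpace Y] {μ : Measure Y}

theorem l1Dist_le {f g : Y → ℝ≥0∞} (hf : Measurable f) :
    l1Dist μ f g ≤ ∫⁻ y, f y ∂μ + ∫⁻ y, g y ∂μ := by
  rw [← lintegral_add_left hf]
  exact lintegral_mono fun y => add_le_add tsub_le_self tsub_le_self

/-- Gaussian upper bound for the tail of the marginal density seen at the scale of the sample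
size. -/
theorem tail_affinity_le [SigmaFinite μ] {q : Param d → Y → ℝ≥0∞}
    (hq : Measurable (Function.uncurry q)) {α : ℝ} (hα₀ : 0 < α) (hα₁ : α < 1)
    {S : Set (Param d)} (hS : MeasurableSet S) {g : Y → ℝ≥0∞} (hg : Measurable g)
    (hg1 : ∫⁻ y, g y ∂μ = 1) (hq1 : ∀ h ∈ S, ∫⁻ y, q h y ∂μ = 1) {a b R : ℝ} (ha : 0 < a)
    (hb : ∀ h ∈ S, ∀ h' ∈ S, l1Dist μ (q h) (q h') ≤ ENNReal.ofReal (b * ‖h - h'‖))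
    (hb₀ : 0 ≤ b) (hA : ∀ h ∈ S, ENNReal.ofReal (a * ‖h‖) ≤ l1Dist μ (q h) g)
    (hR : 2 * √d ≤ R) (hR' : 2 * b * √d ≤ a * R) (k : ℕ) :
    ∫⁻ y : Fin k → Y, (∫⁻ h in S ∩ {h | R < ‖h‖}, ∏ i, q h (y i)) ^ α *
      (∏ i, g (y i)) ^ (1 - α) ∂(Measure.pi fun _ => μ) ≤
    ∫⁻ h : Param d in {h | R / 2 < ‖h‖},
      ENNReal.ofReal (Real.exp (-(min α (1 - α) * (k * a ^ 2) / 64) * ‖h‖ ^ 2)) := by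
  have hκ : 0 < min α (1 - α) := lt_min hα₀ (by linarith)
  have hκ' : min α (1 - α) ≤ 1 := (min_le_left _ _).trans hα₁.le
  set κ := min α (1 - α) with hκdef
  set S' := S ∩ {h | R < ‖h‖} with hS'
  have hS'm : MeasurableSet S' :=
    hS.inter (measurableSet_lt measurable_const measurable_norm)
  have hqk : Measurable fun p : (Fin k → Y) × Param d => ∏ i, q p.2 (p.1 i) :=
    Finset.measurable_prod _ fun i _ =>
      hq.comp (measurable_snd.prodMk ((measurable_pi_apply i).comp measurable_fst))
  have hsum : ∀ F : Param d → ℝ≥0∞, ∫⁻ h in S', F h = ∑' n, ∫⁻ h in S' ∩ unitCell n, F h := by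
    intro F
    rw [← lintegral_iUnion (fun n => hS'm.inter (measurableSet_unitCell n))
      (fun m n hmn => (pairwise_disjoint_unitCell hmn).mono Set.inter_subset_right
        Set.inter_subset_right), ← Set.inter_iUnion, iUnion_unitCell, Set.inter_univ]
  -- On one cell, densities are compared with the one at an arbitrary point `h₁` of the cell. Cells
  -- of volume 1 let each exponential bound be rewritten as an integral over its own cell.
  have hcell : ∀ n, ∫⁻ y : Fin k → Y, (∫⁻ h in S' ∩ unitCell n, ∏ i, q h (y i)) ^ α *
      (∏ i, g (y i)) ^ (1 - α) ∂(Measure.pi fun _ => μ) ≤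
      ∫⁻ h in {h | R / 2 < ‖h‖} ∩ unitCell n,
        ENNReal.ofReal (Real.exp (-(κ * (k * a ^ 2) / 64) * ‖h‖ ^ 2)) := by
    intro n
    rcases (S' ∩ unitCell n).eq_empty_or_nonempty with he | ⟨h₁, hh₁, hn₁⟩
    · simp [he, ENNReal.zero_rpow_of_pos hα₀]
    have hR₁ : R < ‖h₁‖ := hh₁.2
    have hd : 0 ≤ √(d : ℝ) := Real.sqrt_nonneg _
    have hA₁ := hA h₁ hh₁.1
    have hle : a * ‖h₁‖ ≤ 2 := by
      have := hA₁.trans (l1Dist_le (hq.comp (measurable_const.prodMk measurable_id)))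
      rw [hq1 h₁ hh₁.1, hg1, show (1 + 1 : ℝ≥0∞) = ENNReal.ofReal 2 by norm_num] at this
      exact (ENNReal.ofReal_le_ofReal_iff (by norm_num)).1 this
    have hah : 0 ≤ a * ‖h₁‖ := by positivity
    -- A cell has diameter at most √d, so its densities are within A/2 of the one at `h₁`, where A =
    -- a‖h₁‖ bounds the distance of the latter to g from below. Since A ≤ 2 by `hle`, the one-step
    -- factor 1 - κ(A/2)²/4 is positive.
    have hbB : b * √d ≤ a * ‖h₁‖ / 2 := by nlinarith
    have e1 : a * ‖h₁‖ - a * ‖h₁‖ / 2 = a * ‖h₁‖ / 2 := by ring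
    have hρ : 0 < 1 - κ * (a * ‖h₁‖ - a * ‖h₁‖ / 2) ^ 2 / 4 := by
      rw [e1]
      nlinarith
    have hmem : ∀ᵐ h ∂(volume.restrict (S' ∩ unitCell n)), h ∈ S' ∩ unitCell n :=
      ae_restrict_mem (hS'm.inter (measurableSet_unitCell n))
    have h1 := affinity_pi_le (μ := μ) hq hα₁ hg (S := S' ∩ unitCell n)
      (ρ := ENNReal.ofReal (1 - κ * (a * ‖h₁‖ - a * ‖h₁‖ / 2) ^ 2 / 4))
      (fun ν _ hν => affinity_mixture_le hq hα₀ hα₁ (by positivity) (by linarith) hg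
        (hq.comp (measurable_const.prodMk measurable_id)) hg1 hA₁ hρ ν
        (by filter_upwards [hν] with h hh using hq1 h hh.1.1)
        (by
          filter_upwards [hν] with h hh
          refine (hb h hh.1.1 h₁ hh₁.1).trans (ENNReal.ofReal_le_ofReal ?_)
          exact (mul_le_mul_of_nonneg_left (norm_sub_le_of_mem_unitCell hh.2 hn₁) hb₀).trans hbB))
      k (volume.restrict (S' ∩ unitCell n)) hmem
    refine h1.trans ?_
    have hvol : volume.restrict (S' ∩ unitCell n) Set.univ ^ α ≤ 1 := by
      rw [Measure.restrict_apply_univ]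
      exact (ENNReal.rpow_le_rpow (measure_mono Set.inter_subset_right) hα₀.le).trans
        (by simp [volume_unitCell])
    have hcl : unitCell n ⊆ {h | R / 2 < ‖h‖} := by
      intro h hh
      have := norm_sub_le_of_mem_unitCell hn₁ hh
      have h3 := norm_sub_norm_le h₁ h
      simp only [Set.mem_ofPred_eq]
      linarith
    rw [Set.inter_eq_right.2 hcl]
    calc _ ≤ ENNReal.ofReal (Real.exp (-(κ * (k * a ^ 2) / 16) * ‖h₁‖ ^ 2)) * 1 := by
          gcongr
          rw [← ENNReal.ofReal_pow hρ.le]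
          refine ENNReal.ofReal_le_ofReal ?_
          have h4 := Real.add_one_le_exp (-(κ * (a * ‖h₁‖ - a * ‖h₁‖ / 2) ^ 2 / 4))
          calc _ ≤ Real.exp (-(κ * (a * ‖h₁‖ - a * ‖h₁‖ / 2) ^ 2 / 4)) ^ k :=
                pow_le_pow_left₀ hρ.le (by linarith) k
            _ = _ := by
                rw [← Real.exp_nat_mul, e1]
                congr 1
                ring
      _ = ∫⁻ h in unitCell n, ENNReal.ofReal (Real.exp (-(κ * (k * a ^ 2) / 16) * ‖h₁‖ ^ 2)) := by
          rw [setLIntegral_const, volume_unitCell]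
      _ ≤ _ := by
          refine setLIntegral_mono' (measurableSet_unitCell n) fun h hh => ?_
          refine ENNReal.ofReal_le_ofReal (Real.exp_le_exp.2 ?_)
          -- Replacing `h₁` by the running point of the cell loses a factor 4 in the squared norm,
          -- which turns the constant 16 into 64.
          have h2 : ‖h‖ ≤ 2 * ‖h₁‖ := by
            have := norm_sub_le_of_mem_unitCell hh hn₁
            have h3 := norm_sub_norm_le h h₁
            linarith
          have h5 : ‖h‖ ^ 2 ≤ 4 * ‖h₁‖ ^ 2 := by
            have := pow_le_pow_left₀ (norm_nonneg h) h2 2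
            linarith
          have h6 : 0 ≤ κ * (k * a ^ 2) / 64 := by positivity
          nlinarith
  calc _ ≤ ∫⁻ y : Fin k → Y, ∑' n, (∫⁻ h in S' ∩ unitCell n, ∏ i, q h (y i)) ^ α *
      (∏ i, g (y i)) ^ (1 - α) ∂(Measure.pi fun _ => μ) := by
        refine lintegral_mono fun y => ?_
        rw [ENNReal.tsum_mul_right, hsum]
        gcongr
        exact ENNReal_tsum_rpow_le _ hα₀ hα₁.le
    _ = ∑' n, ∫⁻ y : Fin k → Y, (∫⁻ h in S' ∩ unitCell n, ∏ i, q h (y i)) ^ α *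
      (∏ i, g (y i)) ^ (1 - α) ∂(Measure.pi fun _ => μ) := by
        refine lintegral_tsum fun n => ?_
        exact ((hqk.lintegral_prod_right'.pow_const _).mul (by fun_prop)).aemeasurable
    _ ≤ ∑' n, ∫⁻ h in {h | R / 2 < ‖h‖} ∩ unitCell n,
        ENNReal.ofReal (Real.exp (-(κ * (k * a ^ 2) / 64) * ‖h‖ ^ 2)) :=
        ENNReal.tsum_le_tsum hcell
    _ = _ := by
        have hm : MeasurableSet {h : Param d | R / 2 < ‖h‖} :=
          measurableSet_lt measurable_const measurable_norm
        rw [← lintegral_iUnion (fun n => hm.inter (measurableSet_unitCell n))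
          (fun m n hmn => (pairwise_disjoint_unitCell hmn).mono Set.inter_subset_right
            Set.inter_subset_right), ← Set.inter_iUnion, iUnion_unitCell, Set.inter_univ]

theorem tendsto_gaussian_tail {c : ℝ} (hc : 0 < c) :
    Tendsto (fun R : ℝ => ∫⁻ h : Param d in {h | R / 2 < ‖h‖},
      ENNReal.ofReal (Real.exp (-c * ‖h‖ ^ 2))) atTop (𝓝 0) := by
  have hint : Integrable (fun h : Param d => Real.exp (-c * ‖h‖ ^ 2)) := by
    have := GaussianFourier.integrable_cexp_neg_mul_sq_norm_add (V := Param d) (b := c)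
      (by simpa using hc) 0 0
    refine this.norm.congr (ae_of_all _ fun h => ?_)
    simp [Complex.norm_exp, ← Complex.ofReal_pow]
  have hm : ∀ R : ℝ, MeasurableSet {h : Param d | R / 2 < ‖h‖} := fun R =>
    measurableSet_lt measurable_const measurable_norm
  simp_rw [← lintegral_indicator (hm _)]
  have := tendsto_lintegral_filter_of_dominated_convergence (l := atTop) (μ := (volume : Measure (Param d)))
    (F := fun (R : ℝ) => Set.indicator {h : Param d | R / 2 < ‖h‖} fun h =>
      ENNReal.ofReal (Real.exp (-c * ‖h‖ ^ 2))) (f := 0)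
    (fun h => ENNReal.ofReal (Real.exp (-c * ‖h‖ ^ 2)))
    (Eventually.of_forall fun R => (by fun_prop : Measurable _).indicator (hm R))
    (Eventually.of_forall fun R => ae_of_all _ fun h => Set.indicator_le_self _ _ _)
    hint.lintegral_lt_top.ne
    (ae_of_all _ fun h => by
      refine tendsto_const_nhds.congr' ?_
      filter_upwards [eventually_ge_atTop (2 * ‖h‖)] with R hR
      rw [Set.indicator_of_notMem]
      · rfl
      · simp only [Set.mem_ofPred_eq, not_lt]
        linarith)
  simpa using this

end Tail

/-! ### Second-order Taylor estimates. -/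

section Taylor

variable {E : Type*} [NormedAddCommGroup E] [NormedSpace ℝ E]

/-- Mean value inequality on [0,1] for t ↦ f(x+th) minus its quadratic expansion. Asking only for a
linear bound on the error of f' lets the same estimate serve with small C, for the Peano remainder,
and with a fixed C, for domination by an integrable function. -/
theorem abs_taylor_two_le {f : E → ℝ} {f' : E → E →L[ℝ] ℝ} {V : E →L[ℝ] E →L[ℝ] ℝ} {x : E}
    {r C : ℝ} (hf : ∀ z ∈ Metric.ball x r, HasFDerivAt f (f' z) z) (hC : 0 ≤ C)
    (hV : ∀ h, ‖h‖ < r → ‖f' (x + h) - f' x - V h‖ ≤ C * ‖h‖) {h : E} (hh : ‖h‖ < r) :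
    |f (x + h) - f x - f' x h - V h h / 2| ≤ C * ‖h‖ ^ 2 := by
  have hd : ∀ t ∈ Set.Icc (0 : ℝ) 1, HasDerivWithinAt
      (fun t : ℝ => f (x + t • h) - t * f' x h - t ^ 2 * V h h / 2)
      (f' (x + t • h) h - f' x h - t * V h h) (Set.Icc 0 1) t := by
    intro t ht
    have hlt : ‖t • h‖ < r := by
      rw [norm_smul, Real.norm_of_nonneg ht.1]
      exact (mul_le_of_le_one_left (norm_nonneg h) ht.2).trans_lt hh
    have hmem : x + t • h ∈ Metric.ball x r := by simpa using hlt
    have h1 : HasDerivAt (fun t : ℝ => x + t • h) h t := by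
      simpa using ((hasDerivAt_id t).smul_const h).const_add x
    have h2 := (hf _ hmem).comp_hasDerivAt t h1
    have h3 : HasDerivAt (fun t : ℝ => t * f' x h) (f' x h) t := by
      simpa using (hasDerivAt_id t).mul_const (f' x h)
    have h4 : HasDerivAt (fun t : ℝ => t ^ 2 * V h h / 2) (t * V h h) t := by
      refine (((hasDerivAt_pow 2 t).mul_const (V h h)).div_const 2).congr_deriv ?_
      norm_num
      ring
    exact ((h2.sub h3).sub h4).hasDerivWithinAt
  have hb : ∀ t ∈ Set.Icc (0 : ℝ) 1, ‖f' (x + t • h) h - f' x h - t * V h h‖ ≤ C * ‖h‖ ^ 2 := by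
    intro t ht
    have hlt : ‖t • h‖ ≤ ‖h‖ := by
      rw [norm_smul, Real.norm_of_nonneg ht.1]
      exact mul_le_of_le_one_left (norm_nonneg h) ht.2
    have e : f' (x + t • h) h - f' x h - t * V h h = (f' (x + t • h) - f' x - V (t • h)) h := by
      simp
    rw [e]
    refine (ContinuousLinearMap.le_opNorm _ _).trans ?_
    rw [sq, ← mul_assoc]
    gcongr
    exact (hV _ (hlt.trans_lt hh)).trans (by gcongr)
  have := (convex_Icc (0 : ℝ) 1).norm_image_sub_le_of_norm_hasDerivWithin_le hd hb
    (Set.left_mem_Icc.2 zero_le_one) (Set.right_mem_Icc.2 zero_le_one)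
  simp only [one_smul, one_mul, one_pow, zero_smul, zero_mul, add_zero, sub_zero, norm_one, mul_one,
    Real.norm_eq_abs, ne_eq, OfNat.ofNat_ne_zero, not_false_eq_true, zero_pow, zero_div] at this
  convert this using 2
  ring

theorem isLittleO_taylor_two {f : E → ℝ} {f' : E → E →L[ℝ] ℝ} {V : E →L[ℝ] E →L[ℝ] ℝ} {x : E}
    (hf : ∀ᶠ z in 𝓝 x, HasFDerivAt f (f' z) z) (hV : HasFDerivAt f' V x) :
    (fun h => f (x + h) - f x - f' x h - V h h / 2) =o[𝓝 0] fun h => ‖h‖ ^ 2 := by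
  rw [Asymptotics.isLittleO_iff]
  intro c hc
  have h1 := (hasFDerivAt_iff_isLittleO_nhds_zero.1 hV).def hc
  obtain ⟨r₁, hr₁, H₁⟩ := Metric.eventually_nhds_iff_ball.1 hf
  obtain ⟨r₂, hr₂, H₂⟩ := Metric.eventually_nhds_iff_ball.1 h1
  filter_upwards [Metric.ball_mem_nhds (0 : E) (lt_min hr₁ hr₂)] with h hh
  rw [mem_ball_zero_iff] at hh
  have := abs_taylor_two_le (f := f) (f' := f') (V := V) (x := x) (r := min r₁ r₂) (C := c)
    (fun z hz => H₁ z (Metric.ball_subset_ball (min_le_left _ _) hz)) hc.le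
    (fun h hh => H₂ h (by simpa using hh.trans_le (min_le_right _ _))) hh
  simpa using this

/-- Presents second derivatives as limits of sequences of elementary expressions. This yields both
their measurability in the observation and, by dominated convergence, their expectations. -/
theorem tendsto_taylor_two {f : E → ℝ} {f' : E → E →L[ℝ] ℝ} {V : E →L[ℝ] E →L[ℝ] ℝ} {x : E}
    (hf : ∀ᶠ z in 𝓝 x, HasFDerivAt f (f' z) z) (hV : HasFDerivAt f' V x) (u : E) :
    Tendsto (fun n : ℕ => (n : ℝ) ^ 2 * (f (x + (n : ℝ)⁻¹ • u) - f x - (n : ℝ)⁻¹ * f' x u)) atTop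
      (𝓝 (V u u / 2)) := by
  have h0 : Tendsto (fun n : ℕ => (n : ℝ)⁻¹ • u) atTop (𝓝 0) := by
    simpa using (tendsto_inv_atTop_nhds_zero_nat (𝕜 := ℝ)).smul_const u
  have h1 := (isLittleO_taylor_two hf hV).comp_tendsto h0
  have h2 : (fun n : ℕ => ‖(n : ℝ)⁻¹ • u‖ ^ 2) =O[atTop] fun n : ℕ => ((n : ℝ) ^ 2)⁻¹ := by
    refine Asymptotics.IsBigO.of_bound (‖u‖ ^ 2) (Eventually.of_forall fun n => ?_)
    simp only [norm_smul, norm_inv, RCLike.norm_natCast, norm_pow, norm_mul, norm_norm]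
    exact le_of_eq (by ring)
  have h3 := (h1.trans_isBigO h2).tendsto_div_nhds_zero
  have h4 := h3.add_const (V u u / 2)
  rw [zero_add] at h4
  refine h4.congr' ?_
  filter_upwards [eventually_gt_atTop 0] with n hn
  have : (n : ℝ) ≠ 0 := by positivity
  simp only [Function.comp_apply, map_smul, smul_eq_mul, smul_apply]
  field_simp
  ring

theorem tendsto_taylor_one {f : E → ℝ} {f' : E →L[ℝ] ℝ} {x : E} (hf : HasFDerivAt f f' x) (u : E) :
    Tendsto (fun n : ℕ => (n : ℝ) * (f (x + (n : ℝ)⁻¹ • u) - f x)) atTop (𝓝 (f' u)) := by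
  simpa [Function.comp_def] using (hf.lim_real u).comp tendsto_natCast_atTop_atTop

end Taylor

/-! ### Derivative estimates for a single observation. -/

section Regularity

variable {d : ℕ} {Y : Type*}

/-- The observation `y` has a positive and smooth likelihood on a ball, with derivatives of the
log-likelihood dominated by `c`. -/
structure IsNiceObs (ℓ : Param d → Y → ℝ) (θ₀ : Param d) (r c : ℝ) (y : Y) : Prop where
  pos : ∀ θ ∈ Metric.ball θ₀ r, 0 < ℓ θ y
  contDiff : ContDiffOn ℝ 2 (fun θ => ℓ θ y) (Metric.ball θ₀ r)
  score_le : ∀ θ ∈ Metric.ball θ₀ r, ∀ θ' ∈ Metric.ball θ₀ r, ℓ θ y * ‖score ℓ y θ'‖ ^ 2 ≤ c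
  scoreDeriv_le : ∀ θ ∈ Metric.ball θ₀ r, ∀ θ' ∈ Metric.ball θ₀ r, ℓ θ y * ‖scoreDeriv ℓ y θ'‖ ≤ c

variable {ℓ : Param d → Y → ℝ} {θ₀ θ : Param d} {r c : ℝ} {y : Y}

namespace IsNiceObs

theorem contDiffAt_log (h : IsNiceObs ℓ θ₀ r c y) (hθ : θ ∈ Metric.ball θ₀ r) :
    ContDiffAt ℝ 2 (fun t => Real.log (ℓ t y)) θ :=
  (h.contDiff.contDiffAt (Metric.isOpen_ball.mem_nhds hθ)).log (h.pos θ hθ).ne'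

theorem hasFDerivAt_log (h : IsNiceObs ℓ θ₀ r c y) (hθ : θ ∈ Metric.ball θ₀ r) :
    HasFDerivAt (fun t => Real.log (ℓ t y)) (score ℓ y θ) θ :=
  ((h.contDiffAt_log hθ).differentiableAt (by norm_num)).hasFDerivAt

theorem hasFDerivAt_score (h : IsNiceObs ℓ θ₀ r c y) (hθ : θ ∈ Metric.ball θ₀ r) :
    HasFDerivAt (score ℓ y) (scoreDeriv ℓ y θ) θ :=
  (((h.contDiffAt_log hθ).fderiv_right (m := 1) (by norm_num)).differentiableAt
    (by norm_num)).hasFDerivAt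

theorem scoreDeriv_symm (h : IsNiceObs ℓ θ₀ r c y) (hθ : θ ∈ Metric.ball θ₀ r) (u v : Param d) :
    scoreDeriv ℓ y θ u v = scoreDeriv ℓ y θ v u :=
  (h.contDiffAt_log hθ).isSymmSndFDerivAt (by simp) u v

theorem hasFDerivAt_lik (h : IsNiceObs ℓ θ₀ r c y) (hθ : θ ∈ Metric.ball θ₀ r) :
    HasFDerivAt (fun t => ℓ t y) (ℓ θ y • score ℓ y θ) θ := by
  have h1 := (h.hasFDerivAt_log hθ).exp
  rw [Real.exp_log (h.pos θ hθ)] at h1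
  refine h1.congr_of_eventuallyEq ?_
  filter_upwards [Metric.isOpen_ball.mem_nhds hθ] with t ht
  rw [Real.exp_log (h.pos t ht)]

/-- The second derivative of the likelihood. -/
theorem hasFDerivAt_lik_score (h : IsNiceObs ℓ θ₀ r c y) (hθ : θ ∈ Metric.ball θ₀ r) :
    HasFDerivAt (fun t => ℓ t y • score ℓ y t)
      (ℓ θ y • scoreDeriv ℓ y θ + (ℓ θ y • score ℓ y θ).smulRight (score ℓ y θ)) θ :=
  (h.hasFDerivAt_lik hθ).smul (h.hasFDerivAt_score hθ)

theorem norm_lik_deriv_two_le (h : IsNiceObs ℓ θ₀ r c y) (hθ : θ ∈ Metric.ball θ₀ r) :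
    ‖ℓ θ y • scoreDeriv ℓ y θ + (ℓ θ y • score ℓ y θ).smulRight (score ℓ y θ)‖ ≤ 2 * c := by
  refine (ContinuousLinearMap.opNorm_add_le _ _).trans ?_
  rw [ContinuousLinearMap.norm_smulRight_apply, norm_smul, norm_smul,
    Real.norm_of_nonneg (h.pos θ hθ).le]
  have h1 := h.score_le θ hθ θ hθ
  have h2 := h.scoreDeriv_le θ hθ θ hθ
  linarith

theorem nonneg (h : IsNiceObs ℓ θ₀ r c y) (hr : 0 < r) : 0 ≤ c :=
  le_trans (mul_nonneg (h.pos θ₀ (Metric.mem_ball_self hr)).le (sq_nonneg _))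
    (h.score_le θ₀ (Metric.mem_ball_self hr) θ₀ (Metric.mem_ball_self hr))

/-- The domination hypothesis bounds the gradient √ℓ · score / 2 of √ℓ by √c/2, so √ℓ is Lipschitz.
Multiplying by the sum of the two roots and using 2√c√ℓ ≤ c + ℓ leaves an integrable bound. -/
theorem abs_lik_sub_le (h : IsNiceObs ℓ θ₀ r c y) (hr : 0 < r) {θ' : Param d}
    (hθ : θ ∈ Metric.ball θ₀ r) (hθ' : θ' ∈ Metric.ball θ₀ r) :
    |ℓ θ y - ℓ θ' y| ≤ ‖θ - θ'‖ * ((2 * c + ℓ θ y + ℓ θ' y) / 4) := by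
  have hd : ∀ t ∈ Metric.ball θ₀ r, HasFDerivWithinAt (fun t => √(ℓ t y))
      ((1 / (2 * √(ℓ t y))) • ℓ t y • score ℓ y t) (Metric.ball θ₀ r) t := fun t ht =>
    ((h.hasFDerivAt_lik ht).sqrt (h.pos t ht).ne').hasFDerivWithinAt
  have hb : ∀ t ∈ Metric.ball θ₀ r, ‖(1 / (2 * √(ℓ t y))) • ℓ t y • score ℓ y t‖ ≤ √c / 2 := by
    intro t ht
    have hp := h.pos t ht
    have hs : 0 < √(ℓ t y) := Real.sqrt_pos.2 hp
    have e : (1 / (2 * √(ℓ t y))) * ℓ t y = √(ℓ t y) / 2 := by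
      field_simp
      rw [Real.sq_sqrt hp.le]
    rw [smul_smul, e, norm_smul, Real.norm_of_nonneg (by positivity), div_mul_eq_mul_div]
    gcongr
    rw [← Real.sqrt_sq (norm_nonneg (score ℓ y t)), ← Real.sqrt_mul hp.le]
    exact Real.sqrt_le_sqrt (h.score_le t ht t ht)
  have h1 := (convex_ball θ₀ r).norm_image_sub_le_of_norm_hasFDerivWithin_le hd hb hθ' hθ
  have hc := h.nonneg hr
  set a := √(ℓ θ y)
  set b := √(ℓ θ' y)
  have ea : ℓ θ y = a ^ 2 := (Real.sq_sqrt (h.pos θ hθ).le).symm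
  have eb : ℓ θ' y = b ^ 2 := (Real.sq_sqrt (h.pos θ' hθ').le).symm
  have ec : c = √c ^ 2 := (Real.sq_sqrt hc).symm
  have ha : 0 ≤ a := Real.sqrt_nonneg _
  have hb' : 0 ≤ b := Real.sqrt_nonneg _
  rw [ea, eb, sq_sub_sq, abs_mul, abs_of_nonneg (by positivity), mul_comm]
  rw [Real.norm_eq_abs] at h1
  calc |a - b| * (a + b) ≤ (√c / 2 * ‖θ - θ'‖) * (a + b) := by gcongr
    _ = ‖θ - θ'‖ * (√c / 2 * (a + b)) := by ring
    _ ≤ _ := by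
      gcongr
      nlinarith [sq_nonneg (√c - a), sq_nonneg (√c - b)]

theorem norm_lik_score_sub_le (h : IsNiceObs ℓ θ₀ r c y) (hr : 0 < r) {v : Param d} (hv : ‖v‖ < r) :
    ‖ℓ (θ₀ + v) y • score ℓ y (θ₀ + v) - ℓ θ₀ y • score ℓ y θ₀ -
      (ℓ θ₀ y • scoreDeriv ℓ y θ₀ + (ℓ θ₀ y • score ℓ y θ₀).smulRight (score ℓ y θ₀)) v‖ ≤
      4 * c * ‖v‖ := by
  have h0 := Metric.mem_ball_self (x := θ₀) hr
  have h1 := (convex_ball θ₀ r).norm_image_sub_le_of_norm_hasFDerivWithin_le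
    (fun t ht => (h.hasFDerivAt_lik_score ht).hasFDerivWithinAt)
    (fun t ht => h.norm_lik_deriv_two_le ht) h0 (y := θ₀ + v) (by simpa using hv)
  have h2 := ContinuousLinearMap.le_of_opNorm_le _ (h.norm_lik_deriv_two_le h0) v
  rw [add_sub_cancel_left] at h1
  refine (norm_sub_le _ _).trans ?_
  linarith

/-- The hypothesis allows the likelihood and the second derivative at different points of the ball.
With the likelihood taken at the centre, `scoreDeriv` is bounded throughout the ball by c / ℓ θ₀ y,
which is integrable under the law at θ₀ when c is the dominating function. -/
theorem norm_score_sub_le (h : IsNiceObs ℓ θ₀ r c y) (hr : 0 < r) {v : Param d} (hv : ‖v‖ < r) :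
    ‖score ℓ y (θ₀ + v) - score ℓ y θ₀ - scoreDeriv ℓ y θ₀ v‖ ≤ 2 * (c / ℓ θ₀ y) * ‖v‖ := by
  have h0 := Metric.mem_ball_self (x := θ₀) hr
  have hb : ∀ t ∈ Metric.ball θ₀ r, ‖scoreDeriv ℓ y t‖ ≤ c / ℓ θ₀ y := fun t ht => by
    rw [le_div_iff₀ (h.pos θ₀ h0), mul_comm]
    exact h.scoreDeriv_le θ₀ h0 t ht
  have h1 := (convex_ball θ₀ r).norm_image_sub_le_of_norm_hasFDerivWithin_le
    (fun t ht => (h.hasFDerivAt_score ht).hasFDerivWithinAt) hb h0 (y := θ₀ + v) (by simpa using hv)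
  have h2 := ContinuousLinearMap.le_of_opNorm_le _ (hb θ₀ h0) v
  rw [add_sub_cancel_left] at h1
  refine (norm_sub_le _ _).trans ?_
  linarith

theorem eventually_hasFDerivAt_log (h : IsNiceObs ℓ θ₀ r c y) (hr : 0 < r) :
    ∀ᶠ t in 𝓝 θ₀, HasFDerivAt (fun t => Real.log (ℓ t y)) (score ℓ y t) t := by
  filter_upwards [Metric.ball_mem_nhds θ₀ hr] with t ht using h.hasFDerivAt_log ht

theorem eventually_hasFDerivAt_lik (h : IsNiceObs ℓ θ₀ r c y) (hr : 0 < r) :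
    ∀ᶠ t in 𝓝 θ₀, HasFDerivAt (fun t => ℓ t y) (ℓ t y • score ℓ y t) t := by
  filter_upwards [Metric.ball_mem_nhds θ₀ hr] with t ht using h.hasFDerivAt_lik ht

end IsNiceObs

end Regularity

/-! ### Centred score and the two forms of the Fisher information. -/

section FisherInformation

variable {d : ℕ} {Y : Type*} [MeasurableSpace Y] {μ : Measure Y} {ℓ : Param d → Y → ℝ}

theorem IsRegularOn.exists_isNiceObs {Θ U : Set (Param d)} (h : IsRegularOn μ ℓ Θ U) {θ₀ : Param d}
    (hθ₀ : θ₀ ∈ Θ) : ∃ r > 0, Metric.ball θ₀ r ⊆ U ∧ ∃ G : Y → ℝ, Integrable G μ ∧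
      ∀ᵐ y ∂μ, IsNiceObs ℓ θ₀ r (G y) y := by
  obtain ⟨r, hr, hU, G, hG, hd⟩ := h.dominated θ₀ hθ₀
  refine ⟨r, hr, hU, G, hG, ?_⟩
  filter_upwards [h.pos, h.contDiff, hd] with y h1 h2 h3
  exact ⟨fun θ hθ => h1 θ (hU hθ), h2.mono hU, fun θ hθ θ' hθ' => (h3 θ hθ θ' hθ').1,
    fun θ hθ θ' hθ' => (h3 θ hθ θ' hθ').2⟩

/-- A statistical model which is regular in a ball around `θ₀`. -/
structure IsLocallyRegular (μ : Measure Y) (ℓ : Param d → Y → ℝ) (θ₀ : Param d) (r : ℝ)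
    (G : Y → ℝ) : Prop where
  measurable : Measurable (Function.uncurry ℓ)
  r_pos : 0 < r
  integrable_bound : Integrable G μ
  nice : ∀ᵐ y ∂μ, IsNiceObs ℓ θ₀ r (G y) y
  density : ∀ θ ∈ Metric.ball θ₀ r, ∫⁻ y, ENNReal.ofReal (ℓ θ y) ∂μ = 1

theorem IsRegularOn.exists_isLocallyRegular {Θ U : Set (Param d)} (h : IsRegularOn μ ℓ Θ U)
    {θ₀ : Param d} (hθ₀ : θ₀ ∈ Θ) : ∃ r G, IsLocallyRegular μ ℓ θ₀ r G := by
  obtain ⟨r, hr, hU, G, hG, hn⟩ := h.exists_isNiceObs hθ₀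
  exact ⟨r, G, h.measurable, hr, hG, hn, fun θ hθ => h.density θ (hU hθ)⟩

namespace IsLocallyRegular

variable {θ₀ θ : Param d} {r : ℝ} {G : Y → ℝ}

theorem mem_ball (h : IsLocallyRegular μ ℓ θ₀ r G) : θ₀ ∈ Metric.ball θ₀ r :=
  Metric.mem_ball_self h.r_pos

theorem measurable_lik (h : IsLocallyRegular μ ℓ θ₀ r G) (θ : Param d) : Measurable (ℓ θ) :=
  h.measurable.comp (measurable_const.prodMk measurable_id)

theorem integrable_lik (h : IsLocallyRegular μ ℓ θ₀ r G) (hθ : θ ∈ Metric.ball θ₀ r) :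
    Integrable (ℓ θ) μ := by
  refine ⟨(h.measurable_lik θ).aestronglyMeasurable, ?_⟩
  rw [hasFiniteIntegral_iff_ofReal (h.nice.mono fun y hy => (hy.pos θ hθ).le), h.density θ hθ]
  exact ENNReal.one_lt_top

theorem integral_lik (h : IsLocallyRegular μ ℓ θ₀ r G) (hθ : θ ∈ Metric.ball θ₀ r) :
    ∫ y, ℓ θ y ∂μ = 1 := by
  rw [integral_eq_lintegral_of_nonneg_ae (h.nice.mono fun y hy => (hy.pos θ hθ).le)
    (h.measurable_lik θ).aestronglyMeasurable, h.density θ hθ, ENNReal.toReal_one]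

theorem aemeasurable_score (h : IsLocallyRegular μ ℓ θ₀ r G) (u : Param d) :
    AEMeasurable (fun y => score ℓ y θ₀ u) μ := by
  have hm := h.measurable_lik
  refine aemeasurable_of_tendsto_metrizable_ae atTop (f := fun (n : ℕ) y =>
    (n : ℝ) * (Real.log (ℓ (θ₀ + (n : ℝ)⁻¹ • u) y) - Real.log (ℓ θ₀ y))) (fun n => ?_) ?_
  · exact (((hm _).log.sub (hm _).log).const_mul _).aemeasurable
  · filter_upwards [h.nice] with y hy
    exact tendsto_taylor_one (hy.hasFDerivAt_log h.mem_ball) u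

theorem aemeasurable_scoreDeriv (h : IsLocallyRegular μ ℓ θ₀ r G) (u v : Param d) :
    AEMeasurable (fun y => scoreDeriv ℓ y θ₀ u v) μ := by
  have hm := h.measurable_lik
  have hdiag : ∀ w, AEMeasurable (fun y => scoreDeriv ℓ y θ₀ w w / 2) μ := by
    intro w
    refine aemeasurable_of_tendsto_metrizable_ae atTop (f := fun (n : ℕ) y =>
      (n : ℝ) ^ 2 * (Real.log (ℓ (θ₀ + (n : ℝ)⁻¹ • w) y) - Real.log (ℓ θ₀ y) -
        (n : ℝ)⁻¹ * score ℓ y θ₀ w)) (fun n => ?_) ?_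
    · exact ((((hm _).log.sub (hm _).log).aemeasurable).sub
        ((h.aemeasurable_score w).const_mul _)).const_mul _
    · filter_upwards [h.nice] with y hy
      exact tendsto_taylor_two (hy.eventually_hasFDerivAt_log h.r_pos)
        (hy.hasFDerivAt_score h.mem_ball) w
  -- Polarisation, using the symmetry of the second derivative.
  refine (((hdiag (u + v)).sub (hdiag u)).sub (hdiag v)).congr ?_
  filter_upwards [h.nice] with y hy
  have := hy.scoreDeriv_symm h.mem_ball u v
  simp only [Pi.sub_apply, map_add, add_apply]
  linarith

theorem integrable_score_mul_lik (h : IsLocallyRegular μ ℓ θ₀ r G) (u : Param d) :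
    Integrable (fun y => score ℓ y θ₀ u * ℓ θ₀ y) μ := by
  refine Integrable.mono' (g := fun y => ‖u‖ * (ℓ θ₀ y + G y))
    (((h.integrable_lik h.mem_ball).add h.integrable_bound).const_mul _)
    ((h.aemeasurable_score u).mul (h.measurable_lik _).aemeasurable).aestronglyMeasurable ?_
  filter_upwards [h.nice] with y hy
  have h1 := hy.score_le θ₀ h.mem_ball θ₀ h.mem_ball
  have h0 := hy.pos θ₀ h.mem_ball
  rw [norm_mul, Real.norm_of_nonneg h0.le]
  calc ‖score ℓ y θ₀ u‖ * ℓ θ₀ y ≤ (‖score ℓ y θ₀‖ * ‖u‖) * ℓ θ₀ y := by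
        gcongr; exact ContinuousLinearMap.le_opNorm _ _
    _ = ‖u‖ * (‖score ℓ y θ₀‖ * ℓ θ₀ y) := by ring
    _ ≤ _ := by
        gcongr
        nlinarith [sq_nonneg (‖score ℓ y θ₀‖ - 1)]

theorem integrable_score_sq_mul_lik (h : IsLocallyRegular μ ℓ θ₀ r G) (u : Param d) :
    Integrable (fun y => score ℓ y θ₀ u ^ 2 * ℓ θ₀ y) μ := by
  refine Integrable.mono' (g := fun y => ‖u‖ ^ 2 * G y) (h.integrable_bound.const_mul _)
    (((h.aemeasurable_score u).pow_const 2).mul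
      (h.measurable_lik _).aemeasurable).aestronglyMeasurable ?_
  filter_upwards [h.nice] with y hy
  have h1 := hy.score_le θ₀ h.mem_ball θ₀ h.mem_ball
  have h0 := hy.pos θ₀ h.mem_ball
  rw [norm_mul, Real.norm_of_nonneg h0.le, norm_pow]
  calc ‖score ℓ y θ₀ u‖ ^ 2 * ℓ θ₀ y ≤ (‖score ℓ y θ₀‖ * ‖u‖) ^ 2 * ℓ θ₀ y := by
        gcongr; exact ContinuousLinearMap.le_opNorm _ _
    _ = ‖u‖ ^ 2 * (ℓ θ₀ y * ‖score ℓ y θ₀‖ ^ 2) := by ring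
    _ ≤ _ := by gcongr

theorem integrable_scoreDeriv_mul_lik (h : IsLocallyRegular μ ℓ θ₀ r G) (u v : Param d) :
    Integrable (fun y => scoreDeriv ℓ y θ₀ u v * ℓ θ₀ y) μ := by
  refine Integrable.mono' (g := fun y => ‖u‖ * ‖v‖ * G y) (h.integrable_bound.const_mul _)
    ((h.aemeasurable_scoreDeriv u v).mul (h.measurable_lik _).aemeasurable).aestronglyMeasurable ?_
  filter_upwards [h.nice] with y hy
  have h1 := hy.scoreDeriv_le θ₀ h.mem_ball θ₀ h.mem_ball
  have h0 := hy.pos θ₀ h.mem_ball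
  rw [norm_mul, Real.norm_of_nonneg h0.le]
  calc ‖scoreDeriv ℓ y θ₀ u v‖ * ℓ θ₀ y ≤ (‖scoreDeriv ℓ y θ₀‖ * ‖u‖ * ‖v‖) * ℓ θ₀ y := by
        gcongr; exact ContinuousLinearMap.le_opNorm₂ _ _ _
    _ = ‖u‖ * ‖v‖ * (ℓ θ₀ y * ‖scoreDeriv ℓ y θ₀‖) := by ring
    _ ≤ _ := by gcongr

/-- The second-order Taylor remainder of the likelihood along `u`. -/
theorem abs_lik_remainder_le (h : IsLocallyRegular μ ℓ θ₀ r G) {u : Param d} :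
    ∀ᶠ n : ℕ in atTop, ∀ᵐ y ∂μ, |(n : ℝ) ^ 2 * (ℓ (θ₀ + (n : ℝ)⁻¹ • u) y - ℓ θ₀ y -
      (n : ℝ)⁻¹ * (ℓ θ₀ y • score ℓ y θ₀) u)| ≤ 5 * ‖u‖ ^ 2 * G y := by
  have h0 : Tendsto (fun n : ℕ => (n : ℝ)⁻¹ • u) atTop (𝓝 0) := by
    simpa using (tendsto_inv_atTop_nhds_zero_nat (𝕜 := ℝ)).smul_const u
  filter_upwards [h0 (Metric.ball_mem_nhds 0 h.r_pos), eventually_gt_atTop 0] with n hn hn0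
  have hn' : (n : ℝ) ≠ 0 := by positivity
  filter_upwards [h.nice] with y hy
  have hG := hy.nonneg h.r_pos
  have hlt : ‖(n : ℝ)⁻¹ • u‖ < r := by simpa using hn
  have h1 := abs_taylor_two_le (fun z hz => hy.hasFDerivAt_lik hz) (C := 4 * G y) (by positivity)
    (fun v hv => hy.norm_lik_score_sub_le h.r_pos hv) hlt
  have h2 := ContinuousLinearMap.le_opNorm₂ (ℓ θ₀ y • scoreDeriv ℓ y θ₀ +
    (ℓ θ₀ y • score ℓ y θ₀).smulRight (score ℓ y θ₀)) u u
  have h3 := hy.norm_lik_deriv_two_le h.mem_ball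
  set V := ℓ θ₀ y • scoreDeriv ℓ y θ₀ + (ℓ θ₀ y • score ℓ y θ₀).smulRight (score ℓ y θ₀) with hV
  rw [Real.norm_eq_abs] at h2
  have h4 : |V u u| ≤ 2 * G y * ‖u‖ ^ 2 := by
    rw [sq, ← mul_assoc]
    exact h2.trans (by gcongr)
  have e : (n : ℝ) ^ 2 * (ℓ (θ₀ + (n : ℝ)⁻¹ • u) y - ℓ θ₀ y -
      (n : ℝ)⁻¹ * (ℓ θ₀ y • score ℓ y θ₀) u) =
      (n : ℝ) ^ 2 * (ℓ (θ₀ + (n : ℝ)⁻¹ • u) y - ℓ θ₀ y - (ℓ θ₀ y • score ℓ y θ₀) ((n : ℝ)⁻¹ • u) -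
        V ((n : ℝ)⁻¹ • u) ((n : ℝ)⁻¹ • u) / 2) + V u u / 2 := by
    simp only [map_smul, smul_apply, smul_eq_mul]
    field_simp
    ring
  rw [e]
  refine (abs_add_le _ _).trans ?_
  rw [abs_mul, abs_of_nonneg (by positivity), abs_div, abs_two]
  have h5 : (n : ℝ) ^ 2 * (4 * G y * ‖(n : ℝ)⁻¹ • u‖ ^ 2) = 4 * G y * ‖u‖ ^ 2 := by
    rw [norm_smul, norm_inv, RCLike.norm_natCast]
    field_simp
  have h6 := mul_le_mul_of_nonneg_left h1 (sq_nonneg (n : ℝ))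
  linarith

theorem tendsto_mem_ball (h : IsLocallyRegular μ ℓ θ₀ r G) (u : Param d) :
    ∀ᶠ n : ℕ in atTop, θ₀ + (n : ℝ)⁻¹ • u ∈ Metric.ball θ₀ r := by
  have h0 : Tendsto (fun n : ℕ => θ₀ + (n : ℝ)⁻¹ • u) atTop (𝓝 θ₀) := by
    simpa using ((tendsto_inv_atTop_nhds_zero_nat (𝕜 := ℝ)).smul_const u).const_add θ₀
  exact h0 (Metric.ball_mem_nhds θ₀ h.r_pos)

/-- Both likelihoods integrate to one, so only the linear term survives, with a factor n. This
drives both identities for the score. -/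
theorem integral_lik_remainder (h : IsLocallyRegular μ ℓ θ₀ r G) (u : Param d) :
    ∀ᶠ n : ℕ in atTop, ∫ y, (n : ℝ) ^ 2 * (ℓ (θ₀ + (n : ℝ)⁻¹ • u) y - ℓ θ₀ y -
      (n : ℝ)⁻¹ * (ℓ θ₀ y • score ℓ y θ₀) u) ∂μ = -(n : ℝ) * ∫ y, score ℓ y θ₀ u * ℓ θ₀ y ∂μ := by
  filter_upwards [h.tendsto_mem_ball u, eventually_gt_atTop 0] with n hn hn0
  have hn' : (n : ℝ) ≠ 0 := by positivity
  have hi := (h.integrable_score_mul_lik u).const_mul (n : ℝ)⁻¹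
  simp only [smul_apply, smul_eq_mul, mul_comm (ℓ θ₀ _)]
  have hs : Integrable (fun y => ℓ (θ₀ + (n : ℝ)⁻¹ • u) y - ℓ θ₀ y) μ :=
    (h.integrable_lik hn).sub (h.integrable_lik h.mem_ball)
  rw [integral_const_mul, integral_sub hs hi, integral_sub (h.integrable_lik hn) (h.integrable_lik h.mem_ball), h.integral_lik hn,
    h.integral_lik h.mem_ball, integral_const_mul]
  field_simp
  ring

/-- The integral of the rescaled remainder is -n times the mean of the score, yet it is bounded in n
by `abs_lik_remainder_le`. Hence the mean vanishes, without differentiating under the integral sign.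
-/
theorem integral_score_mul_lik (h : IsLocallyRegular μ ℓ θ₀ r G) (u : Param d) :
    ∫ y, score ℓ y θ₀ u * ℓ θ₀ y ∂μ = 0 := by
  by_contra hne
  have h1 : ∀ᶠ n : ℕ in atTop,
      (n : ℝ) * |∫ y, score ℓ y θ₀ u * ℓ θ₀ y ∂μ| ≤ ∫ y, 5 * ‖u‖ ^ 2 * G y ∂μ := by
    filter_upwards [h.integral_lik_remainder u, h.abs_lik_remainder_le (u := u)] with n h1 h2
    simp_rw [← Real.norm_eq_abs] at h2 ⊢
    have := norm_integral_le_of_norm_le (h.integrable_bound.const_mul (5 * ‖u‖ ^ 2)) h2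
    rw [h1, norm_mul, norm_neg, RCLike.norm_natCast] at this
    exact this
  have h2 : Tendsto (fun n : ℕ => (n : ℝ) * |∫ y, score ℓ y θ₀ u * ℓ θ₀ y ∂μ|) atTop atTop :=
    tendsto_natCast_atTop_atTop.atTop_mul_const (abs_pos.2 hne)
  obtain ⟨n, hn, hn'⟩ := (h1.and (h2.eventually_gt_atTop _)).exists
  exact absurd hn (not_le.2 hn')

/-- Once the score is centred, the remainder integrals are eventually zero, while dominated
convergence sends them to half the integral of the second derivative of ℓ, which is ℓ times
`scoreDeriv` plus the square of the score. -/
theorem integral_scoreDeriv_mul_lik (h : IsLocallyRegular μ ℓ θ₀ r G) (u : Param d) :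
    ∫ y, scoreDeriv ℓ y θ₀ u u * ℓ θ₀ y ∂μ = -∫ y, score ℓ y θ₀ u ^ 2 * ℓ θ₀ y ∂μ := by
  have hlim : Tendsto (fun n : ℕ => ∫ y, (n : ℝ) ^ 2 * (ℓ (θ₀ + (n : ℝ)⁻¹ • u) y - ℓ θ₀ y -
      (n : ℝ)⁻¹ * (ℓ θ₀ y • score ℓ y θ₀) u) ∂μ) atTop
      (𝓝 (∫ y, (ℓ θ₀ y • scoreDeriv ℓ y θ₀ +
        (ℓ θ₀ y • score ℓ y θ₀).smulRight (score ℓ y θ₀)) u u / 2 ∂μ)) := by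
    refine tendsto_integral_filter_of_dominated_convergence (fun y => 5 * ‖u‖ ^ 2 * G y)
      (Eventually.of_forall fun n => ?_) h.abs_lik_remainder_le (h.integrable_bound.const_mul _) ?_
    · simp only [smul_apply, smul_eq_mul]
      have := h.measurable_lik
      exact (((((this _).sub (this _)).aemeasurable).sub
        (((this _).aemeasurable.mul (h.aemeasurable_score u)).const_mul _)).const_mul
          _).aestronglyMeasurable
    · filter_upwards [h.nice] with y hy
      exact tendsto_taylor_two (hy.eventually_hasFDerivAt_lik h.r_pos)
        (hy.hasFDerivAt_lik_score h.mem_ball) u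
  have h0 : ∫ y, (ℓ θ₀ y • scoreDeriv ℓ y θ₀ +
        (ℓ θ₀ y • score ℓ y θ₀).smulRight (score ℓ y θ₀)) u u / 2 ∂μ = 0 := by
    refine tendsto_nhds_unique hlim (tendsto_const_nhds.congr' ?_)
    filter_upwards [h.integral_lik_remainder u] with n hn
    rw [hn, h.integral_score_mul_lik, mul_zero]
  have e : ∀ y, (ℓ θ₀ y • scoreDeriv ℓ y θ₀ +
        (ℓ θ₀ y • score ℓ y θ₀).smulRight (score ℓ y θ₀)) u u / 2 =
      (scoreDeriv ℓ y θ₀ u u * ℓ θ₀ y + score ℓ y θ₀ u ^ 2 * ℓ θ₀ y) / 2 := by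
    intro y
    simp only [add_apply, smul_apply, smul_eq_mul, ContinuousLinearMap.smulRight_apply]
    ring
  simp_rw [e] at h0
  rw [integral_div, integral_add (h.integrable_scoreDeriv_mul_lik u u)
    (h.integrable_score_sq_mul_lik u)] at h0
  linarith

/-- The quadratic form of the Fisher information is the second moment of the score. -/
theorem sum_fisher (h : IsLocallyRegular μ ℓ θ₀ r G) (u : Param d) :
    ∑ i, ∑ j, u i * u j * fisher μ ℓ θ₀ i j = ∫ y, score ℓ y θ₀ u ^ 2 * ℓ θ₀ y ∂μ := by
  have hu : u = ∑ i, u i • EuclideanSpace.single i (1 : ℝ) := by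
    conv_lhs => rw [← (EuclideanSpace.basisFun (Fin d) ℝ).sum_repr u]
    simp
  have e : ∀ y, scoreDeriv ℓ y θ₀ u u * ℓ θ₀ y = ∑ i, ∑ j, u i * u j *
      (scoreDeriv ℓ y θ₀ (EuclideanSpace.single i 1) (EuclideanSpace.single j 1) * ℓ θ₀ y) := by
    intro y
    conv_lhs => rw [hu]
    simp only [map_sum, map_smul, sum_apply, smul_apply, smul_eq_mul, Finset.sum_mul, Finset.mul_sum]
    rw [Finset.sum_comm]
    refine Finset.sum_congr rfl fun i _ => Finset.sum_congr rfl fun j _ => ?_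
    ring
  rw [← neg_eq_iff_eq_neg.2 (h.integral_scoreDeriv_mul_lik u)]
  simp_rw [e]
  rw [integral_finsetSum _ fun i _ => integrable_finsetSum _ fun j _ =>
    (h.integrable_scoreDeriv_mul_lik _ _).const_mul _, ← Finset.sum_neg_distrib]
  refine Finset.sum_congr rfl fun i _ => ?_
  rw [integral_finsetSum _ fun j _ => (h.integrable_scoreDeriv_mul_lik _ _).const_mul _,
    ← Finset.sum_neg_distrib]
  refine Finset.sum_congr rfl fun j _ => ?_
  rw [integral_const_mul, fisher, Matrix.of_apply]
  ring

end IsLocallyRegular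

end FisherInformation

/-! ### L¹ distance of densities compared with the distance of parameters. -/

section Separation

variable {d : ℕ} {Y : Type*}

/-- The likelihood, with values in `[0, ∞]`. -/
def lik (ℓ : Param d → Y → ℝ) (θ : Param d) (y : Y) : ℝ≥0∞ := ENNReal.ofReal (ℓ θ y)

variable [MeasurableSpace Y] {μ : Measure Y} {ℓ : Param d → Y → ℝ}

theorem measurable_uncurry_lik (hℓ : Measurable (Function.uncurry ℓ)) :
    Measurable (Function.uncurry (lik ℓ)) := hℓ.ennreal_ofReal

theorem measurable_lik (hℓ : Measurable (Function.uncurry ℓ)) (θ : Param d) :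
    Measurable (lik ℓ θ) :=
  (measurable_uncurry_lik hℓ).comp (measurable_const.prodMk measurable_id)

theorem ofReal_sub_add_ofReal_sub {a b : ℝ} (ha : 0 ≤ a) (hb : 0 ≤ b) :
    (ENNReal.ofReal a - ENNReal.ofReal b) + (ENNReal.ofReal b - ENNReal.ofReal a) =
      ENNReal.ofReal |a - b| := by
  rcases le_total a b with h | h
  · rw [tsub_eq_zero_of_le (ENNReal.ofReal_le_ofReal h), zero_add, abs_of_nonpos (by linarith),
      neg_sub, ENNReal.ofReal_sub _ ha]
  · rw [tsub_eq_zero_of_le (ENNReal.ofReal_le_ofReal h), add_zero, abs_of_nonneg (by linarith),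
      ENNReal.ofReal_sub _ hb]

theorem l1Dist_lik {θ θ' : Param d} (h : ∀ᵐ y ∂μ, 0 ≤ ℓ θ y) (h' : ∀ᵐ y ∂μ, 0 ≤ ℓ θ' y) :
    l1Dist μ (lik ℓ θ) (lik ℓ θ') = ∫⁻ y, ENNReal.ofReal |ℓ θ y - ℓ θ' y| ∂μ := by
  refine lintegral_congr_ae ?_
  filter_upwards [h, h'] with y hy hy'
  exact ofReal_sub_add_ofReal_sub hy hy'

theorem sum_mul_mul_eq_dotProduct (M : Matrix (Fin d) (Fin d) ℝ) (u : Param d) :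
    ∑ i, ∑ j, u i * u j * M i j = u.ofLp ⬝ᵥ M.mulVec u.ofLp := by
  simp only [dotProduct, Matrix.mulVec, Finset.mul_sum]
  refine Finset.sum_congr rfl fun i _ => Finset.sum_congr rfl fun j _ => ?_
  ring

namespace IsLocallyRegular

variable {θ₀ θ θ' : Param d} {r : ℝ} {G : Y → ℝ}

theorem ae_nonneg (h : IsLocallyRegular μ ℓ θ₀ r G) (hθ : θ ∈ Metric.ball θ₀ r) :
    ∀ᵐ y ∂μ, 0 ≤ ℓ θ y := h.nice.mono fun _ hy => (hy.pos θ hθ).le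

theorem l1Dist_lik_le (h : IsLocallyRegular μ ℓ θ₀ r G) (hθ : θ ∈ Metric.ball θ₀ r)
    (hθ' : θ' ∈ Metric.ball θ₀ r) : l1Dist μ (lik ℓ θ) (lik ℓ θ') ≤
      ENNReal.ofReal ((∫ y, G y ∂μ + 1) / 2 * ‖θ - θ'‖) := by
  rw [l1Dist_lik (h.ae_nonneg hθ) (h.ae_nonneg hθ')]
  have h1 := h.integrable_bound.const_mul 2
  have h2 := h1.add (h.integrable_lik hθ)
  have h3 : Integrable (fun y => 2 * G y + ℓ θ y + ℓ θ' y) μ := h2.add (h.integrable_lik hθ')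
  have hi : Integrable (fun y => ‖θ - θ'‖ * ((2 * G y + ℓ θ y + ℓ θ' y) / 4)) μ :=
    (h3.div_const 4).const_mul _
  have e : (∫ y, G y ∂μ + 1) / 2 * ‖θ - θ'‖ =
      ∫ y, ‖θ - θ'‖ * ((2 * G y + ℓ θ y + ℓ θ' y) / 4) ∂μ := by
    rw [integral_const_mul, integral_div, integral_add (f := fun y => 2 * G y + ℓ θ y) h2
      (h.integrable_lik hθ'), integral_add h1 (h.integrable_lik hθ), integral_const_mul,
      h.integral_lik hθ, h.integral_lik hθ']
    ring
  have hle : ∀ᵐ y ∂μ, |ℓ θ y - ℓ θ' y| ≤ ‖θ - θ'‖ * ((2 * G y + ℓ θ y + ℓ θ' y) / 4) :=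
    h.nice.mono fun y hy => hy.abs_lik_sub_le h.r_pos hθ hθ'
  rw [e, ofReal_integral_eq_lintegral_ofReal hi (hle.mono fun y hy => (abs_nonneg _).trans hy)]
  exact lintegral_mono_ae (hle.mono fun y hy => ENNReal.ofReal_le_ofReal hy)

theorem score_sq_pos (h : IsLocallyRegular μ ℓ θ₀ r G) (hI : (fisher μ ℓ θ₀).PosDef) {u : Param d}
    (hu : u ≠ 0) : 0 < ∫ y, score ℓ y θ₀ u ^ 2 * ℓ θ₀ y ∂μ := by
  have h1 := hI.dotProduct_mulVec_pos (x := WithLp.ofLp u) (by simpa using hu)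
  rw [← h.sum_fisher, sum_mul_mul_eq_dotProduct]
  simpa using h1

/-- Near a point with non-degenerate information, parameters are separated by the `L¹` distance. -/
theorem exists_le_l1Dist (h : IsLocallyRegular μ ℓ θ₀ r G) (hI : (fisher μ ℓ θ₀).PosDef) :
    ∃ a > 0, ∃ s > 0, ∀ θ ∈ Metric.ball θ₀ s, ∀ θ' ∈ Metric.ball θ₀ s,
      ENNReal.ofReal (a * ‖θ - θ'‖) ≤ l1Dist μ (lik ℓ θ) (lik ℓ θ') := by
  by_contra! hcon
  have hpos : ∀ n : ℕ, (0 : ℝ) < 1 / (n + 1) := fun n => Nat.one_div_pos_of_nat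
  have hcon' : ∀ n : ℕ, ∃ θ ∈ Metric.ball θ₀ (min r (1 / (n + 1))),
      ∃ θ' ∈ Metric.ball θ₀ (min r (1 / (n + 1))),
      l1Dist μ (lik ℓ θ) (lik ℓ θ') < ENNReal.ofReal (1 / (n + 1) * ‖θ - θ'‖) := fun n =>
    hcon _ (hpos n) _ (lt_min h.r_pos (hpos n))
  choose a ha b hb hab using hcon'
  have hball : ∀ n : ℕ, Metric.ball θ₀ (min r (1 / (n + 1))) ⊆ Metric.ball θ₀ r := fun n =>
    Metric.ball_subset_ball (min_le_left _ _)
  have hne : ∀ n, a n - b n ≠ 0 := by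
    intro n h0
    have := hab n
    simp [h0] at this
  have hdpos : ∀ n, 0 < ‖a n - b n‖ := fun n => norm_pos_iff.2 (hne n)
  have hlim : ∀ c : ℕ → Param d, (∀ n : ℕ, c n ∈ Metric.ball θ₀ (min r (1 / (n + 1)))) →
      Tendsto c atTop (𝓝 θ₀) := by
    intro c hc
    refine tendsto_iff_dist_tendsto_zero.2 (squeeze_zero (fun _ => dist_nonneg) (fun n => ?_)
      tendsto_one_div_add_atTop_nhds_zero_nat)
    exact (hc n).le.trans (min_le_right _ _)
  -- Were separation to fail near θ₀, there would be pairs tending to θ₀ whose L¹ distance is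
  -- negligible against their Euclidean distance. The unit sphere provides a limiting direction u.
  obtain ⟨u, hu, φ, hφ, hφu⟩ := (isCompact_sphere (0 : Param d) 1).tendsto_subseq
    (x := fun n => ‖a n - b n‖⁻¹ • (a n - b n))
    (fun n => by simp [norm_smul, (hdpos n).ne'])
  have hu0 : u ≠ 0 := by
    rintro rfl
    simp at hu
  have hpt : ∀ᵐ y ∂μ, Tendsto (fun n => ENNReal.ofReal (‖a (φ n) - b (φ n)‖⁻¹ *
      |ℓ (a (φ n)) y - ℓ (b (φ n)) y|)) atTop (𝓝 (ENNReal.ofReal |(ℓ θ₀ y • score ℓ y θ₀) u|)) := by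
    filter_upwards [h.nice] with y hy
    refine (ENNReal.continuous_ofReal.tendsto _).comp ?_
    -- Both points of the pair move, so the quotient converges only thanks to strict
    -- differentiability, available from the C² assumption.
    have hstrict : HasStrictFDerivAt (fun t => ℓ t y) (ℓ θ₀ y • score ℓ y θ₀) θ₀ :=
      (hy.contDiff.contDiffAt (Metric.isOpen_ball.mem_nhds h.mem_ball)).hasStrictFDerivAt'
        (hy.hasFDerivAt_lik h.mem_ball) (by norm_num)
    have h1 := (hstrict.isLittleO.comp_tendsto (((hlim a ha).prodMk_nhds (hlim b hb)).comp
      hφ.tendsto_atTop)).norm_right.tendsto_div_nhds_zero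
    have h2 := ((ℓ θ₀ y • score ℓ y θ₀).continuous.tendsto u).comp hφu
    have h3 := (h1.add h2).abs
    rw [zero_add] at h3
    refine h3.congr fun n => ?_
    have := (hdpos (φ n)).ne'
    simp only [Function.comp_apply, map_smul, smul_eq_mul]
    rw [← abs_of_pos (inv_pos.2 (hdpos (φ n))), ← abs_mul]
    congr 1
    field_simp
    rw [abs_of_pos (by positivity)]
    field_simp
    ring
  -- By Fatou the derivative of the likelihood along u is null in L¹. The score then vanishes almost
  -- everywhere along u, against positive definiteness of the information.
  have hfatou : ∫⁻ y, ENNReal.ofReal |(ℓ θ₀ y • score ℓ y θ₀) u| ∂μ ≤ 0 := by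
    have hm := h.measurable_lik
    calc _ = ∫⁻ y, liminf (fun n => ENNReal.ofReal (‖a (φ n) - b (φ n)‖⁻¹ *
            |ℓ (a (φ n)) y - ℓ (b (φ n)) y|)) atTop ∂μ :=
          lintegral_congr_ae (hpt.mono fun y hy => hy.liminf_eq.symm)
      _ ≤ liminf (fun n => ∫⁻ y, ENNReal.ofReal (‖a (φ n) - b (φ n)‖⁻¹ *
            |ℓ (a (φ n)) y - ℓ (b (φ n)) y|) ∂μ) atTop :=
          lintegral_liminf_le fun n =>
            ((((hm _).sub (hm _)).abs).const_mul _).ennreal_ofReal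
      _ ≤ liminf (fun n : ℕ => ENNReal.ofReal (1 / ((φ n : ℝ) + 1))) atTop := by
          refine liminf_le_liminf (Eventually.of_forall fun n => ?_)
          simp_rw [ENNReal.ofReal_mul (inv_nonneg.2 (norm_nonneg _))]
          rw [lintegral_const_mul (f := fun y => ENNReal.ofReal |ℓ (a (φ n)) y - ℓ (b (φ n)) y|) _
              (((hm _).sub (hm _)).abs).ennreal_ofReal,
            ← l1Dist_lik (h.ae_nonneg (hball _ (ha _))) (h.ae_nonneg (hball _ (hb _)))]
          refine (mul_le_mul_right (hab (φ n)).le _).trans ?_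
          rw [← ENNReal.ofReal_mul (inv_nonneg.2 (norm_nonneg _))]
          refine ENNReal.ofReal_le_ofReal (le_of_eq ?_)
          have := (hdpos (φ n)).ne'
          field_simp
      _ = 0 := by
          have h1 := (ENNReal.continuous_ofReal.tendsto _).comp
            ((tendsto_one_div_add_atTop_nhds_zero_nat (𝕜 := ℝ)).comp hφ.tendsto_atTop)
          rw [ENNReal.ofReal_zero] at h1
          exact h1.liminf_eq
  have hae : AEMeasurable (fun y => ENNReal.ofReal |(ℓ θ₀ y • score ℓ y θ₀) u|) μ := by
    simp only [smul_apply, smul_eq_mul]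
    exact ((h.measurable_lik θ₀).aemeasurable.mul (h.aemeasurable_score u)).abs.ennreal_ofReal
  have hz := (lintegral_eq_zero_iff' hae).1 (le_antisymm hfatou bot_le)
  refine (h.score_sq_pos hI hu0).ne' ?_
  rw [integral_eq_zero_of_ae]
  filter_upwards [hz, h.nice] with y hy hy'
  have : (ℓ θ₀ y • score ℓ y θ₀) u = 0 := by
    simpa [ENNReal.ofReal_eq_zero] using hy
  have h0 := (hy'.pos θ₀ h.mem_ball).ne'
  simp only [smul_apply, smul_eq_mul, mul_eq_zero, h0, false_or] at this
  simp [this]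

end IsLocallyRegular

theorem IsRegularOn.lintegral_lik {Θ U : Set (Param d)} (h : IsRegularOn μ ℓ Θ U) {θ : Param d}
    (hθ : θ ∈ Θ) : ∫⁻ y, lik ℓ θ y ∂μ = 1 := h.density θ (h.subset hθ)

theorem IsRegularOn.l1Dist_le_two {Θ U : Set (Param d)} (h : IsRegularOn μ ℓ Θ U) {θ θ' : Param d}
    (hθ : θ ∈ Θ) (hθ' : θ' ∈ Θ) : l1Dist μ (lik ℓ θ) (lik ℓ θ') ≤ ENNReal.ofReal 2 := by
  refine (l1Dist_le (RefPrior.measurable_lik h.measurable θ)).trans ?_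
  rw [h.lintegral_lik hθ, h.lintegral_lik hθ']
  norm_num

/-- On a compact set, the `L¹` distance of the densities is bounded by the distance of the
parameters. -/
theorem IsRegularOn.exists_l1Dist_le {Θ U K : Set (Param d)} (h : IsRegularOn μ ℓ Θ U)
    (hK : IsCompact K) (hKΘ : K ⊆ Θ) : ∃ b ≥ 0, ∀ θ ∈ K, ∀ θ' ∈ K,
      l1Dist μ (lik ℓ θ) (lik ℓ θ') ≤ ENNReal.ofReal (b * ‖θ - θ'‖) := by
  have key : ∃ b ≥ 0, ∃ δ > 0, ∀ θ ∈ K, ∀ θ' ∈ K, ‖θ - θ'‖ < δ →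
      l1Dist μ (lik ℓ θ) (lik ℓ θ') ≤ ENNReal.ofReal (b * ‖θ - θ'‖) := by
    refine hK.induction_on (p := fun s => ∃ b ≥ 0, ∃ δ > 0, ∀ θ ∈ s, ∀ θ' ∈ K, ‖θ - θ'‖ < δ →
      l1Dist μ (lik ℓ θ) (lik ℓ θ') ≤ ENNReal.ofReal (b * ‖θ - θ'‖)) ?_ ?_ ?_ ?_
    · exact ⟨0, le_rfl, 1, one_pos, by simp⟩
    · rintro s t hst ⟨b, hb, δ, hδ, H⟩
      exact ⟨b, hb, δ, hδ, fun θ hθ => H θ (hst hθ)⟩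
    · rintro s t ⟨b, hb, δ, hδ, H⟩ ⟨b', hb', δ', hδ', H'⟩
      refine ⟨max b b', le_max_of_le_left hb, min δ δ', lt_min hδ hδ', ?_⟩
      rintro θ (hθ | hθ) θ' hθ' hlt
      · exact (H θ hθ θ' hθ' (hlt.trans_le (min_le_left _ _))).trans
          (ENNReal.ofReal_le_ofReal (by gcongr; exact le_max_left _ _))
      · exact (H' θ hθ θ' hθ' (hlt.trans_le (min_le_right _ _))).trans
          (ENNReal.ofReal_le_ofReal (by gcongr; exact le_max_right _ _))
    · intro x hx
      obtain ⟨r, G, hr⟩ := h.exists_isLocallyRegular (hKΘ hx)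
      have hr0 := hr.r_pos
      refine ⟨Metric.ball x (r / 2), mem_nhdsWithin_of_mem_nhds (Metric.ball_mem_nhds x (by linarith)),
        max 0 ((∫ y, G y ∂μ + 1) / 2), le_max_left _ _, r / 2, by linarith, ?_⟩
      intro θ hθ θ' _ hlt
      rw [mem_ball_iff_norm] at hθ
      have h1 : θ ∈ Metric.ball x r := mem_ball_iff_norm.2 (by linarith)
      have h2 : θ' ∈ Metric.ball x r := by
        rw [mem_ball_iff_norm, show θ' - x = (θ - x) - (θ - θ') by abel]
        exact (norm_sub_le _ _).trans_lt (by linarith)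
      exact (hr.l1Dist_lik_le h1 h2).trans
        (ENNReal.ofReal_le_ofReal (by gcongr; exact le_max_right _ _))
  obtain ⟨b, hb, δ, hδ, H⟩ := key
  -- Pairs at distance at least δ are handled by the trivial bound 2 on the L¹ distance.
  refine ⟨max b (2 / δ), le_max_of_le_left hb, fun θ hθ θ' hθ' => ?_⟩
  rcases lt_or_ge ‖θ - θ'‖ δ with hlt | hge
  · exact (H θ hθ θ' hθ' hlt).trans (ENNReal.ofReal_le_ofReal (by gcongr; exact le_max_left _ _))
  · refine (h.l1Dist_le_two (hKΘ hθ) (hKΘ hθ')).trans (ENNReal.ofReal_le_ofReal ?_)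
    calc (2 : ℝ) = 2 / δ * δ := by field_simp
      _ ≤ _ := by gcongr; exact le_max_right _ _

/-- On a compact set, the distance of the parameters is bounded by a multiple of the `L¹` distance
of the densities. -/
theorem IsRegularOn.exists_le_l1Dist {Θ U K : Set (Param d)} (h : IsRegularOn μ ℓ Θ U)
    (hK : IsCompact K) (hKΘ : K ⊆ Θ) : ∃ a > 0, ∀ θ ∈ K, ∀ θ' ∈ K,
      ENNReal.ofReal (a * ‖θ - θ'‖) ≤ l1Dist μ (lik ℓ θ) (lik ℓ θ') := by
  obtain ⟨b, hb, hbK⟩ := h.exists_l1Dist_le hK hKΘ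
  have hm := RefPrior.measurable_lik h.measurable
  have key : ∃ a > 0, ∀ p ∈ K ×ˢ K,
      ENNReal.ofReal (a * ‖p.1 - p.2‖) ≤ l1Dist μ (lik ℓ p.1) (lik ℓ p.2) := by
    refine (hK.prod hK).induction_on (p := fun s => ∃ a > 0, ∀ p ∈ s,
      ENNReal.ofReal (a * ‖p.1 - p.2‖) ≤ l1Dist μ (lik ℓ p.1) (lik ℓ p.2)) ?_ ?_ ?_ ?_
    · exact ⟨1, one_pos, by simp⟩
    · rintro s t hst ⟨a, ha, H⟩
      exact ⟨a, ha, fun p hp => H p (hst hp)⟩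
    · rintro s t ⟨a, ha, H⟩ ⟨a', ha', H'⟩
      refine ⟨min a a', lt_min ha ha', ?_⟩
      rintro p (hp | hp)
      · exact (ENNReal.ofReal_le_ofReal (by gcongr; exact min_le_left _ _)).trans (H p hp)
      · exact (ENNReal.ofReal_le_ofReal (by gcongr; exact min_le_right _ _)).trans (H' p hp)
    · rintro ⟨x, x'⟩ ⟨hx, hx'⟩
      -- Compactness of K × K: near the diagonal the local separation applies, and away from it
      -- identifiability gives a positive distance D.
      rcases eq_or_ne x x' with rfl | hne
      · obtain ⟨r, G, hr⟩ := h.exists_isLocallyRegular (hKΘ hx)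
        obtain ⟨a, ha, s, hs, H⟩ := hr.exists_le_l1Dist (h.fisher_posDef x (hKΘ hx))
        exact ⟨Metric.ball x s ×ˢ Metric.ball x s, mem_nhdsWithin_of_mem_nhds
          (prod_mem_nhds (Metric.ball_mem_nhds x hs) (Metric.ball_mem_nhds x hs)), a, ha,
          fun p hp => H p.1 hp.1 p.2 hp.2⟩
      · have hD : 0 < l1Dist μ (lik ℓ x) (lik ℓ x') := by
          rw [pos_iff_ne_zero]
          intro h0
          have hmeas : Measurable fun y => (lik ℓ x y - lik ℓ x' y) + (lik ℓ x' y - lik ℓ x y) := by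
            have := hm x
            have := hm x'
            fun_prop
          rw [l1Dist, lintegral_eq_zero_iff hmeas] at h0
          refine hne (h.identifiable x (hKΘ hx) x' (hKΘ hx') ?_)
          filter_upwards [h0, h.pos] with y hy hp
          have h1 := hp x (h.subset (hKΘ hx))
          have h2 := hp x' (h.subset (hKΘ hx'))
          have hy' : ENNReal.ofReal |ℓ x y - ℓ x' y| = 0 := by
            rw [← ofReal_sub_add_ofReal_sub h1.le h2.le]; exact hy
          rw [ENNReal.ofReal_eq_zero] at hy'
          exact sub_eq_zero.1 (abs_nonpos_iff.1 hy')
        set D := l1Dist μ (lik ℓ x) (lik ℓ x') with hDdef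
        have hDtop : D ≠ ∞ :=
          ((h.l1Dist_le_two (hKΘ hx) (hKΘ hx')).trans_lt ENNReal.ofReal_lt_top).ne
        have hDr : 0 < D.toReal := ENNReal.toReal_pos hD.ne' hDtop
        obtain ⟨M, hM, hMK⟩ := hK.isBounded.exists_pos_norm_le
        have hε : 0 < D.toReal / (4 * (b + 1)) := by positivity
        -- The radius makes each endpoint move by at most D/4 in L¹, so D/2 is left over. As ‖θ -
        -- θ'‖ ≤ 2M on K, the constant (D/2)/(2M) works.
        refine ⟨(Metric.ball x (D.toReal / (4 * (b + 1))) ×ˢ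
          Metric.ball x' (D.toReal / (4 * (b + 1)))) ∩ K ×ˢ K, inter_mem
            (mem_nhdsWithin_of_mem_nhds (prod_mem_nhds (Metric.ball_mem_nhds x hε)
              (Metric.ball_mem_nhds x' hε))) self_mem_nhdsWithin,
          D.toReal / 2 / (2 * M), by positivity, ?_⟩
        rintro ⟨θ, θ'⟩ ⟨⟨h1, h2⟩, h3, h4⟩
        simp only [mem_ball_iff_norm] at h1 h2
        have hsm : ∀ {z : ℝ}, z < D.toReal / (4 * (b + 1)) → b * z ≤ D.toReal / 4 := by
          intro z hz
          calc b * z ≤ b * (D.toReal / (4 * (b + 1))) := by gcongr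
            _ = D.toReal / 4 * (b / (b + 1)) := by field_simp
            _ ≤ D.toReal / 4 * 1 := by
              gcongr
              rw [div_le_one (by linarith)]
              linarith
            _ = _ := mul_one _
        have h5 := (hbK θ h3 x hx).trans (ENNReal.ofReal_le_ofReal (hsm h1))
        have h6 := (hbK θ' h4 x' hx').trans (ENNReal.ofReal_le_ofReal (hsm h2))
        rw [l1Dist_comm] at h5
        have h7 : D ≤ ENNReal.ofReal (D.toReal / 2) + l1Dist μ (lik ℓ θ) (lik ℓ θ') := by
          calc D ≤ l1Dist μ (lik ℓ x) (lik ℓ θ) + l1Dist μ (lik ℓ θ) (lik ℓ x') :=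
                l1Dist_triangle (hm _) (hm _)
            _ ≤ l1Dist μ (lik ℓ x) (lik ℓ θ) +
                (l1Dist μ (lik ℓ θ) (lik ℓ θ') + l1Dist μ (lik ℓ θ') (lik ℓ x')) := by
                gcongr
                exact l1Dist_triangle (hm _) (hm _)
            _ ≤ ENNReal.ofReal (D.toReal / 4) +
                (l1Dist μ (lik ℓ θ) (lik ℓ θ') + ENNReal.ofReal (D.toReal / 4)) := by gcongr
            _ = _ := by
                rw [add_comm (l1Dist _ _ _), ← add_assoc, ← ENNReal.ofReal_add (by positivity)
                  (by positivity)]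
                congr 2
                ring
        have h8 := tsub_le_iff_left.2 h7
        refine le_trans (le_trans (ENNReal.ofReal_le_ofReal (q := D.toReal / 2) ?_) (le_of_eq ?_)) h8
        · have h9 : ‖θ - θ'‖ ≤ 2 * M := (norm_sub_le _ _).trans
            (by linarith [hMK θ h3, hMK θ' h4])
          calc _ ≤ D.toReal / 2 / (2 * M) * (2 * M) := by gcongr
            _ = _ := by field_simp
        · calc ENNReal.ofReal (D.toReal / 2) =
                ENNReal.ofReal D.toReal - ENNReal.ofReal (D.toReal / 2) := by
                rw [← ENNReal.ofReal_sub _ (by positivity), sub_half]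
            _ = _ := by rw [ENNReal.ofReal_toReal hDtop]
  obtain ⟨a, ha, H⟩ := key
  exact ⟨a, ha, fun θ hθ θ' hθ' => H (θ, θ') ⟨hθ, hθ'⟩⟩

end Separation

/-! ### Local asymptotic normality. -/

section LocalExpansion

variable {d : ℕ} {Y : Type*} [MeasurableSpace Y]

/-- The remainder of a second-order expansion. -/
def expansionRem (lam : Param d → Y → ℝ) (s : Y → Param d) (V : Fin d → Fin d → Y → ℝ)
    (h : Param d) (y : Y) : ℝ :=
  lam h y - inner ℝ (s y) h - (∑ i, ∑ j, h i * h j * V i j y) / 2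

/-- A random function `lam` with an integrable second-order expansion at `0`, whose linear part
is centred with covariance `J` and whose quadratic part has mean `-J`. -/
structure QuadExpansion (P : Measure Y) (lam : Param d → Y → ℝ) (s : Y → Param d)
    (V : Fin d → Fin d → Y → ℝ) (J : Matrix (Fin d) (Fin d) ℝ) (H : Y → ℝ) (r : ℝ) : Prop where
  measurable_lam : Measurable (Function.uncurry lam)
  measurable_s : Measurable s
  measurable_V : ∀ i j, Measurable (V i j)
  r_pos : 0 < r
  integrable_H : Integrable H P
  integrable_V : ∀ i j, Integrable (V i j) P
  integral_V : ∀ i j, ∫ y, V i j y ∂P = -J i j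
  posDef : J.PosDef
  integral_s : ∀ t : Param d, ∫ y, inner ℝ (s y) t ∂P = 0
  integral_s_sq : ∀ t : Param d, ∫ y, inner ℝ (s y) t ^ 2 ∂P = ∑ i, ∑ j, t i * t j * J i j
  lam_zero : ∀ᵐ y ∂P, lam 0 y = 0
  continuousOn : ∀ᵐ y ∂P, ContinuousOn (fun h => lam h y) (Metric.ball 0 r)
  abs_rem_le : ∀ᵐ y ∂P, ∀ h, ‖h‖ < r → |expansionRem lam s V h y| ≤ H y * ‖h‖ ^ 2
  rem_isLittleO : ∀ᵐ y ∂P,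
    (fun h => expansionRem lam s V h y) =o[𝓝 0] fun h => ‖h‖ ^ 2

namespace QuadExpansion

variable {P : Measure Y} [IsProbabilityMeasure P] {lam : Param d → Y → ℝ} {s : Y → Param d}
  {V : Fin d → Fin d → Y → ℝ} {J : Matrix (Fin d) (Fin d) ℝ} {H : Y → ℝ} {r : ℝ}

theorem map_comp_eval {β : Type*} [MeasurableSpace β] {f : Y → β} (hf : Measurable f) (i : ℕ) :
    (Measure.infinitePi fun _ : ℕ => P).map (fun ω => f (ω i)) = P.map f := by
  have h1 := Measure.map_map (μ := Measure.infinitePi fun _ : ℕ => P) hf (measurable_pi_apply i)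
  rw [Measure.infinitePi_map_eval (fun _ : ℕ => P) i] at h1
  exact h1.symm

theorem identDistrib_eval {β : Type*} [MeasurableSpace β] {f : Y → β} (hf : Measurable f) (i : ℕ) :
    IdentDistrib (fun ω : ℕ → Y => f (ω i)) (fun ω => f (ω 0)) (Measure.infinitePi fun _ => P)
      (Measure.infinitePi fun _ => P) :=
  ⟨(hf.comp (measurable_pi_apply i)).aemeasurable, (hf.comp (measurable_pi_apply 0)).aemeasurable,
    (map_comp_eval hf i).trans (map_comp_eval hf 0).symm⟩

theorem ae_tendsto_average {f : Y → ℝ} (hf : Measurable f) (hi : Integrable f P) :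
    ∀ᵐ ω ∂(Measure.infinitePi fun _ : ℕ => P),
      Tendsto (fun n : ℕ => (∑ i ∈ Finset.range n, f (ω i)) / n) atTop (𝓝 (∫ y, f y ∂P)) := by
  have hp := measurePreserving_eval_infinitePi (fun _ : ℕ => P) 0
  have hind := iIndepFun_infinitePi (P := fun _ : ℕ => P) (X := fun _ => f) (fun _ => hf)
  have := strong_law_ae_real (μ := Measure.infinitePi fun _ : ℕ => P) (fun i ω => f (ω i))
    (hp.integrable_comp_of_integrable hi) (fun i j hij => hind.indepFun hij)
    (identDistrib_eval hf)
  have e : ∫ ω, f (ω 0) ∂(Measure.infinitePi fun _ : ℕ => P) = ∫ y, f y ∂P := by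
    have h1 := integral_map (μ := Measure.infinitePi fun _ : ℕ => P) hp.measurable.aemeasurable
      hf.aestronglyMeasurable
    rw [hp.map_eq] at h1
    exact h1.symm
  rwa [e] at this

/-- Uniform control of the remainder by averages of small functions. -/
theorem exists_modulus (h : QuadExpansion P lam s V J H r) :
    ∃ w : ℕ → Y → ℝ, (∀ n, Measurable (w n)) ∧ (∀ n, Integrable (w n) P) ∧
      Tendsto (fun n => ∫ y, w n y ∂P) atTop (𝓝 0) ∧ ∀ᵐ y ∂P, ∀ n : ℕ, ∀ v : Param d,
        ‖v‖ < r / (n + 1) → |expansionRem lam s V v y| ≤ w n y * ‖v‖ ^ 2 := by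
  set e := TopologicalSpace.denseSeq (Param d)
  have he : DenseRange e := TopologicalSpace.denseRange_denseSeq _
  have hrem : ∀ v, Measurable (expansionRem lam s V v) := by
    intro v
    have h1 : Measurable (lam v) := h.measurable_lam.comp (measurable_const.prodMk measurable_id)
    have h2 := h.measurable_s
    have h3 := h.measurable_V
    unfold expansionRem
    fun_prop
  -- The modulus is a supremum of normalised remainders over a countable dense set, hence
  -- measurable. It is dominated by H and tends to 0, so its mean tends to 0.
  let W : ℕ → Y → ℝ≥0∞ := fun n y => ⨆ m, if e m ≠ 0 ∧ ‖e m‖ < r / (n + 1) then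
    ENNReal.ofReal (|expansionRem lam s V (e m) y| / ‖e m‖ ^ 2) else 0
  have hWm : ∀ n, Measurable (W n) := fun n => Measurable.iSup fun m => by
    split_ifs
    · exact ((hrem _).abs.div_const _).ennreal_ofReal
    · exact measurable_const
  have hrn : ∀ n : ℕ, r / (n + 1) ≤ r := fun n =>
    div_le_self h.r_pos.le (by linarith [n.cast_nonneg (α := ℝ)])
  have hWH : ∀ᵐ y ∂P, ∀ n, W n y ≤ ENNReal.ofReal (H y) := by
    filter_upwards [h.abs_rem_le] with y hy n
    refine iSup_le fun m => ?_
    split_ifs with hm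
    · refine ENNReal.ofReal_le_ofReal ?_
      have : 0 < ‖e m‖ ^ 2 := by have := norm_pos_iff.2 hm.1; positivity
      rw [div_le_iff₀ this]
      exact hy _ (hm.2.trans_le (hrn n))
    · exact bot_le
  have hW0 : ∀ᵐ y ∂P, Tendsto (fun n => W n y) atTop (𝓝 0) := by
    filter_upwards [h.rem_isLittleO] with y hy
    rw [ENNReal.tendsto_nhds_zero]
    intro ε hε
    rcases eq_or_ne ε ∞ with rfl | hεt
    · simp
    have hε' : 0 < ε.toReal := ENNReal.toReal_pos hε.ne' hεt
    obtain ⟨δ, hδ, hδ'⟩ := Metric.eventually_nhds_iff_ball.1 (hy.def hε')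
    have hlim : Tendsto (fun n : ℕ => r / ((n : ℝ) + 1)) atTop (𝓝 0) := by
      simpa [div_eq_mul_inv] using
        (tendsto_one_div_add_atTop_nhds_zero_nat (𝕜 := ℝ)).const_mul r
    filter_upwards [hlim.eventually_lt_const hδ] with n hn
    refine iSup_le fun m => ?_
    split_ifs with hm
    · refine ENNReal.ofReal_le_of_le_toReal ?_
      have : 0 < ‖e m‖ ^ 2 := by have := norm_pos_iff.2 hm.1; positivity
      rw [div_le_iff₀ this]
      have := hδ' (e m) (by simpa using hm.2.trans hn)
      simpa using this
    · exact bot_le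
  have hHint : ∫⁻ y, ENNReal.ofReal (H y) ∂P ≠ ∞ := h.integrable_H.lintegral_lt_top.ne
  have hWlim : Tendsto (fun n => ∫⁻ y, W n y ∂P) atTop (𝓝 0) := by
    have := tendsto_lintegral_of_dominated_convergence (fun y => ENNReal.ofReal (H y)) hWm
      (fun n => hWH.mono fun y hy => hy n) hHint hW0
    simpa using this
  have hWfin : ∀ n, ∫⁻ y, W n y ∂P ≠ ∞ := fun n =>
    ((lintegral_mono_ae (hWH.mono fun y hy => hy n)).trans_lt hHint.lt_top).ne
  refine ⟨fun n y => (W n y).toReal, fun n => (hWm n).ennreal_toReal,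
    fun n => integrable_toReal_of_lintegral_ne_top (hWm n).aemeasurable (hWfin n), ?_, ?_⟩
  · have e1 : ∀ n, ∫ y, (W n y).toReal ∂P = (∫⁻ y, W n y ∂P).toReal := fun n =>
      integral_toReal (hWm n).aemeasurable (ae_lt_top (hWm n) (hWfin n))
    simp_rw [e1]
    simpa [Function.comp_def] using (ENNReal.tendsto_toReal ENNReal.zero_ne_top).comp hWlim
  · filter_upwards [hWH, h.continuousOn, h.lam_zero] with y hy hc h0 n v hv
    rcases eq_or_ne v 0 with rfl | hv0
    · simp [expansionRem, h0]
    have hWt : W n y ≠ ∞ := ((hy n).trans_lt ENNReal.ofReal_lt_top).ne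
    -- Continuity in v extends the bound from the dense sequence to every point of the punctured
    -- ball.
    set O : Set (Param d) := Metric.ball 0 (r / (n + 1)) ∩ {0}ᶜ with hO
    have hOo : IsOpen O := Metric.isOpen_ball.inter isOpen_compl_singleton
    have hvO : v ∈ O := ⟨by simpa using hv, hv0⟩
    have hOr : O ⊆ Metric.ball 0 r := fun x hx => Metric.ball_subset_ball (hrn n) hx.1
    have hcont : ContinuousOn (fun v => |expansionRem lam s V v y|) O := by
      have h1 := hc.mono hOr
      unfold expansionRem
      refine ContinuousOn.abs ?_
      refine (h1.sub (by fun_prop)).sub ?_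
      refine Continuous.continuousOn ?_
      fun_prop
    have hcl := he.open_subset_closure_inter hOo hvO
    refine ContinuousWithinAt.closure_le hcl ((hcont v hvO).mono Set.inter_subset_left)
      (Continuous.continuousWithinAt
      (f := fun v : Param d => (W n y).toReal * ‖v‖ ^ 2) (by fun_prop)) ?_
    rintro _ ⟨hx, ⟨m, rfl⟩⟩
    have hm : e m ≠ 0 ∧ ‖e m‖ < r / (n + 1) := ⟨hx.2, by simpa using hx.1⟩
    have : 0 < ‖e m‖ ^ 2 := by have := norm_pos_iff.2 hm.1; positivity
    rw [← div_le_iff₀ this, ← ENNReal.ofReal_le_iff_le_toReal hWt]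
    refine le_trans ?_ (le_iSup _ m)
    rw [if_pos hm]

/-- The normalised sum of the linear parts. -/
def normSum (s : Y → Param d) (k : ℕ) (ω : ℕ → Y) : Param d :=
  (√(k : ℝ))⁻¹ • ∑ i ∈ Finset.range k, s (ω i)

/-- Local asymptotic normality: almost surely, the sums of the local expansions are asymptotically
quadratic, uniformly on bounded sets. -/
theorem ae_expansion (h : QuadExpansion P lam s V J H r) :
    ∀ᵐ ω ∂(Measure.infinitePi fun _ : ℕ => P), ∀ R > 0, ∀ ε > 0, ∀ᶠ k : ℕ in atTop,
      ∀ v : Param d, ‖v‖ ≤ R →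
        |∑ i ∈ Finset.range k, lam ((√(k : ℝ))⁻¹ • v) (ω i) -
          (inner ℝ (normSum s k ω) v - (∑ i, ∑ j, v i * v j * J i j) / 2)| ≤ ε := by
  obtain ⟨w, hwm, hwi, hw0, hw⟩ := h.exists_modulus
  have hV : ∀ᵐ ω ∂(Measure.infinitePi fun _ : ℕ => P), ∀ i j, Tendsto (fun n : ℕ =>
      (∑ l ∈ Finset.range n, V i j (ω l)) / n) atTop (𝓝 (-J i j)) := by
    refine ae_all_iff.2 fun i => ae_all_iff.2 fun j => ?_
    rw [← h.integral_V i j]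
    exact ae_tendsto_average (h.measurable_V i j) (h.integrable_V i j)
  have hwl : ∀ᵐ ω ∂(Measure.infinitePi fun _ : ℕ => P), ∀ m : ℕ, Tendsto (fun n : ℕ =>
      (∑ l ∈ Finset.range n, w m (ω l)) / n) atTop (𝓝 (∫ y, w m y ∂P)) :=
    ae_all_iff.2 fun m => ae_tendsto_average (hwm m) (hwi m)
  have hwω : ∀ᵐ ω ∂(Measure.infinitePi fun _ : ℕ => P), ∀ l : ℕ, ∀ n : ℕ, ∀ v : Param d,
        ‖v‖ < r / (n + 1) → |expansionRem lam s V v (ω l)| ≤ w n (ω l) * ‖v‖ ^ 2 :=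
    ae_all_iff.2 fun l =>
      (measurePreserving_eval_infinitePi (fun _ : ℕ => P) l).quasiMeasurePreserving.ae hw
  filter_upwards [hV, hwl, hwω] with ω hV hwl hwω R hR ε hε
  -- The scale m is fixed first, so that `w m` has small mean; the strong law then controls its
  -- empirical average, and all v/√k with ‖v‖ ≤ R eventually enter the ball of radius r/(m+1). The
  -- other half of ε pays for replacing the empirical averages of V by -J.
  obtain ⟨m, hm⟩ := (hw0.eventually_lt_const (show 0 < ε / 2 / R ^ 2 by positivity)).exists
  have hVs : Tendsto (fun n : ℕ => ∑ i, ∑ j, |(∑ l ∈ Finset.range n, V i j (ω l)) / n + J i j|)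
      atTop (𝓝 0) := by
    have : Tendsto (fun n : ℕ => ∑ i, ∑ j, |(∑ l ∈ Finset.range n, V i j (ω l)) / n + J i j|)
        atTop (𝓝 (∑ i, ∑ j, |-J i j + J i j|)) :=
      tendsto_finsetSum _ fun i _ => tendsto_finsetSum _ fun j _ => ((hV i j).add_const _).abs
    simpa using this
  have hsm : Tendsto (fun k : ℕ => (√(k : ℝ))⁻¹ * R) atTop (𝓝 0) := by
    simpa using (tendsto_inv_atTop_zero.comp
      (Real.tendsto_sqrt_atTop.comp tendsto_natCast_atTop_atTop)).mul_const R
  have hrm : 0 < r / ((m : ℝ) + 1) := div_pos h.r_pos (by positivity)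
  filter_upwards [(hwl m).eventually_lt_const hm,
    hVs.eventually_lt_const (show 0 < ε / R ^ 2 by positivity),
    hsm.eventually_lt_const hrm, eventually_gt_atTop 0] with k h1 h2 h3 hk v hv
  have hk' : (0 : ℝ) < k := by exact_mod_cast hk
  have hsq : (√(k : ℝ))⁻¹ * (√(k : ℝ))⁻¹ = (k : ℝ)⁻¹ := by
    rw [← mul_inv, Real.mul_self_sqrt hk'.le]
  have hs0 : 0 < (√(k : ℝ))⁻¹ := by positivity
  have hnv : ‖(√(k : ℝ))⁻¹ • v‖ < r / (m + 1) := by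
    rw [norm_smul, Real.norm_of_nonneg hs0.le]
    exact (mul_le_mul_of_nonneg_left hv hs0.le).trans_lt h3
  have hv2 : ‖v‖ ^ 2 ≤ R ^ 2 := pow_le_pow_left₀ (norm_nonneg _) hv 2
  have e : ∑ i ∈ Finset.range k, lam ((√(k : ℝ))⁻¹ • v) (ω i) -
      (inner ℝ (normSum s k ω) v - (∑ i, ∑ j, v i * v j * J i j) / 2) =
      ∑ l ∈ Finset.range k, expansionRem lam s V ((√(k : ℝ))⁻¹ • v) (ω l) +
      (∑ i, ∑ j, v i * v j * ((∑ l ∈ Finset.range k, V i j (ω l)) / k + J i j)) / 2 := by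
    have e1 : inner ℝ (normSum s k ω) v =
        ∑ l ∈ Finset.range k, inner ℝ (s (ω l)) ((√(k : ℝ))⁻¹ • v) := by
      rw [normSum, real_inner_smul_left, sum_inner, Finset.mul_sum]
      simp only [real_inner_smul_right]
    have e2 : ∑ l ∈ Finset.range k, (∑ i, ∑ j, ((√(k : ℝ))⁻¹ • v) i * ((√(k : ℝ))⁻¹ • v) j *
        V i j (ω l)) = ∑ i, ∑ j, v i * v j * ((∑ l ∈ Finset.range k, V i j (ω l)) / k) := by
      rw [Finset.sum_comm]
      refine Finset.sum_congr rfl fun i _ => ?_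
      rw [Finset.sum_comm]
      refine Finset.sum_congr rfl fun j _ => ?_
      rw [div_eq_mul_inv, ← hsq, Finset.sum_mul, Finset.mul_sum]
      refine Finset.sum_congr rfl fun l _ => ?_
      simp only [PiLp.smul_apply, smul_eq_mul]
      ring
    have e3 : ∑ i, ∑ j, v i * v j * ((∑ l ∈ Finset.range k, V i j (ω l)) / k + J i j) =
        ∑ i, ∑ j, v i * v j * ((∑ l ∈ Finset.range k, V i j (ω l)) / k) +
          ∑ i, ∑ j, v i * v j * J i j := by
      simp only [mul_add, Finset.sum_add_distrib]
    simp only [expansionRem, Finset.sum_sub_distrib, ← Finset.sum_div]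
    rw [e2, e3, e1]
    ring
  have b1 : |∑ l ∈ Finset.range k, expansionRem lam s V ((√(k : ℝ))⁻¹ • v) (ω l)| ≤ ε / 2 := by
    calc _ ≤ ∑ l ∈ Finset.range k, w m (ω l) * ‖(√(k : ℝ))⁻¹ • v‖ ^ 2 :=
          (Finset.abs_sum_le_sum_abs _ _).trans (Finset.sum_le_sum fun l _ => hwω l m _ hnv)
      _ = (∑ l ∈ Finset.range k, w m (ω l)) / k * ‖v‖ ^ 2 := by
          rw [← Finset.sum_mul, norm_smul, Real.norm_of_nonneg hs0.le, mul_pow, sq (√(k : ℝ))⁻¹, hsq]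
          ring
      _ ≤ ε / 2 / R ^ 2 * R ^ 2 := by gcongr
      _ = ε / 2 := by field_simp
  have b2 : |(∑ i, ∑ j, v i * v j * ((∑ l ∈ Finset.range k, V i j (ω l)) / k + J i j)) / 2| ≤
      ε / 2 := by
    rw [abs_div, abs_two]
    gcongr
    calc _ ≤ ∑ i, ∑ j, R ^ 2 * |(∑ l ∈ Finset.range k, V i j (ω l)) / k + J i j| := by
          refine (Finset.abs_sum_le_sum_abs _ _).trans (Finset.sum_le_sum fun i _ => ?_)
          refine (Finset.abs_sum_le_sum_abs _ _).trans (Finset.sum_le_sum fun j _ => ?_)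
          rw [abs_mul, abs_mul, sq]
          have hi := PiLp.norm_apply_le v i
          have hj := PiLp.norm_apply_le v j
          rw [Real.norm_eq_abs] at hi hj
          gcongr
          · exact hi.trans hv
          · exact hj.trans hv
      _ = R ^ 2 * ∑ i, ∑ j, |(∑ l ∈ Finset.range k, V i j (ω l)) / k + J i j| := by
          simp only [Finset.mul_sum]
      _ ≤ R ^ 2 * (ε / R ^ 2) := by gcongr
      _ = ε := by field_simp
  rw [e]
  exact (abs_add_le _ _).trans (by linarith)

theorem measurable_normSum {s : Y → Param d} (hs : Measurable s) (k : ℕ) :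
    Measurable (normSum s k) := by
  unfold normSum
  fun_prop

/-- The central limit theorem for the linear parts. -/
theorem tendsto_integral_normSum (h : QuadExpansion P lam s V J H r)
    (F : BoundedContinuousFunction (Param d) ℝ) :
    Tendsto (fun k => ∫ ω, F (normSum s k ω) ∂(Measure.infinitePi fun _ : ℕ => P)) atTop
      (𝓝 (∫ x, F x ∂(multivariateGaussian 0 J))) := by
  have hms := measurable_normSum h.measurable_s
  let ν : ℕ → ProbabilityMeasure (Param d) := fun k =>
    ⟨(Measure.infinitePi fun _ : ℕ => P).map (normSum s k),
      Measure.isProbabilityMeasure_map (hms k).aemeasurable⟩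
  let γ : ProbabilityMeasure (Param d) := ⟨multivariateGaussian 0 J, inferInstance⟩
  have hlim : Tendsto ν atTop (𝓝 γ) := by
    refine ProbabilityMeasure.tendsto_iff_tendsto_charFun.2 fun t => ?_
    change Tendsto (fun k => charFun ((Measure.infinitePi fun _ : ℕ => P).map (normSum s k)) t) atTop
      (𝓝 (charFun (multivariateGaussian 0 J) t))
    rw [charFun_multivariateGaussian h.posDef.posSemidef]
    -- Cramér–Wold through characteristic functions: the projection on t is standardised by its
    -- variance, which is positive only for t ≠ 0.
    rcases eq_or_ne t 0 with rfl | ht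
    · have (k : ℕ) : IsProbabilityMeasure ((Measure.infinitePi fun _ : ℕ => P).map (normSum s k)) :=
        Measure.isProbabilityMeasure_map (hms k).aemeasurable
      simp
    set v := ∑ i, ∑ j, t i * t j * J i j with hv
    have hvpos : 0 < v := by
      rw [hv, sum_mul_mul_eq_dotProduct]
      simpa using h.posDef.dotProduct_mulVec_pos (x := WithLp.ofLp t) (by simpa using ht)
    have hsv : 0 < √v := Real.sqrt_pos.2 hvpos
    set X : Y → ℝ := fun y => inner ℝ (s y) t / √v with hX
    have hXm : Measurable X := by
      have := h.measurable_s
      fun_prop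
    have hind := iIndepFun_infinitePi (P := fun _ : ℕ => P) (X := fun _ => X) (fun _ => hXm)
    have hmap0 : (Measure.infinitePi fun _ : ℕ => P).map (fun ω => X (ω 0)) = P.map X :=
      map_comp_eval hXm 0
    have hXs : ∀ k : ℕ, Measurable fun ω : ℕ → Y =>
        (√(k : ℝ))⁻¹ * ∑ i ∈ Finset.range k, X (ω i) := fun k =>
      (Finset.measurable_sum _ fun i _ => hXm.comp (measurable_pi_apply i)).const_mul _
    have hc := tendsto_charFun_inv_sqrt_mul_pow (P := P) hXm.aemeasurable
      (by rw [hX, integral_div, h.integral_s, zero_div])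
      (by
        simp only [Pi.pow_apply, hX, div_pow]
        rw [integral_div, h.integral_s_sq, Real.sq_sqrt hvpos.le, div_self hvpos.ne']) (√v)
    have e1 : ∀ k : ℕ, charFun ((Measure.infinitePi fun _ : ℕ => P).map (normSum s k)) t =
        charFun (P.map X) ((√(k : ℝ))⁻¹ * √v) ^ k := by
      intro k
      have h1 := charFun_inv_sqrt_mul_sum (n := k) (t := √v) hind (identDistrib_eval hXm)
      rw [hmap0] at h1
      rw [← h1, charFun_apply, charFun_apply, integral_map (hms k).aemeasurable (by fun_prop),
        integral_map (hXs k).aemeasurable (by fun_prop)]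
      congr with ω
      congr 2
      rw [normSum, real_inner_smul_left, sum_inner]
      simp only [hX, ← Finset.sum_div, RCLike.inner_apply, conj_trivial]
      norm_cast
      field_simp
    simp_rw [e1]
    convert hc using 2
    rw [← Complex.ofReal_pow, Real.sq_sqrt hvpos.le]
    have e2 := sum_mul_mul_eq_dotProduct J t
    rw [← hv] at e2
    rw [e2, inner_zero_right]
    push_cast
    ring_nf
  have := (ProbabilityMeasure.tendsto_iff_forall_integral_tendsto.1 hlim) F
  refine this.congr fun k => ?_
  exact integral_map (hms k).aemeasurable F.continuous.aestronglyMeasurable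

end QuadExpansion

end LocalExpansion

/-! ### From convergence in law to convergence of fractional moments. -/

section MomentLimit

/-- For x ≥ c one has x^α = x^(α-1) x ≤ c^(α-1) x. As c^(α-1) → 0, bounded first moments make α-th
moments uniformly insensitive to truncation. -/
theorem ENNReal_rpow_le_min_add {α : ℝ} (hα₁ : α < 1) {c x : ℝ≥0∞} (hc : c ≠ 0)
    (hc' : c ≠ ∞) : x ^ α ≤ min x c ^ α + c ^ (α - 1) * x := by
  rcases le_total x c with h | h
  · rw [min_eq_left h]
    exact le_self_add
  · rcases eq_or_ne x ∞ with rfl | hx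
    · rw [ENNReal.mul_top]
      · simp
      · rw [ne_eq, ENNReal.rpow_eq_zero_iff]
        rintro (⟨h0, _⟩ | ⟨h0, _⟩)
        exacts [hc h0, hc' h0]
    · have hx0 : x ≠ 0 := (lt_of_lt_of_le (pos_iff_ne_zero.2 hc) h).ne'
      refine le_trans ?_ le_add_self
      calc x ^ α = x ^ (α - 1) * x := by
            conv_rhs => rw [← ENNReal.rpow_one x, ← ENNReal.rpow_mul, ← ENNReal.rpow_add _ _ hx0 hx]
            congr 1
            ring
        _ ≤ _ := by
            gcongr 1
            rw [show α - 1 = -(1 - α) by ring, ENNReal.rpow_neg, ENNReal.rpow_neg]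
            exact ENNReal.inv_le_inv.2 (ENNReal.rpow_le_rpow h (by linarith))

/-- Fractional moments converge as soon as truncated ones do, if the first moments are bounded. -/
theorem tendsto_lintegral_rpow_of_min {Ω Ω' : Type*} [MeasurableSpace Ω] [MeasurableSpace Ω']
    {P : Measure Ω} {Q : Measure Ω'} {α : ℝ} (hα₀ : 0 < α) (hα₁ : α < 1) {S : ℕ → Ω → ℝ≥0∞}
    {T : Ω' → ℝ≥0∞} (hS : ∀ k, Measurable (S k)) (hT : Measurable T) {B : ℝ≥0∞} (hB : B ≠ ∞)
    (hSB : ∀ᶠ k in atTop, ∫⁻ ω, S k ω ∂P ≤ B)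
    (h : ∀ c : ℕ, 0 < c → Tendsto (fun k => ∫⁻ ω, min (S k ω) c ^ α ∂P) atTop
      (𝓝 (∫⁻ x, min (T x) c ^ α ∂Q))) :
    Tendsto (fun k => ∫⁻ ω, S k ω ^ α ∂P) atTop (𝓝 (∫⁻ x, T x ^ α ∂Q)) := by
  have hlim : Tendsto (fun c : ℕ => ∫⁻ x, min (T x) c ^ α ∂Q) atTop (𝓝 (∫⁻ x, T x ^ α ∂Q)) := by
    refine lintegral_tendsto_of_tendsto_of_monotone
      (fun c => ((hT.min measurable_const).pow_const _).aemeasurable) (ae_of_all _ fun x => ?_)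
      (ae_of_all _ fun x => ?_)
    · intro a b hab
      dsimp only
      gcongr
    · refine (ENNReal.continuous_rpow_const.tendsto _).comp ?_
      have h1 : Tendsto (fun c : ℕ => (c : ℝ≥0∞)) atTop (𝓝 ∞) := ENNReal.tendsto_nat_nhds_top
      have := (tendsto_const_nhds (x := T x)).min h1
      simpa using this
  have hc0 : Tendsto (fun c : ℕ => (c : ℝ≥0∞) ^ (α - 1) * B) atTop (𝓝 0) := by
    have h1 : Tendsto (fun c : ℕ => (c : ℝ≥0∞) ^ (α - 1)) atTop (𝓝 0) := by
      have h2 := (ENNReal.continuous_rpow_const (y := 1 - α)).tendsto ∞ |>.comp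
        ENNReal.tendsto_nat_nhds_top
      rw [ENNReal.top_rpow_of_pos (by linarith)] at h2
      have h3 := tendsto_inv_iff.2 h2
      rw [ENNReal.inv_top] at h3
      refine h3.congr fun c => ?_
      rw [Function.comp_apply, ← ENNReal.rpow_neg, neg_sub]
    simpa using ENNReal.Tendsto.mul_const h1 (Or.inr hB)
  have hlow : ∫⁻ x, T x ^ α ∂Q ≤ liminf (fun k => ∫⁻ ω, S k ω ^ α ∂P) atTop := by
    refine le_of_tendsto hlim ?_
    filter_upwards [eventually_gt_atTop 0] with c hc
    rw [← (h c hc).liminf_eq]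
    refine liminf_le_liminf (Eventually.of_forall fun k => lintegral_mono fun ω => ?_)
    gcongr
    exact min_le_left _ _
  have hupp : limsup (fun k => ∫⁻ ω, S k ω ^ α ∂P) atTop ≤ ∫⁻ x, T x ^ α ∂Q := by
    have h1 := hlim.add hc0
    rw [add_zero] at h1
    refine ge_of_tendsto h1 ?_
    filter_upwards [eventually_gt_atTop 0] with c hc
    have h2 := (h c hc).add (tendsto_const_nhds (x := (c : ℝ≥0∞) ^ (α - 1) * B))
    rw [← h2.limsup_eq]
    refine limsup_le_limsup ?_
    filter_upwards [hSB] with k hk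
    calc ∫⁻ ω, S k ω ^ α ∂P ≤ ∫⁻ ω, (min (S k ω) c ^ α + (c : ℝ≥0∞) ^ (α - 1) * S k ω) ∂P :=
          lintegral_mono fun ω => ENNReal_rpow_le_min_add hα₁ (by exact_mod_cast hc.ne')
            (ENNReal.natCast_ne_top c)
      _ = ∫⁻ ω, min (S k ω) c ^ α ∂P + (c : ℝ≥0∞) ^ (α - 1) * ∫⁻ ω, S k ω ∂P := by
          rw [lintegral_add_right _ ((hS k).const_mul _), lintegral_const_mul _ (hS k)]
      _ ≤ _ := by gcongr
  exact tendsto_of_le_liminf_of_limsup_le hlow hupp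

theorem ENNReal_tendsto_of_add {a b δ : ℕ → ℝ≥0∞} {L : ℝ≥0∞} (hL : L ≠ ∞)
    (hb : Tendsto b atTop (𝓝 L)) (hδ : Tendsto δ atTop (𝓝 0)) (h1 : ∀ k, a k ≤ b k + δ k)
    (h2 : ∀ k, b k ≤ a k + δ k) : Tendsto a atTop (𝓝 L) := by
  refine tendsto_of_tendsto_of_tendsto_of_le_of_le (g := fun k => b k - δ k)
    (h := fun k => b k + δ k) ?_ ?_ (fun k => tsub_le_iff_right.2 (h2 k)) h1
  · simpa using ENNReal.Tendsto.sub hb hδ (Or.inl hL)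
  · simpa using hb.add hδ

variable {d : ℕ} {Y : Type*} [MeasurableSpace Y]

/-- The integral over a ball of the exponential of the limiting quadratic expansion. -/
def quadExpIntegral (J : Matrix (Fin d) (Fin d) ℝ) (R : ℝ) (x : Param d) : ℝ≥0∞ :=
  ∫⁻ v in Metric.closedBall (0 : Param d) R,
    ENNReal.ofReal (Real.exp (inner ℝ x v - (∑ i, ∑ j, v i * v j * J i j) / 2))

/-- The integral over a ball of the local likelihood ratio. -/
def localExpIntegral (lam : Param d → Y → ℝ) (R : ℝ) (k : ℕ) (ω : ℕ → Y) : ℝ≥0∞ :=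
  ∫⁻ v in Metric.closedBall (0 : Param d) R,
    ENNReal.ofReal (Real.exp (∑ i ∈ Finset.range k, lam ((√(k : ℝ))⁻¹ • v) (ω i)))

/-- Continuity, obtained from compactness of the ball, makes the truncated power of this integral a
bounded continuous test function for the central limit theorem. The integral over the whole space is
recovered later by monotone convergence. -/
theorem continuous_quadExpIntegral_toReal (J : Matrix (Fin d) (Fin d) ℝ) (R : ℝ) :
    Continuous (fun x => (quadExpIntegral J R x).toReal) ∧ ∀ x, quadExpIntegral J R x ≠ ∞ := by
  have hcont : Continuous (Function.uncurry fun (x v : Param d) =>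
      Real.exp (inner ℝ x v - (∑ i, ∑ j, v i * v j * J i j) / 2)) := by
    unfold Function.uncurry
    fun_prop
  have hint : ∀ x, IntegrableOn (fun v : Param d =>
      Real.exp (inner ℝ x v - (∑ i, ∑ j, v i * v j * J i j) / 2)) (Metric.closedBall 0 R) := fun x =>
    (hcont.comp (Continuous.prodMk_right x)).continuousOn.integrableOn_compact
      (isCompact_closedBall 0 R)
  have e : ∀ x, quadExpIntegral J R x = ENNReal.ofReal (∫ v in Metric.closedBall (0 : Param d) R,
      Real.exp (inner ℝ x v - (∑ i, ∑ j, v i * v j * J i j) / 2)) := fun x =>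
    (ofReal_integral_eq_lintegral_ofReal (hint x) (ae_of_all _ fun v => (Real.exp_pos _).le)).symm
  refine ⟨?_, fun x => by rw [e]; exact ENNReal.ofReal_ne_top⟩
  have e' : ∀ x, (quadExpIntegral J R x).toReal = ∫ v in Metric.closedBall (0 : Param d) R,
      Real.exp (inner ℝ x v - (∑ i, ∑ j, v i * v j * J i j) / 2) := fun x => by
    rw [e, ENNReal.toReal_ofReal (integral_nonneg fun v => (Real.exp_pos _).le)]
  simp_rw [e']
  exact continuous_parametric_integral_of_continuous hcont (isCompact_closedBall 0 R)

theorem measurable_quadExpIntegral (J : Matrix (Fin d) (Fin d) ℝ) (R : ℝ) :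
    Measurable (quadExpIntegral J R) := by
  obtain ⟨h1, h2⟩ := continuous_quadExpIntegral_toReal J R
  have : quadExpIntegral J R = fun x => ENNReal.ofReal (quadExpIntegral J R x).toReal :=
    funext fun x => (ENNReal.ofReal_toReal (h2 x)).symm
  rw [this]
  exact h1.measurable.ennreal_ofReal

theorem measurable_localExpIntegral {lam : Param d → Y → ℝ}
    (hlam : Measurable (Function.uncurry lam)) (R : ℝ) (k : ℕ) :
    Measurable (localExpIntegral lam R k) := by
  refine Measurable.lintegral_prod_right' (f := fun p : (ℕ → Y) × Param d => ENNReal.ofReal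
    (Real.exp (∑ i ∈ Finset.range k, lam ((√(k : ℝ))⁻¹ • p.2) (p.1 i)))) ?_
  refine (Real.measurable_exp.comp (Finset.measurable_sum _ fun i _ => ?_)).ennreal_ofReal
  have h1 : Measurable fun p : (ℕ → Y) × Param d => p.1 i :=
    (measurable_pi_apply i).comp measurable_fst
  have h2 : Measurable fun p : (ℕ → Y) × Param d => (√(k : ℝ))⁻¹ • p.2 := by fun_prop
  exact hlam.comp (h2.prodMk h1)

/-- Truncation at c turns a relative error η into an additive error, since (1+η)^α ≤ 1+η. -/
theorem min_rpow_sub_le {α η : ℝ} (hα₀ : 0 < α) (hα₁ : α < 1) (hη : 0 ≤ η) {x y c : ℝ≥0∞}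
    (h : x ≤ ENNReal.ofReal (1 + η) * y) :
    min x c ^ α - min y c ^ α ≤ ENNReal.ofReal η * c ^ α := by
  have h1 : (1 : ℝ≥0∞) ≤ ENNReal.ofReal (1 + η) := by
    rw [ENNReal.one_le_ofReal]
    linarith
  rw [tsub_le_iff_right]
  calc min x c ^ α ≤ (ENNReal.ofReal (1 + η) * min y c) ^ α := by
        gcongr
        refine le_trans (min_le_min h ((one_mul c).symm.le.trans (mul_le_mul_left h1 c))) ?_
        rw [mul_min]
    _ = ENNReal.ofReal (1 + η) ^ α * min y c ^ α := ENNReal.mul_rpow_of_nonneg _ _ hα₀.le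
    _ ≤ ENNReal.ofReal (1 + η) * min y c ^ α := by
        gcongr
        conv_rhs => rw [← ENNReal.rpow_one (ENNReal.ofReal (1 + η))]
        exact ENNReal.rpow_le_rpow_of_exponent_le h1 hα₁.le
    _ = ENNReal.ofReal η * min y c ^ α + min y c ^ α := by
        rw [ENNReal.ofReal_add zero_le_one hη, ENNReal.ofReal_one, add_mul, one_mul, add_comm]
    _ ≤ _ := by
        gcongr
        exact min_le_right _ _

namespace QuadExpansion

variable {P : Measure Y} [IsProbabilityMeasure P] {lam : Param d → Y → ℝ} {s : Y → Param d}
  {V : Fin d → Fin d → Y → ℝ} {J : Matrix (Fin d) (Fin d) ℝ} {H : Y → ℝ} {r : ℝ}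

/-- The expansion with tolerance log(1+η) in the exponent becomes, uniformly on the ball, a factor
1+η after exponentiation. -/
theorem ae_localExpIntegral (h : QuadExpansion P lam s V J H r) {R : ℝ} (hR : 0 < R) :
    ∀ᵐ ω ∂(Measure.infinitePi fun _ : ℕ => P), ∀ η > 0, ∀ᶠ k : ℕ in atTop,
      localExpIntegral lam R k ω ≤ ENNReal.ofReal (1 + η) * quadExpIntegral J R (normSum s k ω) ∧
      quadExpIntegral J R (normSum s k ω) ≤ ENNReal.ofReal (1 + η) * localExpIntegral lam R k ω := by
  filter_upwards [h.ae_expansion] with ω hω η hη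
  have hlog : 0 < Real.log (1 + η) := Real.log_pos (by linarith)
  filter_upwards [hω R hR _ hlog] with k hk
  have key : ∀ a b : ℝ, a ≤ b + Real.log (1 + η) →
      ENNReal.ofReal (Real.exp a) ≤ ENNReal.ofReal (1 + η) * ENNReal.ofReal (Real.exp b) := by
    intro a b hab
    rw [← ENNReal.ofReal_mul (by linarith)]
    refine ENNReal.ofReal_le_ofReal ?_
    calc Real.exp a ≤ Real.exp (b + Real.log (1 + η)) := Real.exp_le_exp.2 hab
      _ = _ := by rw [Real.exp_add, Real.exp_log (by linarith), mul_comm]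
  constructor
  · rw [quadExpIntegral, ← lintegral_const_mul' _ _ ENNReal.ofReal_ne_top]
    refine setLIntegral_mono' measurableSet_closedBall fun v hv => key _ _ ?_
    have := (abs_le.1 (hk v (by simpa using hv))).2
    linarith
  · rw [localExpIntegral, ← lintegral_const_mul' _ _ ENNReal.ofReal_ne_top]
    refine setLIntegral_mono' measurableSet_closedBall fun v hv => key _ _ ?_
    have := (abs_le.1 (hk v (by simpa using hv))).1
    linarith

/-- The truncated quadratic integral is a bounded continuous function of the normalised sum, so its
expectation converges by the central limit theorem. The true integral differs from it by an almost
surely vanishing bounded error, removed by dominated convergence. -/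
theorem tendsto_min_rpow (h : QuadExpansion P lam s V J H r) {α : ℝ} (hα₀ : 0 < α) (hα₁ : α < 1)
    {R : ℝ} (hR : 0 < R) (c : ℕ) :
    Tendsto (fun k => ∫⁻ ω, min (localExpIntegral lam R k ω) c ^ α
      ∂(Measure.infinitePi fun _ : ℕ => P)) atTop
      (𝓝 (∫⁻ x, min (quadExpIntegral J R x) c ^ α ∂(multivariateGaussian 0 J))) := by
  have hcα : (c : ℝ≥0∞) ^ α ≠ ∞ := ENNReal.rpow_ne_top_of_nonneg hα₀.le (ENNReal.natCast_ne_top c)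
  obtain ⟨hTc, hTt⟩ := continuous_quadExpIntegral_toReal J R
  have hSm := measurable_localExpIntegral h.measurable_lam R
  have hTm := measurable_quadExpIntegral J R
  have hΔm := measurable_normSum h.measurable_s
  let F : BoundedContinuousFunction (Param d) ℝ := BoundedContinuousFunction.ofNormedAddCommGroup
    (fun x => min (quadExpIntegral J R x).toReal c ^ α)
    ((hTc.min continuous_const).rpow_const fun _ => Or.inr hα₀.le) ((c : ℝ) ^ α) (fun x => by
      have h0 : 0 ≤ min (quadExpIntegral J R x).toReal c := le_min ENNReal.toReal_nonneg
        c.cast_nonneg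
      rw [Real.norm_of_nonneg (by positivity)]
      gcongr
      exact min_le_right _ _)
  have hF : ∀ x, min (quadExpIntegral J R x) c ^ α = ENNReal.ofReal (F x) := by
    intro x
    have h0 : 0 ≤ min (quadExpIntegral J R x).toReal c := le_min ENNReal.toReal_nonneg
        c.cast_nonneg
    change _ = ENNReal.ofReal (min (quadExpIntegral J R x).toReal c ^ α)
    rw [← ENNReal.ofReal_rpow_of_nonneg h0 hα₀.le, ENNReal.ofReal_min, ENNReal.ofReal_toReal (hTt x),
      ENNReal.ofReal_natCast]
  have hF0 : ∀ x, 0 ≤ F x := fun x => by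
    have h0 : 0 ≤ min (quadExpIntegral J R x).toReal c := le_min ENNReal.toReal_nonneg
        c.cast_nonneg
    change 0 ≤ min (quadExpIntegral J R x).toReal c ^ α
    positivity
  have hb : Tendsto (fun k => ∫⁻ ω, min (quadExpIntegral J R (normSum s k ω)) c ^ α
      ∂(Measure.infinitePi fun _ : ℕ => P)) atTop
      (𝓝 (∫⁻ x, min (quadExpIntegral J R x) c ^ α ∂(multivariateGaussian 0 J))) := by
    simp_rw [hF]
    have h1 := (ENNReal.continuous_ofReal.tendsto _).comp (h.tendsto_integral_normSum F)
    rw [ofReal_integral_eq_lintegral_ofReal (F.integrable _) (ae_of_all _ hF0)] at h1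
    refine h1.congr fun k => ?_
    rw [Function.comp_apply, ofReal_integral_eq_lintegral_ofReal _ (ae_of_all _ fun ω => hF0 _)]
    refine (integrable_map_measure F.continuous.aestronglyMeasurable (hΔm k).aemeasurable).1 ?_
    have := Measure.isProbabilityMeasure_map (μ := Measure.infinitePi fun _ : ℕ => P)
      (hΔm k).aemeasurable
    exact F.integrable _
  have hAm : ∀ k, Measurable fun ω => min (localExpIntegral lam R k ω) c ^ α := fun k =>
    ((hSm k).min measurable_const).pow_const _
  have hBm : ∀ k, Measurable fun ω => min (quadExpIntegral J R (normSum s k ω)) c ^ α := fun k =>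
    (((hTm.comp (hΔm k))).min measurable_const).pow_const _
  have hδ : Tendsto (fun k => l1Dist (Measure.infinitePi fun _ : ℕ => P)
      (fun ω => min (localExpIntegral lam R k ω) c ^ α)
      (fun ω => min (quadExpIntegral J R (normSum s k ω)) c ^ α)) atTop (𝓝 0) := by
    have := tendsto_lintegral_of_dominated_convergence (μ := Measure.infinitePi fun _ : ℕ => P)
      (F := fun k ω => (min (localExpIntegral lam R k ω) c ^ α -
        min (quadExpIntegral J R (normSum s k ω)) c ^ α) +
        (min (quadExpIntegral J R (normSum s k ω)) c ^ α - min (localExpIntegral lam R k ω) c ^ α))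
      (f := fun _ => 0) (fun _ => (c : ℝ≥0∞) ^ α + (c : ℝ≥0∞) ^ α)
      (fun k => ((hAm k).sub (hBm k)).add ((hBm k).sub (hAm k)))
      (fun k => ae_of_all _ fun ω => by
        refine add_le_add (tsub_le_self.trans ?_) (tsub_le_self.trans ?_) <;>
        · gcongr
          exact min_le_right _ _)
      (by simp [hcα]) ?_
    · simpa [l1Dist] using this
    · filter_upwards [h.ae_localExpIntegral hR] with ω hω
      rw [ENNReal.tendsto_nhds_zero]
      intro ε hε
      have hz : Tendsto (fun η : ℝ => ENNReal.ofReal η * (c : ℝ≥0∞) ^ α +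
          ENNReal.ofReal η * (c : ℝ≥0∞) ^ α) (𝓝[>] 0) (𝓝 0) := by
        have h1 : Tendsto (fun η : ℝ => ENNReal.ofReal η * (c : ℝ≥0∞) ^ α) (𝓝[>] 0) (𝓝 0) := by
          have := ENNReal.Tendsto.mul_const ((ENNReal.continuous_ofReal.tendsto 0).mono_left
            (nhdsWithin_le_nhds (s := Set.Ioi 0))) (Or.inr hcα)
          simpa using this
        simpa using h1.add h1
      obtain ⟨η, hη, hη0⟩ := ((ENNReal.tendsto_nhds_zero.1 hz ε hε).and
        self_mem_nhdsWithin).exists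
      filter_upwards [hω η hη0] with k hk
      exact (add_le_add (min_rpow_sub_le hα₀ hα₁ (le_of_lt hη0) hk.1)
        (min_rpow_sub_le hα₀ hα₁ (le_of_lt hη0) hk.2)).trans hη
  refine ENNReal_tendsto_of_add ?_ hb hδ ?_ ?_
  · refine ne_top_of_le_ne_top (b := (c : ℝ≥0∞) ^ α) hcα ?_
    calc _ ≤ ∫⁻ _, (c : ℝ≥0∞) ^ α ∂(multivariateGaussian 0 J) :=
          lintegral_mono fun x => by gcongr; exact min_le_right _ _
      _ = _ := by simp
  · intro k
    rw [l1Dist, ← lintegral_add_left (hBm k)]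
    exact lintegral_mono fun ω => le_add_tsub.trans (by gcongr; exact le_self_add)
  · intro k
    rw [l1Dist, ← lintegral_add_left (hAm k)]
    exact lintegral_mono fun ω => le_add_tsub.trans (by gcongr; exact le_add_self)

/-- Convergence of the fractional moments of the local likelihood ratio integrals. -/
theorem tendsto_rpow (h : QuadExpansion P lam s V J H r) {α : ℝ} (hα₀ : 0 < α) (hα₁ : α < 1)
    {R : ℝ} (hR : 0 < R) {B : ℝ≥0∞} (hB : B ≠ ∞) (hSB : ∀ᶠ k in atTop,
      ∫⁻ ω, localExpIntegral lam R k ω ∂(Measure.infinitePi fun _ : ℕ => P) ≤ B) :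
    Tendsto (fun k => ∫⁻ ω, localExpIntegral lam R k ω ^ α
      ∂(Measure.infinitePi fun _ : ℕ => P)) atTop
      (𝓝 (∫⁻ x, quadExpIntegral J R x ^ α ∂(multivariateGaussian 0 J))) :=
  tendsto_lintegral_rpow_of_min hα₀ hα₁ (measurable_localExpIntegral h.measurable_lam R)
    (measurable_quadExpIntegral J R) hB hSB fun c _ => h.tendsto_min_rpow hα₀ hα₁ hR c

end QuadExpansion

end MomentLimit

/-! ### The Gaussian limit as a function of the information matrix. -/

section GaussianLimit

variable {d : ℕ}

/-- The integral of the exponential of the limiting quadratic expansion. -/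
def quadExpFull (J : Matrix (Fin d) (Fin d) ℝ) (x : Param d) : ℝ≥0∞ :=
  ∫⁻ v : Param d, ENNReal.ofReal (Real.exp (inner ℝ x v - (∑ i, ∑ j, v i * v j * J i j) / 2))

theorem tendsto_quadExpIntegral (J : Matrix (Fin d) (Fin d) ℝ) (x : Param d) :
    Tendsto (fun n : ℕ => quadExpIntegral J n x) atTop (𝓝 (quadExpFull J x)) := by
  unfold quadExpIntegral quadExpFull
  have hm : Measurable fun v : Param d => ENNReal.ofReal
      (Real.exp (inner ℝ x v - (∑ i, ∑ j, v i * v j * J i j) / 2)) := by fun_prop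
  simp_rw [← lintegral_indicator (measurableSet_closedBall (x := (0 : Param d)) (ε := _))]
  refine lintegral_tendsto_of_tendsto_of_monotone
    (fun n => (hm.indicator measurableSet_closedBall).aemeasurable) (ae_of_all _ fun v => ?_)
    (ae_of_all _ fun v => ?_)
  · intro a b hab
    refine Set.indicator_le_indicator_of_subset (Metric.closedBall_subset_closedBall ?_)
      (fun _ => bot_le) v
    exact_mod_cast hab
  · obtain ⟨N, hN⟩ := exists_nat_ge ‖v‖
    refine tendsto_const_nhds.congr' ?_
    filter_upwards [eventually_ge_atTop N] with n hn
    rw [Set.indicator_of_mem]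
    rw [mem_closedBall_zero_iff]
    exact hN.trans (by exact_mod_cast hn)

theorem monotone_quadExpIntegral (J : Matrix (Fin d) (Fin d) ℝ) (x : Param d) :
    Monotone fun n : ℕ => quadExpIntegral J n x := fun a b hab =>
  lintegral_mono_set (Metric.closedBall_subset_closedBall (by exact_mod_cast hab))

theorem measurable_quadExpFull (J : Matrix (Fin d) (Fin d) ℝ) : Measurable (quadExpFull J) :=
  measurable_of_tendsto_metrizable (fun n : ℕ => measurable_quadExpIntegral J n)
    (tendsto_pi_nhds.2 fun x => tendsto_quadExpIntegral J x)

theorem tendsto_lintegral_quadExpIntegral (J : Matrix (Fin d) (Fin d) ℝ) {α : ℝ} (hα₀ : 0 < α) :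
    Tendsto (fun n : ℕ => ∫⁻ x, quadExpIntegral J n x ^ α ∂(multivariateGaussian 0 J)) atTop
      (𝓝 (∫⁻ x, quadExpFull J x ^ α ∂(multivariateGaussian 0 J))) :=
  lintegral_tendsto_of_tendsto_of_monotone
    (fun n => ((measurable_quadExpIntegral J n).pow_const _).aemeasurable)
    (ae_of_all _ fun x _ _ hab => ENNReal.rpow_le_rpow (monotone_quadExpIntegral J x hab) hα₀.le)
    (ae_of_all _ fun x => (ENNReal.continuous_rpow_const.tendsto _).comp
      (tendsto_quadExpIntegral J x))

/-- The limiting moment for the identity information matrix. -/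
def gaussMoment (d : ℕ) (α : ℝ) : ℝ≥0∞ :=
  ∫⁻ z, (∫⁻ u : Param d, ENNReal.ofReal (Real.exp (inner ℝ z u - ‖u‖ ^ 2 / 2))) ^ α
    ∂(stdGaussian (Param d))

theorem measurable_stdExp : Measurable fun z : Param d =>
    ∫⁻ u : Param d, ENNReal.ofReal (Real.exp (inner ℝ z u - ‖u‖ ^ 2 / 2)) := by
  refine Measurable.lintegral_prod_right' (f := fun p : Param d × Param d =>
    ENNReal.ofReal (Real.exp (inner ℝ p.1 p.2 - ‖p.2‖ ^ 2 / 2))) ?_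
  fun_prop

/-- Positivity is proved directly; finiteness follows later from the boundedness of rescaled
affinities, and no closed form is required. -/
theorem gaussMoment_ne_zero (d : ℕ) {α : ℝ} (hα₀ : 0 < α) : gaussMoment d α ≠ 0 := by
  have hpos : ∀ z : Param d,
      ∫⁻ u : Param d, ENNReal.ofReal (Real.exp (inner ℝ z u - ‖u‖ ^ 2 / 2)) ≠ 0 := by
    intro z h0
    rw [lintegral_eq_zero_iff (by fun_prop)] at h0
    have : ∀ᵐ u : Param d, False := by
      filter_upwards [h0] with u hu
      have h1 := Real.exp_pos (inner ℝ z u - ‖u‖ ^ 2 / 2)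
      simp [ENNReal.ofReal_eq_zero, not_le.2 h1] at hu
    rw [Filter.eventually_false_iff_eq_bot, ae_eq_bot] at this
    exact (NeZero.ne (volume : Measure (Param d))) this
  intro h0
  rw [gaussMoment, lintegral_eq_zero_iff (measurable_stdExp.pow_const _)] at h0
  have : ∀ᵐ z ∂(stdGaussian (Param d)), False := by
    filter_upwards [h0] with z hz
    simp only [Pi.zero_apply, ENNReal.rpow_eq_zero_iff, hpos z, false_and, false_or] at hz
    exact absurd hz.2 (not_lt.2 hα₀.le)
  rw [Filter.eventually_false_iff_eq_bot, ae_eq_bot] at this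
  exact (IsProbabilityMeasure.ne_zero (stdGaussian (Param d))) this

theorem lintegral_comp_linearMap {f : Param d →ₗ[ℝ] Param d} (hf : LinearMap.det f ≠ 0)
    {g : Param d → ℝ≥0∞} (hg : Measurable g) :
    ∫⁻ v, g (f v) = ENNReal.ofReal |(LinearMap.det f)⁻¹| * ∫⁻ u, g u := by
  have h1 := Measure.map_linearMap_addHaar_eq_smul_addHaar (volume : Measure (Param d)) hf
  have hm : Measurable f := (LinearMap.continuous_of_finiteDimensional f).measurable
  rw [← lintegral_map hg hm, h1, lintegral_smul_measure, smul_eq_mul]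

open scoped MatrixOrder in
/-- The limiting moment as a function of the information matrix. -/
theorem lintegral_quadExpFull {J : Matrix (Fin d) (Fin d) ℝ} (hJ : J.PosDef) {α : ℝ}
    (hα₀ : 0 < α) :
    ∫⁻ x, quadExpFull J x ^ α ∂(multivariateGaussian 0 J) =
      ENNReal.ofReal (|J.det| ^ (-α / 2)) * gaussMoment d α := by
  -- With x = Az, z standard Gaussian, and u = Av, the exponent becomes ⟨z,u⟩ - ‖u‖²/2. The Jacobian
  -- |det A|⁻¹, raised to the power α, is |det J|^(-α/2).
  set A := CFC.sqrt J with hA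
  have hAA : A * A = J := CFC.sqrt_mul_sqrt_self J hJ.posSemidef.nonneg
  have hsa : IsSelfAdjoint (Matrix.toEuclideanCLM (𝕜 := ℝ) A) :=
    (CFC.sqrt_nonneg J).isSelfAdjoint.map _
  set L := Matrix.toEuclideanCLM (𝕜 := ℝ) A with hL
  have hdet : LinearMap.det (L : Param d →ₗ[ℝ] Param d) = A.det := by
    change LinearMap.det (Matrix.toLpLin 2 2 A) = _
    rw [Matrix.toLpLin_eq_toLin, LinearMap.det_toLin]
  have hdet2 : A.det ^ 2 = J.det := by rw [sq, ← Matrix.det_mul, hAA]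
  have hJdet : 0 < J.det := hJ.det_pos
  have hAdet : A.det ≠ 0 := by
    intro h0
    rw [h0] at hdet2
    linarith [zero_pow (M₀ := ℝ) two_ne_zero]
  have hquad : ∀ v : Param d, ∑ i, ∑ j, v i * v j * J i j = ‖L v‖ ^ 2 := by
    intro v
    rw [sum_mul_mul_eq_dotProduct, ← Matrix.inner_toEuclideanCLM, ← hAA, map_mul,
      ← real_inner_self_eq_norm_sq, mul_apply_eq_comp,
      ← ContinuousLinearMap.adjoint_inner_left, hsa.adjoint_eq]
  have hfull : ∀ z, quadExpFull J (L z) = ENNReal.ofReal |A.det⁻¹| *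
      ∫⁻ u : Param d, ENNReal.ofReal (Real.exp (inner ℝ z u - ‖u‖ ^ 2 / 2)) := by
    intro z
    rw [← hdet, ← lintegral_comp_linearMap (by rwa [hdet]) (by fun_prop)]
    unfold quadExpFull
    refine lintegral_congr fun v => ?_
    rw [hquad]
    have e := ContinuousLinearMap.adjoint_inner_left L v z
    rw [hsa.adjoint_eq] at e
    rw [e]
    rfl
  have hmap : multivariateGaussian 0 J = (stdGaussian (Param d)).map L := by
    rw [multivariateGaussian]
    simp only [zero_add]
    rfl
  rw [hmap, lintegral_map ((measurable_quadExpFull J).pow_const _) L.continuous.measurable]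
  simp_rw [hfull, ENNReal.mul_rpow_of_nonneg _ _ hα₀.le]
  rw [lintegral_const_mul _ (measurable_stdExp.pow_const _), gaussMoment,
    ENNReal.ofReal_rpow_of_nonneg (abs_nonneg _) hα₀.le]
  congr 2
  rw [← hdet2, abs_inv, abs_pow, ← Real.rpow_natCast, ← Real.rpow_mul (abs_nonneg _),
    Real.inv_rpow (abs_nonneg _), ← Real.rpow_neg (abs_nonneg _)]
  congr 1
  push_cast
  ring

end GaussianLimit

/-! ### The statistical model near a point as a random quadratic expansion. -/

section LocalModel

variable {d : ℕ} {Y : Type*} [MeasurableSpace Y] {μ : Measure Y} {ℓ : Param d → Y → ℝ}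

/-- The joint likelihood, with values in `[0, ∞]`. -/
def jlik (ℓ : Param d → Y → ℝ) (k : ℕ) (θ : Param d) (y : Fin k → Y) : ℝ≥0∞ :=
  ∏ i, lik ℓ θ (y i)

theorem measurable_uncurry_jlik (hℓ : Measurable (Function.uncurry ℓ)) (k : ℕ) :
    Measurable fun p : (Fin k → Y) × Param d => jlik ℓ k p.2 p.1 :=
  Finset.measurable_prod _ fun i _ => (measurable_uncurry_lik hℓ).comp
    (measurable_snd.prodMk ((measurable_pi_apply i).comp measurable_fst))

theorem measurable_jlik_affine (hℓ : Measurable (Function.uncurry ℓ)) (k : ℕ) (θ : Param d)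
    (c : ℝ) : Measurable fun p : (Fin k → Y) × Param d => jlik ℓ k (θ + c • p.2) p.1 := by
  have h1 : Measurable fun p : (Fin k → Y) × Param d => (p.1, θ + c • p.2) := by fun_prop
  exact (measurable_uncurry_jlik hℓ k).comp h1

theorem measurable_jlik (hℓ : Measurable (Function.uncurry ℓ)) (k : ℕ) (θ : Param d) :
    Measurable (jlik ℓ k θ) :=
  Finset.measurable_prod _ fun i _ => (measurable_lik hℓ θ).comp (measurable_pi_apply i)

theorem lintegral_pi_withDensity [SigmaFinite μ] {f : Y → ℝ≥0∞} (hf : Measurable f)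
    [SigmaFinite (μ.withDensity f)] {k : ℕ} {F : (Fin k → Y) → ℝ≥0∞} (hF : Measurable F) :
    ∫⁻ y, F y ∂(Measure.pi fun _ => μ.withDensity f) =
      ∫⁻ y, F y * ∏ i, f (y i) ∂(Measure.pi fun _ => μ) := by
  induction k with
  | zero => rw [Measure.pi_of_empty, Measure.pi_of_empty]; simp
  | succ k ih =>
    have hcons : Measurable fun p : Y × (Fin k → Y) => (Fin.cons p.1 p.2 : Fin (k + 1) → Y) :=
      measurable_pi_lambda _ fun i => by
        refine Fin.cases ?_ (fun j => ?_) i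
        · exact measurable_fst
        · exact (measurable_pi_apply j).comp measurable_snd
    have hFc : ∀ y₀, Measurable fun y : Fin k → Y => F (Fin.cons y₀ y) := fun y₀ =>
      hF.comp (hcons.comp (measurable_const.prodMk measurable_id))
    rw [lintegral_pi_fin_succ hF, lintegral_pi_fin_succ (F := fun y => F y * ∏ i, f (y i))
      (hF.mul (Finset.measurable_prod _ fun i _ => hf.comp (measurable_pi_apply i)))]
    simp_rw [fun y₀ => ih (hFc y₀)]
    rw [lintegral_withDensity_eq_lintegral_mul _ hf]
    · refine lintegral_congr fun y₀ => ?_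
      rw [Pi.mul_apply, ← lintegral_const_mul _ (f := fun y => F (Fin.cons y₀ y) * ∏ i, f (y i))
        ((hFc y₀).mul (Finset.measurable_prod _ fun i _ => hf.comp (measurable_pi_apply i)))]
      refine lintegral_congr fun y => ?_
      simp only [Fin.prod_univ_succ, Fin.cons_zero, Fin.cons_succ]
      ring
    · refine Measurable.lintegral_prod_right' (f := fun p : Y × (Fin k → Y) =>
        F (Fin.cons p.1 p.2) * ∏ i, f (p.2 i)) ?_
      exact (hF.comp hcons).mul (Finset.measurable_prod _ fun i _ =>
        hf.comp ((measurable_pi_apply i).comp measurable_snd))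

/-- The distribution of one observation. -/
def obsMeasure (μ : Measure Y) (ℓ : Param d → Y → ℝ) (θ : Param d) : Measure Y :=
  μ.withDensity (lik ℓ θ)

theorem isProbabilityMeasure_obsMeasure {θ : Param d} (h : ∫⁻ y, lik ℓ θ y ∂μ = 1) :
    IsProbabilityMeasure (obsMeasure μ ℓ θ) :=
  ⟨by rw [obsMeasure, withDensity_apply _ MeasurableSet.univ, setLIntegral_univ, h]⟩

/-- All sample sizes are placed on one infinite product space, where almost sure statements in k
make sense. -/
theorem lintegral_mul_jlik [SigmaFinite μ] (hℓ : Measurable (Function.uncurry ℓ)) {θ : Param d}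
    [IsProbabilityMeasure (obsMeasure μ ℓ θ)] {k : ℕ} {F : (Fin k → Y) → ℝ≥0∞} (hF : Measurable F) :
    ∫⁻ y, F y * jlik ℓ k θ y ∂(Measure.pi fun _ => μ) =
      ∫⁻ ω, F (fun i => ω i) ∂(Measure.infinitePi fun _ : ℕ => obsMeasure μ ℓ θ) := by
  have : SigmaFinite (μ.withDensity (lik ℓ θ)) :=
    inferInstanceAs (SigmaFinite (obsMeasure μ ℓ θ))
  have h1 : ∫⁻ y, F y * jlik ℓ k θ y ∂(Measure.pi fun _ => μ) =
      ∫⁻ y, F y ∂(Measure.pi fun _ => obsMeasure μ ℓ θ) :=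
    (lintegral_pi_withDensity (measurable_lik hℓ θ) hF).symm
  have h2 := Measure.map_infinitePi_infinitePi_of_inj (P := fun _ : ℕ => obsMeasure μ ℓ θ)
    (Fin.val_injective (n := k))
  rw [h1, ← Measure.infinitePi_eq_pi, ← h2, lintegral_map hF
    (measurable_pi_lambda _ fun i => measurable_pi_apply _)]

theorem lintegral_jlik [SigmaFinite μ] (hℓ : Measurable (Function.uncurry ℓ)) {θ : Param d}
    (h : ∫⁻ y, lik ℓ θ y ∂μ = 1) (k : ℕ) :
    ∫⁻ y, jlik ℓ k θ y ∂(Measure.pi fun _ => μ) = 1 := by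
  have := isProbabilityMeasure_obsMeasure h
  simpa using lintegral_mul_jlik (μ := μ) hℓ (θ := θ) (k := k) (F := fun _ => 1) measurable_const

/-- The local log-likelihood ratio. -/
def logRatio (ℓ : Param d → Y → ℝ) (θ₀ h : Param d) (y : Y) : ℝ :=
  Real.log (ℓ (θ₀ + h) y) - Real.log (ℓ θ₀ y)

/-- The local likelihood ratio integral as a function of finitely many observations. -/
def finExpIntegral (lam : Param d → Y → ℝ) (R : ℝ) (k : ℕ) (y : Fin k → Y) : ℝ≥0∞ :=
  ∫⁻ v in Metric.closedBall (0 : Param d) R,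
    ENNReal.ofReal (Real.exp (∑ i, lam ((√(k : ℝ))⁻¹ • v) (y i)))

theorem measurable_finExpIntegral {lam : Param d → Y → ℝ}
    (hlam : Measurable (Function.uncurry lam)) (R : ℝ) (k : ℕ) :
    Measurable (finExpIntegral lam R k) := by
  refine Measurable.lintegral_prod_right' (f := fun p : (Fin k → Y) × Param d => ENNReal.ofReal
    (Real.exp (∑ i, lam ((√(k : ℝ))⁻¹ • p.2) (p.1 i)))) ?_
  refine (Real.measurable_exp.comp (Finset.measurable_sum _ fun i _ => ?_)).ennreal_ofReal
  have h1 : Measurable fun p : (Fin k → Y) × Param d => p.1 i :=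
    (measurable_pi_apply i).comp measurable_fst
  have h2 : Measurable fun p : (Fin k → Y) × Param d => (√(k : ℝ))⁻¹ • p.2 := by fun_prop
  exact hlam.comp (h2.prodMk h1)

theorem finExpIntegral_val {Ω : Type*} (lam : Param d → Ω → ℝ) (R : ℝ) (k : ℕ) (ω : ℕ → Ω) :
    finExpIntegral lam R k (fun i => ω i) = localExpIntegral lam R k ω := by
  unfold finExpIntegral localExpIntegral
  refine lintegral_congr fun v => ?_
  rw [Fin.sum_univ_eq_sum_range (fun i => lam ((√(k : ℝ))⁻¹ • v) (ω i))]

theorem eventually_norm_smul_lt (R : ℝ) {r : ℝ} (hr : 0 < r) :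
    ∀ᶠ k : ℕ in atTop, ∀ v ∈ Metric.closedBall (0 : Param d) R, ‖(√(k : ℝ))⁻¹ • v‖ < r := by
  have h1 : Tendsto (fun k : ℕ => (√(k : ℝ))⁻¹ * R) atTop (𝓝 0) := by
    have := (tendsto_inv_atTop_zero.comp
      (Real.tendsto_sqrt_atTop.comp tendsto_natCast_atTop_atTop)).mul_const R
    simpa using this
  filter_upwards [h1.eventually_lt_const hr] with k hk v hv
  rw [norm_smul, Real.norm_of_nonneg (by positivity)]
  exact lt_of_le_of_lt (by gcongr; simpa using hv) hk

theorem jlik_ne_top {Ω : Type*} {ℓ : Param d → Ω → ℝ} (k : ℕ) (θ : Param d) (y : Fin k → Ω) :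
    jlik ℓ k θ y ≠ ∞ :=
  ENNReal.prod_ne_top fun _ _ => ENNReal.ofReal_ne_top

namespace IsLocallyRegular

variable {θ₀ θ : Param d} {r : ℝ} {G : Y → ℝ}

theorem isProbabilityMeasure_obsMeasure (h : IsLocallyRegular μ ℓ θ₀ r G) :
    IsProbabilityMeasure (obsMeasure μ ℓ θ₀) :=
  RefPrior.isProbabilityMeasure_obsMeasure (h.density θ₀ h.mem_ball)

theorem integrable_obsMeasure (h : IsLocallyRegular μ ℓ θ₀ r G) {f : Y → ℝ}
    (hf : Integrable (fun y => f y * ℓ θ₀ y) μ) : Integrable f (obsMeasure μ ℓ θ₀) := by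
  rw [obsMeasure, integrable_withDensity_iff_integrable_smul' (RefPrior.measurable_lik h.measurable θ₀)
    (ae_of_all _ fun y => ENNReal.ofReal_lt_top)]
  refine hf.congr ?_
  filter_upwards [h.ae_nonneg h.mem_ball] with y hy
  rw [lik, ENNReal.toReal_ofReal hy, smul_eq_mul, mul_comm]

theorem integral_obsMeasure (h : IsLocallyRegular μ ℓ θ₀ r G) (f : Y → ℝ) :
    ∫ y, f y ∂(obsMeasure μ ℓ θ₀) = ∫ y, f y * ℓ θ₀ y ∂μ := by
  rw [obsMeasure, integral_withDensity_eq_integral_toReal_smul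
    (RefPrior.measurable_lik h.measurable θ₀) (ae_of_all _ fun y => ENNReal.ofReal_lt_top)]
  refine integral_congr_ae ?_
  filter_upwards [h.ae_nonneg h.mem_ball] with y hy
  rw [lik, ENNReal.toReal_ofReal hy, smul_eq_mul, mul_comm]

/-- The score and its derivative are only almost everywhere measurable in y, so measurable
representatives are used as coefficients. -/
theorem exists_quadExpansion (h : IsLocallyRegular μ ℓ θ₀ r G) (hI : (fisher μ ℓ θ₀).PosDef) :
    ∃ s V H, QuadExpansion (obsMeasure μ ℓ θ₀) (logRatio ℓ θ₀) s V (fisher μ ℓ θ₀) H r := by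
  have hs : AEMeasurable (fun y => (WithLp.toLp 2 fun i =>
      score ℓ y θ₀ (EuclideanSpace.single i 1) : Param d)) μ :=
    (WithLp.measurable_toLp 2 _).comp_aemeasurable
      (aemeasurable_pi_lambda _ fun i => h.aemeasurable_score _)
  have hV := fun i j : Fin d =>
    h.aemeasurable_scoreDeriv (EuclideanSpace.single i 1) (EuclideanSpace.single j 1)
  have hexp : ∀ u : Param d, u = ∑ i, u i • EuclideanSpace.single i (1 : ℝ) := by
    intro u
    conv_lhs => rw [← (EuclideanSpace.basisFun (Fin d) ℝ).sum_repr u]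
    simp
  have hac : obsMeasure μ ℓ θ₀ ≪ μ := withDensity_absolutelyContinuous _ _
  have hs' : ∀ᵐ y ∂μ, ∀ t, inner ℝ (hs.mk _ y) t = score ℓ y θ₀ t := by
    filter_upwards [hs.ae_eq_mk] with y hy t
    rw [← hy, PiLp.inner_apply]
    conv_rhs => rw [hexp t]
    simp
  have hV' : ∀ᵐ y ∂μ, ∀ i j, (hV i j).mk _ y =
      scoreDeriv ℓ y θ₀ (EuclideanSpace.single i 1) (EuclideanSpace.single j 1) := by
    refine ae_all_iff.2 fun i => ae_all_iff.2 fun j => ?_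
    filter_upwards [(hV i j).ae_eq_mk] with y hy using hy.symm
  have hrem : ∀ᵐ y ∂μ, ∀ v, expansionRem (logRatio ℓ θ₀) (hs.mk _) (fun i j => (hV i j).mk _) v y =
      Real.log (ℓ (θ₀ + v) y) - Real.log (ℓ θ₀ y) - score ℓ y θ₀ v - scoreDeriv ℓ y θ₀ v v / 2 := by
    filter_upwards [hs', hV'] with y h1 h2 v
    rw [expansionRem, h1, logRatio]
    congr 2
    conv_rhs => rw [hexp v]
    simp only [map_sum, map_smul, sum_apply, smul_apply, smul_eq_mul, Finset.mul_sum, h2]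
    rw [Finset.sum_comm]
    refine Finset.sum_congr rfl fun i _ => Finset.sum_congr rfl fun j _ => ?_
    ring
  -- The bound 2G/ℓ(θ₀) is the constant of `norm_score_sub_le`; against the density ℓ(θ₀) it
  -- integrates to 2∫G.
  refine ⟨hs.mk _, fun i j => (hV i j).mk _, fun y => 2 * (G y / ℓ θ₀ y), ?_⟩
  refine
    { measurable_lam := ?_
      measurable_s := hs.measurable_mk
      measurable_V := fun i j => (hV i j).measurable_mk
      r_pos := h.r_pos
      integrable_H := ?_
      integrable_V := fun i j => ?_
      integral_V := fun i j => ?_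
      posDef := hI
      integral_s := fun t => ?_
      integral_s_sq := fun t => ?_
      lam_zero := ?_
      continuousOn := ?_
      abs_rem_le := ?_
      rem_isLittleO := ?_ }
  · have h1 : Measurable fun p : Param d × Y => ℓ (θ₀ + p.1) p.2 :=
      h.measurable.comp ((measurable_fst.const_add θ₀).prodMk measurable_snd)
    have h2 : Measurable fun p : Param d × Y => ℓ θ₀ p.2 :=
      (h.measurable_lik θ₀).comp measurable_snd
    exact h1.log.sub h2.log
  · refine h.integrable_obsMeasure ((h.integrable_bound.const_mul 2).congr ?_)
    filter_upwards [h.nice] with y hy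
    have := (hy.pos θ₀ h.mem_ball).ne'
    field_simp
  · refine h.integrable_obsMeasure ((h.integrable_scoreDeriv_mul_lik
      (EuclideanSpace.single i 1) (EuclideanSpace.single j 1)).congr ?_)
    filter_upwards [hV'] with y hy
    rw [hy]
  · rw [h.integral_obsMeasure, fisher, Matrix.of_apply, neg_neg]
    refine integral_congr_ae ?_
    filter_upwards [hV'] with y hy
    rw [hy]
  · rw [h.integral_obsMeasure, ← h.integral_score_mul_lik t]
    refine integral_congr_ae ?_
    filter_upwards [hs'] with y hy
    rw [hy]
  · rw [h.integral_obsMeasure, h.sum_fisher]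
    refine integral_congr_ae ?_
    filter_upwards [hs'] with y hy
    rw [hy]
  · exact ae_of_all _ fun y => by simp [logRatio]
  · filter_upwards [hac.ae_le h.nice] with y hy v hv
    have hv' : θ₀ + v ∈ Metric.ball θ₀ r := by simpa using hv
    have h1 : ContinuousAt (fun v => θ₀ + v) v := by fun_prop
    have h2 : ContinuousAt (fun t => Real.log (ℓ t y)) (θ₀ + v) := (hy.hasFDerivAt_log hv').continuousAt
    exact ((ContinuousAt.comp (f := fun v => θ₀ + v) h2 h1).sub
      continuousAt_const).continuousWithinAt
  · filter_upwards [hac.ae_le h.nice, hac.ae_le hrem] with y hy hr v hv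
    rw [hr]
    have hp := hy.pos θ₀ h.mem_ball
    have hG := hy.nonneg h.r_pos
    exact abs_taylor_two_le (fun z hz => hy.hasFDerivAt_log hz) (by positivity)
      (fun v hv => hy.norm_score_sub_le h.r_pos hv) hv
  · filter_upwards [hac.ae_le h.nice, hac.ae_le hrem] with y hy hr
    simp_rw [hr]
    exact isLittleO_taylor_two (hy.eventually_hasFDerivAt_log h.r_pos)
      (hy.hasFDerivAt_score h.mem_ball)

theorem ae_jlik_eq [SigmaFinite μ] (h : IsLocallyRegular μ ℓ θ₀ r G) (k : ℕ) :
    ∀ᵐ y ∂(Measure.pi fun _ : Fin k => μ), jlik ℓ k θ₀ y ≠ 0 ∧ ∀ v : Param d, ‖v‖ < r →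
      jlik ℓ k (θ₀ + v) y =
        jlik ℓ k θ₀ y * ENNReal.ofReal (Real.exp (∑ i, logRatio ℓ θ₀ v (y i))) := by
  have h1 : ∀ᵐ y ∂(Measure.pi fun _ : Fin k => μ), ∀ i, IsNiceObs ℓ θ₀ r (G (y i)) (y i) :=
    ae_all_iff.2 fun i => (Measure.quasiMeasurePreserving_eval (fun _ : Fin k => μ) i).ae h.nice
  filter_upwards [h1] with y hy
  have hpos := fun i => (hy i).pos θ₀ h.mem_ball
  refine ⟨Finset.prod_ne_zero_iff.2 fun i _ => by simpa [lik] using hpos i, fun v hv => ?_⟩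
  rw [Real.exp_sum, ENNReal.ofReal_prod_of_nonneg fun i _ => (Real.exp_pos _).le, jlik, jlik,
    ← Finset.prod_mul_distrib]
  refine Finset.prod_congr rfl fun i _ => ?_
  have hp' := (hy i).pos (θ₀ + v) (by simpa using hv)
  rw [lik, lik, ← ENNReal.ofReal_mul (hpos i).le, logRatio, Real.exp_sub, Real.exp_log hp',
    Real.exp_log (hpos i), mul_div_cancel₀ _ (hpos i).ne']

theorem ae_setLIntegral_jlik_eq [SigmaFinite μ] (h : IsLocallyRegular μ ℓ θ₀ r G) {R : ℝ} {k : ℕ}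
    (hk : ∀ v ∈ Metric.closedBall (0 : Param d) R, ‖(√(k : ℝ))⁻¹ • v‖ < r) :
    ∀ᵐ y ∂(Measure.pi fun _ : Fin k => μ), jlik ℓ k θ₀ y ≠ 0 ∧
      ∫⁻ v in Metric.closedBall (0 : Param d) R, jlik ℓ k (θ₀ + (√(k : ℝ))⁻¹ • v) y =
        finExpIntegral (logRatio ℓ θ₀) R k y * jlik ℓ k θ₀ y := by
  filter_upwards [h.ae_jlik_eq k] with y hy
  refine ⟨hy.1, ?_⟩
  rw [mul_comm, finExpIntegral, ← lintegral_const_mul' _ _ (jlik_ne_top k θ₀ y)]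
  exact setLIntegral_congr_fun measurableSet_closedBall fun v hv => hy.2 _ (hk v hv)

/-- Under the law at θ₀ every likelihood ratio has mean one, so Tonelli gives the volume of the
ball. This is the first-moment bound that permits removing the truncation. -/
theorem lintegral_localExpIntegral_le [SigmaFinite μ] (h : IsLocallyRegular μ ℓ θ₀ r G)
    (hlam : Measurable (Function.uncurry (logRatio ℓ θ₀))) {R : ℝ} {k : ℕ}
    (hk : ∀ v ∈ Metric.closedBall (0 : Param d) R, ‖(√(k : ℝ))⁻¹ • v‖ < r) :
    ∫⁻ ω, localExpIntegral (logRatio ℓ θ₀) R k ω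
      ∂(Measure.infinitePi fun _ : ℕ => obsMeasure μ ℓ θ₀) ≤
        volume (Metric.closedBall (0 : Param d) R) := by
  have hP := h.isProbabilityMeasure_obsMeasure
  simp_rw [← finExpIntegral_val]
  rw [← lintegral_mul_jlik (μ := μ) h.measurable (measurable_finExpIntegral hlam R k),
    lintegral_congr_ae ((h.ae_setLIntegral_jlik_eq hk).mono fun y hy => hy.2.symm),
    lintegral_lintegral_swap]
  · rw [setLIntegral_congr_fun (g := fun _ => 1) measurableSet_closedBall]
    · simp
    · exact fun v hv => lintegral_jlik h.measurable (h.density _ (by simpa using hk v hv)) k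
  · exact (measurable_jlik_affine h.measurable k θ₀ _).aemeasurable

/-- Factoring ℓ_k(θ₀)^α out of the mixture rebuilds ℓ_k(θ₀), so the affinity is the α-th moment,
under the law at θ₀, of the integrated likelihood ratio. -/
theorem tendsto_localised [SigmaFinite μ] (h : IsLocallyRegular μ ℓ θ₀ r G)
    (hI : (fisher μ ℓ θ₀).PosDef) {α : ℝ} (hα₀ : 0 < α) (hα₁ : α < 1) {R : ℝ} (hR : 0 < R) :
    Tendsto (fun k : ℕ => ∫⁻ y : Fin k → Y, (∫⁻ v in Metric.closedBall (0 : Param d) R,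
        jlik ℓ k (θ₀ + (√(k : ℝ))⁻¹ • v) y) ^ α * jlik ℓ k θ₀ y ^ (1 - α)
        ∂(Measure.pi fun _ => μ)) atTop
      (𝓝 (∫⁻ x, quadExpIntegral (fisher μ ℓ θ₀) R x ^ α
        ∂(multivariateGaussian 0 (fisher μ ℓ θ₀)))) := by
  have hP := h.isProbabilityMeasure_obsMeasure
  obtain ⟨s, V, H, hQ⟩ := h.exists_quadExpansion hI
  have hk := eventually_norm_smul_lt (d := d) R h.r_pos
  refine (hQ.tendsto_rpow hα₀ hα₁ hR (measure_closedBall_lt_top.ne)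
    (hk.mono fun k hk => h.lintegral_localExpIntegral_le hQ.measurable_lam hk)).congr' ?_
  filter_upwards [hk] with k hk
  simp_rw [← finExpIntegral_val]
  rw [← lintegral_mul_jlik (μ := μ) h.measurable (F := fun y => finExpIntegral (logRatio ℓ θ₀) R k y ^ α)
    ((measurable_finExpIntegral hQ.measurable_lam R k).pow_const α)]
  refine lintegral_congr_ae ?_
  filter_upwards [h.ae_setLIntegral_jlik_eq hk] with y hy
  rw [hy.2, ENNReal.mul_rpow_of_nonneg _ _ hα₀.le, mul_assoc,
    ← ENNReal.rpow_add _ _ hy.1 (jlik_ne_top k θ₀ y)]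
  simp

end IsLocallyRegular

end LocalModel

/-! ### Affinities with weights on the scale of the sample size. -/

section LocalAffinity

variable {d : ℕ} {Y : Type*} [MeasurableSpace Y] {μ : Measure Y} {ℓ : Param d → Y → ℝ}

theorem lintegral_comp_affine {c : ℝ} (hc : c ≠ 0) (θ : Param d) {F : Param d → ℝ≥0∞}
    (hF : Measurable F) :
    ∫⁻ v, F (θ + c • v) = ENNReal.ofReal |(c ^ d)⁻¹| * ∫⁻ u, F u := by
  have h1 := Measure.map_addHaar_smul (volume : Measure (Param d)) hc
  rw [finrank_euclideanSpace_fin] at h1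
  have hm : Measurable fun u => F (θ + u) := hF.comp (measurable_const_add θ)
  rw [← lintegral_map (f := fun u => F (θ + u)) hm (measurable_const_smul c), h1,
    lintegral_smul_measure, smul_eq_mul, lintegral_add_left_eq_self F θ]

theorem setLIntegral_closedBall_comp_affine {c : ℝ} (hc : 0 < c) (θ : Param d) (R : ℝ)
    {F : Param d → ℝ≥0∞} (hF : Measurable F) :
    ∫⁻ v in Metric.closedBall 0 R, F (θ + c • v) =
      ENNReal.ofReal |(c ^ d)⁻¹| * ∫⁻ u in Metric.closedBall θ (c * R), F u := by
  rw [← lintegral_indicator measurableSet_closedBall, ← lintegral_indicator measurableSet_closedBall,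
    ← lintegral_comp_affine hc.ne' θ (hF.indicator measurableSet_closedBall)]
  refine lintegral_congr fun v => ?_
  have : θ + c • v ∈ Metric.closedBall θ (c * R) ↔ v ∈ Metric.closedBall (0 : Param d) R := by
    simp [norm_smul, abs_of_pos hc, hc]
  by_cases hv : v ∈ Metric.closedBall (0 : Param d) R
  · rw [Set.indicator_of_mem hv, Set.indicator_of_mem (this.2 hv)]
  · rw [Set.indicator_of_notMem hv, Set.indicator_of_notMem (mt this.1 hv)]

/-- Lebesgue's differentiation theorem on the balls of radius R/√k, read after rescaling to the
fixed ball of radius R. -/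
theorem ae_tendsto_oscillation {g : Param d → ℝ≥0} (hg : Measurable g) {M : ℝ≥0}
    (hM : ∀ θ, g θ ≤ M) :
    ∀ᵐ θ : Param d, ∀ R : ℝ, 0 < R → Tendsto (fun k : ℕ => ∫⁻ v in Metric.closedBall 0 R,
      ‖(g (θ + (√(k : ℝ))⁻¹ • v) : ℝ) - g θ‖ₑ) atTop (𝓝 0) := by
  have hloc : LocallyIntegrable (fun θ => (g θ : ℝ)) (volume : Measure (Param d)) := by
    refine (locallyIntegrable_const (M : ℝ)).mono (by fun_prop) (ae_of_all _ fun θ => ?_)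
    simpa using hM θ
  filter_upwards [(Besicovitch.vitaliFamily
    (volume : Measure (Param d))).ae_tendsto_lintegral_enorm_sub_div hloc] with θ hθ R hR
  have h1 : Tendsto (fun k : ℕ => (√(k : ℝ))⁻¹ * R) atTop (𝓝[>] 0) := by
    refine tendsto_nhdsWithin_iff.2 ⟨?_, ?_⟩
    · have := (tendsto_inv_atTop_zero.comp
        (Real.tendsto_sqrt_atTop.comp tendsto_natCast_atTop_atTop)).mul_const R
      simpa using this
    · filter_upwards [eventually_gt_atTop 0] with k hk
      have : (0 : ℝ) < k := by exact_mod_cast hk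
      simp only [Set.mem_Ioi]
      positivity
  have h2 := (hθ.comp (Besicovitch.tendsto_filterAt (volume : Measure (Param d)) θ)).comp h1
  have h3 := ENNReal.Tendsto.mul_const (b := volume (Metric.closedBall (0 : Param d) R)) h2
    (Or.inr measure_closedBall_lt_top.ne)
  rw [zero_mul] at h3
  refine h3.congr' ?_
  filter_upwards [eventually_gt_atTop 0] with k hk
  have hk' : (0 : ℝ) < k := by exact_mod_cast hk
  have hc : 0 < (√(k : ℝ))⁻¹ := by positivity
  have hm : Measurable fun u => ‖(g u : ℝ) - g θ‖ₑ := by fun_prop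
  rw [setLIntegral_closedBall_comp_affine hc θ R hm]
  have hv := setLIntegral_closedBall_comp_affine hc θ R (F := fun _ => 1) measurable_const
  simp only [setLIntegral_const, one_mul] at hv
  have hpos : volume (Metric.closedBall θ ((√(k : ℝ))⁻¹ * R)) ≠ 0 :=
    (Metric.measure_closedBall_pos _ _ (by positivity)).ne'
  simp only [Function.comp_apply, hv]
  rw [mul_left_comm, ENNReal.div_mul_cancel hpos measure_closedBall_lt_top.ne]

/-- The affinity between the joint likelihood at `θ` and its mixture with weight `w` over the
neighbours `θ + k^{-1/2} v`. -/
def localAffinity (α : ℝ) (μ : Measure Y) [SigmaFinite μ] (ℓ : Param d → Y → ℝ) (k : ℕ)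
    (θ : Param d) (w : Param d → ℝ≥0∞) : ℝ≥0∞ :=
  ∫⁻ y : Fin k → Y, (∫⁻ v, w v * jlik ℓ k (θ + (√(k : ℝ))⁻¹ • v) y) ^ α * jlik ℓ k θ y ^ (1 - α)
    ∂(Measure.pi fun _ => μ)

section Basic

variable [SigmaFinite μ] {α : ℝ} {k : ℕ} {θ : Param d}

theorem measurable_weighted_jlik (hℓ : Measurable (Function.uncurry ℓ)) (k : ℕ) (θ : Param d)
    {w : Param d → ℝ≥0∞} (hw : Measurable w) :
    Measurable fun p : (Fin k → Y) × Param d =>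
      w p.2 * jlik ℓ k (θ + (√(k : ℝ))⁻¹ • p.2) p.1 :=
  (hw.comp measurable_snd).mul (measurable_jlik_affine hℓ k θ _)

theorem measurable_lintegral_weighted_jlik (hℓ : Measurable (Function.uncurry ℓ)) (k : ℕ)
    (θ : Param d) {w : Param d → ℝ≥0∞} (hw : Measurable w) :
    Measurable fun y : Fin k → Y => ∫⁻ v, w v * jlik ℓ k (θ + (√(k : ℝ))⁻¹ • v) y :=
  Measurable.lintegral_prod_right' (f := fun p : (Fin k → Y) × Param d =>
    w p.2 * jlik ℓ k (θ + (√(k : ℝ))⁻¹ • p.2) p.1) (measurable_weighted_jlik hℓ k θ hw)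

theorem localAffinity_mono (hα₀ : 0 ≤ α) {w w' : Param d → ℝ≥0∞} (h : ∀ v, w v ≤ w' v) :
    localAffinity α μ ℓ k θ w ≤ localAffinity α μ ℓ k θ w' := by
  unfold localAffinity
  gcongr
  exact h _

theorem localAffinity_const_mul (hα₀ : 0 ≤ α) {c : ℝ≥0∞} (hc : c ≠ ∞) (w : Param d → ℝ≥0∞) :
    localAffinity α μ ℓ k θ (fun v => c * w v) = c ^ α * localAffinity α μ ℓ k θ w := by
  unfold localAffinity
  rw [← lintegral_const_mul' _ _ (ENNReal.rpow_ne_top_of_nonneg hα₀ hc)]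
  refine lintegral_congr fun y => ?_
  simp_rw [mul_assoc]
  rw [lintegral_const_mul' _ _ hc, ENNReal.mul_rpow_of_nonneg _ _ hα₀, mul_assoc]

/-- Subadditivity of t ↦ t^α allows a weight to be split into ball and tail, and into a frozen
density and its oscillation. -/
theorem localAffinity_add_le (hℓ : Measurable (Function.uncurry ℓ)) (hα₀ : 0 ≤ α) (hα₁ : α ≤ 1)
    {w w' : Param d → ℝ≥0∞} (hw : Measurable w) :
    localAffinity α μ ℓ k θ (fun v => w v + w' v) ≤
      localAffinity α μ ℓ k θ w + localAffinity α μ ℓ k θ w' := by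
  unfold localAffinity
  rw [← lintegral_add_left (f := fun y : Fin k → Y =>
    (∫⁻ v, w v * jlik ℓ k (θ + (√(k : ℝ))⁻¹ • v) y) ^ α * jlik ℓ k θ y ^ (1 - α))
    (((measurable_lintegral_weighted_jlik hℓ k θ hw).pow_const α).mul
    ((measurable_jlik hℓ k θ).pow_const _))]
  refine lintegral_mono fun y => ?_
  have hm : Measurable fun v => w v * jlik ℓ k (θ + (√(k : ℝ))⁻¹ • v) y :=
    (measurable_weighted_jlik hℓ k θ hw).comp (measurable_const.prodMk measurable_id)
  simp_rw [add_mul]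
  rw [lintegral_add_left hm, ← add_mul]
  gcongr
  exact ENNReal.rpow_add_le_add_rpow _ _ hα₀ hα₁

/-- Hölder with exponents 1/α and 1/(1-α), then Tonelli. A weight small in L¹ thus contributes a
small affinity, uniformly in k. -/
theorem localAffinity_le (hℓ : Measurable (Function.uncurry ℓ)) (hα₀ : 0 ≤ α) (hα₁ : α ≤ 1)
    {w : Param d → ℝ≥0∞} (hw : Measurable w) (hθ : ∫⁻ y, lik ℓ θ y ∂μ = 1)
    (hv : ∀ v, w v ≠ 0 → ∫⁻ y, lik ℓ (θ + (√(k : ℝ))⁻¹ • v) y ∂μ = 1) :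
    localAffinity α μ ℓ k θ w ≤ (∫⁻ v, w v) ^ α := by
  refine (ENNReal.lintegral_mul_norm_pow_le
    (measurable_lintegral_weighted_jlik hℓ k θ hw).aemeasurable
    (measurable_jlik hℓ k θ).aemeasurable hα₀ (by linarith) (by ring)).trans ?_
  rw [lintegral_jlik hℓ hθ, ENNReal.one_rpow, mul_one, lintegral_lintegral_swap
    (measurable_weighted_jlik hℓ k θ hw).aemeasurable]
  gcongr with v
  rw [lintegral_const_mul _ (measurable_jlik hℓ k _)]
  rcases eq_or_ne (w v) 0 with h | h
  · simp [h]
  · rw [lintegral_jlik hℓ (hv v h), mul_one]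

end Basic

/-- Uniform control of the total variation distance by the Euclidean distance. -/
structure IsBiLipschitzOn (μ : Measure Y) (ℓ : Param d → Y → ℝ) (K : Set (Param d)) (a b : ℝ) :
    Prop where
  measurable : Measurable (Function.uncurry ℓ)
  measurableSet : MeasurableSet K
  density : ∀ θ ∈ K, ∫⁻ y, lik ℓ θ y ∂μ = 1
  pos : 0 < a
  nonneg : 0 ≤ b
  lower : ∀ θ ∈ K, ∀ θ' ∈ K, ENNReal.ofReal (a * ‖θ - θ'‖) ≤ l1Dist μ (lik ℓ θ) (lik ℓ θ')
  upper : ∀ θ ∈ K, ∀ θ' ∈ K, l1Dist μ (lik ℓ θ) (lik ℓ θ') ≤ ENNReal.ofReal (b * ‖θ - θ'‖)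

theorem IsRegularOn.exists_isBiLipschitzOn {Θ U K : Set (Param d)} (h : IsRegularOn μ ℓ Θ U)
    (hK : IsCompact K) (hKΘ : K ⊆ Θ) : ∃ a b, IsBiLipschitzOn μ ℓ K a b := by
  obtain ⟨b, hb, hbK⟩ := h.exists_l1Dist_le hK hKΘ
  obtain ⟨a, ha, haK⟩ := h.exists_le_l1Dist hK hKΘ
  exact ⟨a, b, h.measurable, hK.measurableSet,
    fun θ hθ => h.density θ (h.subset (hKΘ hθ)), ha, hb, haK, hbK⟩

/-- The bound on the tail of the local affinity. -/
def tailBound (d : ℕ) (α a R : ℝ) : ℝ≥0∞ :=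
  ∫⁻ h : Param d in {h | R / 2 < ‖h‖}, ENNReal.ofReal (Real.exp (-(min α (1 - α) * a ^ 2 / 64) * ‖h‖ ^ 2))

theorem tendsto_tailBound (d : ℕ) {α a : ℝ} (hα₀ : 0 < α) (hα₁ : α < 1) (ha : 0 < a) :
    Tendsto (tailBound d α a) atTop (𝓝 0) := by
  have : 0 < min α (1 - α) := lt_min hα₀ (by linarith)
  exact tendsto_gaussian_tail (by positivity)

theorem IsBiLipschitzOn.localAffinity_tail_le [SigmaFinite μ] {K : Set (Param d)} {a b : ℝ}
    (h : IsBiLipschitzOn μ ℓ K a b) {α : ℝ} (hα₀ : 0 < α) (hα₁ : α < 1) {R : ℝ}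
    (hR : 2 * √d ≤ R) (hR' : 2 * b * √d ≤ a * R) {k : ℕ} (hk : 0 < k) {θ : Param d} (hθ : θ ∈ K)
    {w : Param d → ℝ≥0∞} {M : ℝ≥0∞} (hM : M ≠ ∞) (hwM : ∀ v, w v ≤ M)
    (hw : ∀ v, w v ≠ 0 → θ + (√(k : ℝ))⁻¹ • v ∈ K ∧ R < ‖v‖) :
    localAffinity α μ ℓ k θ w ≤ M ^ α * tailBound d α a R := by
  have hk' : (0 : ℝ) < k := by exact_mod_cast hk
  set c := (√(k : ℝ))⁻¹ with hc
  have hc0 : 0 < c := by positivity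
  set S := {v : Param d | θ + c • v ∈ K} with hS
  have hSm : MeasurableSet S := by
    have : Measurable fun v : Param d => θ + c • v := by fun_prop
    exact this h.measurableSet
  have hTm : MeasurableSet (S ∩ {v | R < ‖v‖}) :=
    hSm.inter (measurableSet_lt measurable_const measurable_norm)
  have hq : Measurable (Function.uncurry fun v : Param d => lik ℓ (θ + c • v)) := by
    have h1 : Measurable fun p : Param d × Y => (θ + c • p.1, p.2) := by fun_prop
    exact (measurable_uncurry_lik h.measurable).comp h1
  -- In the variable v the comparison constants are a/√k and b/√k, so k(a/√k)² = a²: the exponent of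
  -- the tail bound does not depend on k. The condition relating a, b and R is unchanged by the
  -- scaling.
  have hkc : k * (a * c) ^ 2 = a ^ 2 := by
    rw [mul_pow, hc, inv_pow, Real.sq_sqrt hk'.le]
    field_simp
  have key := tail_affinity_le (μ := μ) hq hα₀ hα₁ hSm (measurable_lik h.measurable θ)
    (h.density θ hθ) (fun v hv => h.density _ hv) (a := a * c) (b := b * c) (R := R)
    (mul_pos h.pos hc0) (fun v hv v' hv' => (h.upper _ hv _ hv').trans_eq (by
      rw [add_sub_add_left_eq_sub, ← smul_sub, norm_smul, Real.norm_of_nonneg hc0.le, mul_assoc]))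
    (mul_nonneg h.nonneg hc0.le) (fun v hv => le_trans (le_of_eq (by
      rw [add_sub_cancel_left, norm_smul, Real.norm_of_nonneg hc0.le, mul_assoc]))
      (h.lower _ hv _ hθ)) hR (by nlinarith) k
  rw [hkc] at key
  refine le_trans ?_ (mul_le_mul_right key (M ^ α))
  calc localAffinity α μ ℓ k θ w
      ≤ localAffinity α μ ℓ k θ (fun v => M * (S ∩ {v | R < ‖v‖}).indicator 1 v) := by
        refine localAffinity_mono hα₀.le fun v => ?_
        by_cases hv : v ∈ S ∩ {v | R < ‖v‖}
        · simpa [hv] using hwM v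
        · have : w v = 0 := by
            by_contra h0
            exact hv (hw v h0)
          simp [this]
    _ = _ := by
        rw [localAffinity_const_mul hα₀.le hM, localAffinity]
        congr 1
        refine lintegral_congr fun y => ?_
        congr 2
        rw [← lintegral_indicator hTm]
        refine lintegral_congr fun v => ?_
        by_cases hv : v ∈ S ∩ {v | R < ‖v‖} <;> simp [hv, jlik, hc]

end LocalAffinity

/-! ### Pointwise limit of the rescaled affinity. -/

section MixtureAffinity

variable {d : ℕ} {Y : Type*} [MeasurableSpace Y] {μ : Measure Y} {ℓ : Param d → Y → ℝ}
  [SigmaFinite μ] {α : ℝ} {K : Set (Param d)} {a b : ℝ} {g : Param d → ℝ≥0} {M : ℝ≥0}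

theorem eventually_tail_radius (d : ℕ) {a : ℝ} (ha : 0 < a) (b : ℝ) :
    ∀ᶠ n : ℕ in atTop, 0 < (n : ℝ) ∧ 2 * √d ≤ (n : ℝ) ∧ 2 * b * √d ≤ a * n := by
  have h := tendsto_natCast_atTop_atTop (R := ℝ)
  filter_upwards [h.eventually_gt_atTop 0, h.eventually_ge_atTop (2 * √d),
    (h.const_mul_atTop ha).eventually_ge_atTop (2 * b * √d)] with n h1 h2 h3 using ⟨h1, h2, h3⟩

/-- The affinity at `θ` with the rescaled prior density `g`. -/
def rescaledAffinity (α : ℝ) (μ : Measure Y) [SigmaFinite μ] (ℓ : Param d → Y → ℝ)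
    (g : Param d → ℝ≥0) (k : ℕ) (θ : Param d) : ℝ≥0∞ :=
  localAffinity α μ ℓ k θ fun v => g (θ + (√(k : ℝ))⁻¹ • v)

theorem measurable_rescaled (hg : Measurable g) (k : ℕ) (θ : Param d) :
    Measurable fun v : Param d => (g (θ + (√(k : ℝ))⁻¹ • v) : ℝ≥0∞) := by
  fun_prop

/-- The rescaled affinity is at most the contribution of a ball plus a uniform tail. -/
theorem IsBiLipschitzOn.rescaledAffinity_le_add (h : IsBiLipschitzOn μ ℓ K a b) (hα₀ : 0 < α)
    (hα₁ : α < 1) (hg : Measurable g) (hM : ∀ θ, g θ ≤ M) (hgK : ∀ θ, g θ ≠ 0 → θ ∈ K) {R : ℝ}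
    (hR : 2 * √d ≤ R) (hR' : 2 * b * √d ≤ a * R) {k : ℕ} (hk : 0 < k) {θ : Param d} (hθ : θ ∈ K) :
    rescaledAffinity α μ ℓ g k θ ≤
      localAffinity α μ ℓ k θ ((Metric.closedBall 0 R).indicator fun v =>
        (g (θ + (√(k : ℝ))⁻¹ • v) : ℝ≥0∞)) + M ^ α * tailBound d α a R := by
  set w : Param d → ℝ≥0∞ := fun v => g (θ + (√(k : ℝ))⁻¹ • v) with hw
  set B : Set (Param d) := Metric.closedBall 0 R with hB
  have hBm : MeasurableSet B := measurableSet_closedBall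
  have htail : localAffinity α μ ℓ k θ (Bᶜ.indicator w) ≤ (M : ℝ≥0∞) ^ α * tailBound d α a R := by
    refine h.localAffinity_tail_le hα₀ hα₁ hR hR' hk hθ ENNReal.coe_ne_top (fun v => ?_) fun v hv => ?_
    · exact (Set.indicator_le_self _ _ v).trans (ENNReal.coe_le_coe.2 (hM _))
    · obtain ⟨h1, h2⟩ := Set.indicator_apply_ne_zero.1 hv
      refine ⟨hgK _ (by simpa [hw] using h2), ?_⟩
      simpa [hB] using h1
  refine le_trans (le_of_eq ?_) ((localAffinity_add_le (w' := Bᶜ.indicator w) h.measurable hα₀.le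
    hα₁.le ((measurable_rescaled hg k θ).indicator hBm)).trans (add_le_add_right htail _))
  rw [rescaledAffinity]
  congr 1
  ext v
  by_cases hv : v ∈ B <;> simp [hv, hw]

/-- A radius with tail below 1 is fixed and Hölder's bound used on the ball. The uniform constant
serves for dominated convergence in θ and for the finiteness of `gaussMoment`. -/
theorem IsBiLipschitzOn.exists_rescaledAffinity_le (h : IsBiLipschitzOn μ ℓ K a b) (hα₀ : 0 < α)
    (hα₁ : α < 1) (hg : Measurable g) (hM : ∀ θ, g θ ≤ M) (hgK : ∀ θ, g θ ≠ 0 → θ ∈ K) :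
    ∃ C : ℝ≥0∞, C ≠ ∞ ∧ ∀ k : ℕ, 0 < k → ∀ θ ∈ K, rescaledAffinity α μ ℓ g k θ ≤ C := by
  have h1 : ∀ᶠ n : ℕ in atTop, tailBound d α a n < 1 :=
    ((tendsto_tailBound d hα₀ hα₁ h.pos).comp tendsto_natCast_atTop_atTop).eventually_lt_const
      one_pos
  obtain ⟨n, ⟨hn0, hn1, hn2⟩, hn3⟩ := ((eventually_tail_radius d h.pos b).and h1).exists
  have hMα : (M : ℝ≥0∞) ^ α ≠ ∞ := ENNReal.rpow_ne_top_of_nonneg hα₀.le ENNReal.coe_ne_top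
  refine ⟨(M * volume (Metric.closedBall (0 : Param d) n)) ^ α + M ^ α * 1,
    ENNReal.add_ne_top.2 ⟨ENNReal.rpow_ne_top_of_nonneg hα₀.le
      (ENNReal.mul_ne_top ENNReal.coe_ne_top measure_closedBall_lt_top.ne), by simpa using hMα⟩,
    fun k hk θ hθ => (h.rescaledAffinity_le_add hα₀ hα₁ hg hM hgK hn1 hn2 hk hθ).trans ?_⟩
  gcongr
  refine (localAffinity_le h.measurable hα₀.le hα₁.le
    ((measurable_rescaled hg k θ).indicator measurableSet_closedBall) (h.density θ hθ)
    fun v hv => ?_).trans ?_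
  · refine h.density _ (hgK _ ?_)
    simpa using (Set.indicator_apply_ne_zero.1 hv).2
  · gcongr
    rw [lintegral_indicator measurableSet_closedBall]
    refine (setLIntegral_mono (g := fun _ => (M : ℝ≥0∞)) measurable_const fun v _ => ?_).trans ?_
    · exact_mod_cast hM _
    · simp

theorem coe_le_add_enorm_sub (x y : ℝ≥0) : (x : ℝ≥0∞) ≤ y + ‖(x : ℝ) - y‖ₑ := by
  have h1 : (x : ℝ≥0∞) = ENNReal.ofReal (x : ℝ) := by simp
  have h2 : (y : ℝ≥0∞) = ENNReal.ofReal (y : ℝ) := by simp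
  rw [h1, h2, ← ofReal_norm, ← ENNReal.ofReal_add (by positivity) (norm_nonneg _)]
  refine ENNReal.ofReal_le_ofReal ?_
  have := le_abs_self ((x : ℝ) - y)
  rw [Real.norm_eq_abs]
  linarith

theorem localAffinity_indicator (R : ℝ) (k : ℕ) (θ : Param d) :
    localAffinity α μ ℓ k θ ((Metric.closedBall 0 R).indicator 1) =
      ∫⁻ y : Fin k → Y, (∫⁻ v in Metric.closedBall (0 : Param d) R,
        jlik ℓ k (θ + (√(k : ℝ))⁻¹ • v) y) ^ α * jlik ℓ k θ y ^ (1 - α)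
        ∂(Measure.pi fun _ => μ) := by
  unfold localAffinity
  refine lintegral_congr fun y => ?_
  congr 2
  rw [← lintegral_indicator measurableSet_closedBall]
  refine lintegral_congr fun v => ?_
  by_cases hv : v ∈ Metric.closedBall (0 : Param d) R
  · rw [Set.indicator_of_mem hv, Set.indicator_of_mem hv, Pi.one_apply, one_mul]
  · rw [Set.indicator_of_notMem hv, Set.indicator_of_notMem hv, zero_mul]

/-- Limit of the rescaled affinity at a parameter where the prior density does not oscillate. -/
theorem IsBiLipschitzOn.tendsto_rescaledAffinity (h : IsBiLipschitzOn μ ℓ K a b) (hα₀ : 0 < α)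
    (hα₁ : α < 1) (hg : Measurable g) (hM : ∀ θ, g θ ≤ M) (hgK : ∀ θ, g θ ≠ 0 → θ ∈ K)
    {θ : Param d} (hθ : θ ∈ K) {r : ℝ} {G : Y → ℝ} (hreg : IsLocallyRegular μ ℓ θ r G)
    (hI : (fisher μ ℓ θ).PosDef)
    (hosc : ∀ R : ℝ, 0 < R → Tendsto (fun k : ℕ => ∫⁻ v in Metric.closedBall 0 R,
      ‖(g (θ + (√(k : ℝ))⁻¹ • v) : ℝ) - g θ‖ₑ) atTop (𝓝 0)) :
    Tendsto (fun k => rescaledAffinity α μ ℓ g k θ) atTop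
      (𝓝 ((g θ : ℝ≥0∞) ^ α *
        (ENNReal.ofReal (|(fisher μ ℓ θ).det| ^ (-α / 2)) * gaussMoment d α))) := by
  set c : ℝ≥0∞ := (g θ : ℝ≥0∞) with hc
  have hcα : c ^ α ≠ ∞ := ENNReal.rpow_ne_top_of_nonneg hα₀.le ENNReal.coe_ne_top
  set σ : ℕ → ℝ≥0∞ := fun n => ∫⁻ x, quadExpIntegral (fisher μ ℓ θ) n x ^ α
        ∂(multivariateGaussian 0 (fisher μ ℓ θ)) with hσ
  set s : ℕ → ℕ → ℝ≥0∞ := fun n k =>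
    localAffinity α μ ℓ k θ ((Metric.closedBall 0 n).indicator 1) with hs
  set e : ℕ → Param d → ℝ≥0∞ := fun k v => ‖(g (θ + (√(k : ℝ))⁻¹ • v) : ℝ) - g θ‖ₑ with he
  have hem : ∀ k, Measurable (e k) := fun k => by fun_prop
  set δ : ℕ → ℕ → ℝ≥0∞ := fun n k => (∫⁻ v in Metric.closedBall 0 n, e k v) ^ α with hδ
  have hs_lim : ∀ n : ℕ, 0 < (n : ℝ) → Tendsto (s n) atTop (𝓝 (σ n)) := fun n hn => by
    simp_rw [hs, localAffinity_indicator]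
    exact hreg.tendsto_localised hI hα₀ hα₁ hn
  have hδ_lim : ∀ n : ℕ, 0 < (n : ℝ) → Tendsto (δ n) atTop (𝓝 0) := fun n hn => by
    have := (ENNReal.continuous_rpow_const (y := α)).continuousAt.tendsto.comp (hosc n hn)
    rwa [ENNReal.zero_rpow_of_pos hα₀] at this
  have hσ_lim : Tendsto σ atTop
      (𝓝 (ENNReal.ofReal (|(fisher μ ℓ θ).det| ^ (-α / 2)) * gaussMoment d α)) := by
    rw [← lintegral_quadExpFull hI hα₀]
    exact tendsto_lintegral_quadExpIntegral _ hα₀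
  have hcσ := ENNReal.Tendsto.const_mul hσ_lim (Or.inr hcα)
  have hBm : ∀ n : ℕ, MeasurableSet (Metric.closedBall (0 : Param d) n) :=
    fun n => measurableSet_closedBall
  -- The points θ + v/√k may leave K here, since the oscillation weight does not vanish where g
  -- does. They eventually lie in the ball of local regularity, where the likelihood is still a
  -- probability density.
  have herr : ∀ n : ℕ, ∀ᶠ k in atTop,
      localAffinity α μ ℓ k θ ((Metric.closedBall 0 n).indicator (e k)) ≤ δ n k := fun n => by
    filter_upwards [eventually_norm_smul_lt (d := d) n hreg.r_pos] with k hk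
    refine (localAffinity_le h.measurable hα₀.le hα₁.le ((hem k).indicator (hBm n))
      (h.density θ hθ) fun v hv => ?_).trans_eq ?_
    · exact hreg.density _ (by simpa using hk v (Set.indicator_apply_ne_zero.1 hv).1)
    · rw [lintegral_indicator (hBm n)]
  have hcs : ∀ (n k : ℕ), localAffinity α μ ℓ k θ (fun v =>
      c * (Metric.closedBall (0 : Param d) n).indicator 1 v) = c ^ α * s n k :=
    fun n k => localAffinity_const_mul hα₀.le ENNReal.coe_ne_top _
  have hcm : ∀ n : ℕ, Measurable fun v : Param d =>
      c * (Metric.closedBall (0 : Param d) n).indicator 1 v := fun n =>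
    (measurable_one.indicator (hBm n)).const_mul c
  -- On the ball, g is at most its value at θ plus the oscillation; outside it the uniform tail is
  -- added. The limit k → ∞ is taken with the radius n fixed, and n → ∞ only at the end.
  have hupper : ∀ᶠ n : ℕ in atTop, limsup (fun k => rescaledAffinity α μ ℓ g k θ) atTop ≤
      c ^ α * σ n + M ^ α * tailBound d α a n := by
    filter_upwards [eventually_tail_radius d h.pos b] with n hn
    have hlim : Tendsto (fun k => c ^ α * s n k + δ n k + M ^ α * tailBound d α a n) atTop
        (𝓝 (c ^ α * σ n + 0 + M ^ α * tailBound d α a n)) :=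
      ((ENNReal.Tendsto.const_mul (hs_lim n hn.1) (Or.inr hcα)).add (hδ_lim n hn.1)).add_const _
    rw [add_zero] at hlim
    rw [← hlim.limsup_eq]
    refine limsup_le_limsup ?_
    filter_upwards [herr n, eventually_gt_atTop 0] with k hk hk0
    refine (h.rescaledAffinity_le_add hα₀ hα₁ hg hM hgK hn.2.1 hn.2.2 hk0 hθ).trans ?_
    gcongr
    rw [← hcs]
    refine le_trans (localAffinity_mono hα₀.le (w' := fun v =>
      c * (Metric.closedBall (0 : Param d) n).indicator 1 v +
        (Metric.closedBall 0 n).indicator (e k) v) fun v => ?_)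
      ((localAffinity_add_le h.measurable hα₀.le hα₁.le (hcm n)).trans (add_le_add_right hk _))
    by_cases hv : v ∈ Metric.closedBall (0 : Param d) n
    · simp only [Set.indicator_of_mem hv, Pi.one_apply, mul_one]
      exact coe_le_add_enorm_sub _ _
    · simp only [Set.indicator_of_notMem hv, zero_le]
  -- For the lower bound the weight outside the ball is discarded.
  have hlower : ∀ᶠ n : ℕ in atTop,
      c ^ α * σ n ≤ liminf (fun k => rescaledAffinity α μ ℓ g k θ) atTop := by
    filter_upwards [eventually_gt_atTop 0] with n hn
    have hn' : 0 < (n : ℝ) := by exact_mod_cast hn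
    have hlim : Tendsto (fun k => c ^ α * s n k - δ n k) atTop (𝓝 (c ^ α * σ n - 0)) :=
      ENNReal.Tendsto.sub (ENNReal.Tendsto.const_mul (hs_lim n hn') (Or.inr hcα)) (hδ_lim n hn')
        (Or.inr ENNReal.zero_ne_top)
    rw [tsub_zero] at hlim
    rw [← hlim.liminf_eq]
    refine liminf_le_liminf ?_
    filter_upwards [herr n] with k hk
    rw [tsub_le_iff_right, ← hcs]
    refine le_trans (localAffinity_mono hα₀.le (w' := fun v => (g (θ + (√(k : ℝ))⁻¹ • v) : ℝ≥0∞) +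
        (Metric.closedBall 0 n).indicator (e k) v) fun v => ?_)
      ((localAffinity_add_le h.measurable hα₀.le hα₁.le (measurable_rescaled hg k θ)).trans
        (add_le_add_right hk _))
    by_cases hv : v ∈ Metric.closedBall (0 : Param d) n
    · simp only [Set.indicator_of_mem hv, Pi.one_apply, mul_one]
      have := coe_le_add_enorm_sub (g θ) (g (θ + (√(k : ℝ))⁻¹ • v))
      rwa [enorm_sub_rev] at this
    · simp only [Set.indicator_of_notMem hv, mul_zero, zero_le]
  refine tendsto_of_le_liminf_of_limsup_le (le_of_tendsto hcσ hlower) ?_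
  have htail := ENNReal.Tendsto.const_mul (a := (M : ℝ≥0∞) ^ α)
    ((tendsto_tailBound d hα₀ hα₁ h.pos).comp tendsto_natCast_atTop_atTop)
    (Or.inr (ENNReal.rpow_ne_top_of_nonneg hα₀.le ENNReal.coe_ne_top))
  have := hcσ.add htail
  rw [mul_zero, add_zero] at this
  exact ge_of_tendsto this hupper

end MixtureAffinity

/-! ### Integrated limit over the parameter. -/

section MixtureLimit

variable {d : ℕ} {Y : Type*} [MeasurableSpace Y] {μ : Measure Y} {ℓ : Param d → Y → ℝ}
  {α : ℝ} {g : Param d → ℝ≥0}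

/-- The density of the limit functional, up to constants. -/
def limitDensity (α : ℝ) (μ : Measure Y) (ℓ : Param d → Y → ℝ) (g : Param d → ℝ≥0)
    (θ : Param d) : ℝ :=
  (g θ : ℝ) ^ (1 + α) * |(fisher μ ℓ θ).det| ^ (-α / 2)

theorem ofReal_limitDensity (hα₀ : 0 < α) (θ : Param d) :
    ENNReal.ofReal (limitDensity α μ ℓ g θ) * gaussMoment d α = g θ * ((g θ : ℝ≥0∞) ^ α *
      (ENNReal.ofReal (|(fisher μ ℓ θ).det| ^ (-α / 2)) * gaussMoment d α)) := by
  rw [limitDensity, ENNReal.ofReal_mul (by positivity), ← mul_assoc, ← mul_assoc,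
    ← ENNReal.ofReal_rpow_of_nonneg (by positivity) (by linarith), ENNReal.ofReal_coe_nnreal]
  congr 2
  rw [ENNReal.rpow_add_of_nonneg _ _ zero_le_one hα₀.le, ENNReal.rpow_one]

variable [SigmaFinite μ] {K : Set (Param d)} {M : ℝ≥0}

/-- The affinity between the joint likelihood at `θ` and its mixture with density `g`. -/
def mixtureAffinity (α : ℝ) (μ : Measure Y) [SigmaFinite μ] (ℓ : Param d → Y → ℝ)
    (g : Param d → ℝ≥0) (k : ℕ) (θ : Param d) : ℝ≥0∞ :=
  ∫⁻ y : Fin k → Y, (∫⁻ θ', g θ' * jlik ℓ k θ' y) ^ α * jlik ℓ k θ y ^ (1 - α)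
    ∂(Measure.pi fun _ => μ)

theorem measurable_mixture (hℓ : Measurable (Function.uncurry ℓ)) (hg : Measurable g) (k : ℕ) :
    Measurable fun y : Fin k → Y => ∫⁻ θ', g θ' * jlik ℓ k θ' y := by
  refine Measurable.lintegral_prod_right' (f := fun p : (Fin k → Y) × Param d =>
    g p.2 * jlik ℓ k p.2 p.1) ?_
  exact (hg.coe_nnreal_ennreal.comp measurable_snd).mul (measurable_uncurry_jlik hℓ k)

theorem measurable_mixtureAffinity (hℓ : Measurable (Function.uncurry ℓ)) (hg : Measurable g)
    (k : ℕ) : Measurable (mixtureAffinity α μ ℓ g k) := by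
  refine Measurable.lintegral_prod_right' (f := fun p : Param d × (Fin k → Y) =>
    (∫⁻ θ', g θ' * jlik ℓ k θ' p.2) ^ α * jlik ℓ k p.1 p.2 ^ (1 - α)) ?_
  exact (((measurable_mixture hℓ hg k).comp measurable_snd).pow_const α).mul
    (((measurable_uncurry_jlik hℓ k).comp measurable_swap).pow_const _)

/-- Origin of the rate: the Jacobian k^(d/2) of the substitution sits inside the power α. -/
theorem rescaledAffinity_eq (hℓ : Measurable (Function.uncurry ℓ)) (hg : Measurable g)
    (hα₀ : 0 ≤ α) {k : ℕ} (hk : 0 < k) (θ : Param d) :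
    rescaledAffinity α μ ℓ g k θ =
      ENNReal.ofReal ((k : ℝ) ^ ((d : ℝ) * α / 2)) * mixtureAffinity α μ ℓ g k θ := by
  have hk' : (0 : ℝ) < k := by exact_mod_cast hk
  have hc : (√(k : ℝ))⁻¹ ≠ 0 := by positivity
  have hscale : ENNReal.ofReal |(((√(k : ℝ))⁻¹) ^ d)⁻¹| ^ α =
      ENNReal.ofReal ((k : ℝ) ^ ((d : ℝ) * α / 2)) := by
    rw [inv_pow, inv_inv, abs_of_pos (by positivity),
      ENNReal.ofReal_rpow_of_nonneg (by positivity) hα₀, Real.sqrt_eq_rpow, ← Real.rpow_natCast,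
      ← Real.rpow_mul hk'.le, ← Real.rpow_mul hk'.le]
    congr 2
    ring
  rw [rescaledAffinity, localAffinity, mixtureAffinity, ← hscale, ← lintegral_const_mul' _ _
    (ENNReal.rpow_ne_top_of_nonneg hα₀ ENNReal.ofReal_ne_top)]
  refine lintegral_congr fun y => ?_
  have hm : Measurable fun θ' : Param d => g θ' * jlik ℓ k θ' y :=
    hg.coe_nnreal_ennreal.mul
      ((measurable_uncurry_jlik hℓ k).comp (measurable_const.prodMk measurable_id))
  rw [lintegral_comp_affine hc θ hm, ENNReal.mul_rpow_of_nonneg _ _ hα₀, mul_assoc]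

/-- Asymptotics of the mean affinity between the likelihood and its mixture. -/
theorem IsRegularOn.tendsto_mixtureAffinity {Θ U : Set (Param d)} (h : IsRegularOn μ ℓ Θ U)
    (hK : IsCompact K) (hKΘ : K ⊆ Θ) (hα₀ : 0 < α) (hα₁ : α < 1) (hg : Measurable g)
    (hM : ∀ θ, g θ ≤ M) (hgK : ∀ θ, g θ ≠ 0 → θ ∈ K) (hg1 : ∫⁻ θ, (g θ : ℝ≥0∞) = 1) :
    gaussMoment d α ≠ ∞ ∧
    Tendsto (fun k : ℕ => (k : ℝ) ^ ((d : ℝ) * α / 2) *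
        (∫⁻ θ, g θ * mixtureAffinity α μ ℓ g k θ).toReal) atTop
      (𝓝 ((gaussMoment d α).toReal * ∫ θ, limitDensity α μ ℓ g θ)) := by
  obtain ⟨a, b, hB⟩ := h.exists_isBiLipschitzOn hK hKΘ
  obtain ⟨C, hC, hCle⟩ := hB.exists_rescaledAffinity_le hα₀ hα₁ hg hM hgK
  have hpt : ∀ᵐ θ : Param d, θ ∈ K → Tendsto (fun k => rescaledAffinity α μ ℓ g k θ) atTop
      (𝓝 ((g θ : ℝ≥0∞) ^ α *
        (ENNReal.ofReal (|(fisher μ ℓ θ).det| ^ (-α / 2)) * gaussMoment d α))) := by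
    filter_upwards [ae_tendsto_oscillation hg hM] with θ hosc hθ
    obtain ⟨r, G, hr⟩ := h.exists_isLocallyRegular (hKΘ hθ)
    exact hB.tendsto_rescaledAffinity hα₀ hα₁ hg hM hgK hθ hr (h.fisher_posDef θ (hKΘ hθ)) hosc
  -- An infinite moment would force the bounded rescaled affinities to tend to ∞ wherever g > 0,
  -- making g null against `hg1`.
  have hgm : gaussMoment d α ≠ ∞ := by
    intro htop
    have : ∀ᵐ θ : Param d, (g θ : ℝ≥0∞) = 0 := by
      filter_upwards [hpt] with θ hθ
      by_contra h0
      have h0' : g θ ≠ 0 := by simpa using h0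
      have hmem := hgK θ h0'
      have hle := le_of_tendsto (hθ hmem)
        ((eventually_gt_atTop 0).mono fun k hk => hCle k hk θ hmem)
      have hdet := (h.fisher_posDef θ (hKΘ hmem)).det_pos
      rw [htop, ENNReal.mul_top, ENNReal.mul_top] at hle
      · exact hC (top_le_iff.1 hle)
      · exact (ENNReal.rpow_pos (pos_iff_ne_zero.2 h0) ENNReal.coe_ne_top).ne'
      · have : 0 < |(fisher μ ℓ θ).det| ^ (-α / 2) := Real.rpow_pos_of_pos (abs_pos.2 hdet.ne') _
        simpa using this
    rw [lintegral_congr_ae this] at hg1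
    simp at hg1
  -- The index is shifted to k + 1 because the rescaling by 1/√k degenerates at k = 0.
  have hlim : ∀ᵐ θ : Param d, Tendsto (fun k => g θ * rescaledAffinity α μ ℓ g (k + 1) θ) atTop
      (𝓝 (ENNReal.ofReal (limitDensity α μ ℓ g θ) * gaussMoment d α)) := by
    filter_upwards [hpt] with θ hθ
    rw [ofReal_limitDensity hα₀]
    rcases eq_or_ne (g θ) 0 with h0 | h0
    · simp [h0]
    · exact ENNReal.Tendsto.const_mul ((tendsto_add_atTop_iff_nat 1).2 (hθ (hgK θ h0)))
        (Or.inr ENNReal.coe_ne_top)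
  have hmeas : ∀ k, Measurable fun θ => g θ * rescaledAffinity α μ ℓ g (k + 1) θ := fun k => by
    simp_rw [rescaledAffinity_eq h.measurable hg hα₀.le k.succ_pos]
    exact hg.coe_nnreal_ennreal.mul ((measurable_mixtureAffinity h.measurable hg _).const_mul _)
  have hbound : ∀ k, ∀ᵐ θ : Param d, g θ * rescaledAffinity α μ ℓ g (k + 1) θ ≤ g θ * C :=
    fun k => ae_of_all _ fun θ => by
      rcases eq_or_ne (g θ) 0 with h0 | h0
      · simp [h0]
      · gcongr
        exact hCle _ k.succ_pos θ (hgK θ h0)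
  have hgC : ∫⁻ θ, (g θ : ℝ≥0∞) * C = C := by
    rw [lintegral_mul_const' _ _ hC, hg1, one_mul]
  have hD := tendsto_lintegral_of_dominated_convergence _ hmeas hbound (by rwa [hgC]) hlim
  have hfin : ∫⁻ θ, ENNReal.ofReal (limitDensity α μ ℓ g θ) * gaussMoment d α ≠ ∞ := by
    refine ne_top_of_le_ne_top hC (le_of_tendsto' hD fun k => ?_)
    exact (lintegral_mono_ae (hbound k)).trans_eq hgC
  -- Measurability in θ is inherited from the measurable approximations, after division by the
  -- positive finite moment; no direct study of `fisher` as a function of θ is made.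
  have haem : AEMeasurable (limitDensity α μ ℓ g) := by
    have h1 := aemeasurable_of_tendsto_metrizable_ae atTop (fun k => (hmeas k).aemeasurable) hlim
    have h2 := (h1.mul_const (gaussMoment d α)⁻¹).ennreal_toReal
    refine h2.congr (ae_of_all _ fun θ => ?_)
    beta_reduce
    rw [mul_assoc, ENNReal.mul_inv_cancel (gaussMoment_ne_zero d hα₀) hgm, mul_one,
      ENNReal.toReal_ofReal]
    unfold limitDensity
    positivity
  refine ⟨hgm, ?_⟩
  rw [integral_eq_lintegral_of_nonneg_ae (ae_of_all _ fun θ => by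
    simp only [Pi.zero_apply, limitDensity]; positivity) haem.aestronglyMeasurable,
    mul_comm (gaussMoment d α).toReal,
    ← ENNReal.toReal_mul, ← lintegral_mul_const' _ _ hgm, ← tendsto_add_atTop_iff_nat 1]
  refine ((ENNReal.tendsto_toReal hfin).comp hD).congr fun k => ?_
  have hk : 0 ≤ ((k + 1 : ℕ) : ℝ) ^ ((d : ℝ) * α / 2) := by positivity
  rw [Function.comp_apply, ← ENNReal.toReal_ofReal hk, ← ENNReal.toReal_mul,
    ← lintegral_const_mul' _ _ ENNReal.ofReal_ne_top]
  congr 1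
  refine lintegral_congr fun θ => ?_
  rw [rescaledAffinity_eq h.measurable hg hα₀.le k.succ_pos, mul_left_comm]

end MixtureLimit

/-! ### From priors and mutual informations to densities and affinities. -/

section PriorDensity

theorem fAlpha_div_mul {α p q : ℝ} (hp : 0 ≤ p) (hq : 0 < q) :
    fAlpha α (p / q) * q =
      (p ^ α * q ^ (1 - α) - α * p - (1 - α) * q) / (α * (α - 1)) := by
  rw [fAlpha, Real.div_rpow hp hq.le, Real.rpow_sub hq, Real.rpow_one, div_mul_eq_mul_div]
  congr 1
  field_simp

variable {d : ℕ} {Θ : Set (Param d)}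

theorem sigmaFinite_lebesgueOn (hΘ : MeasurableSet Θ) : SigmaFinite (lebesgueOn Θ) := by
  refine SigmaFinite.of_map _ measurable_subtype_coe.aemeasurable ?_
  rw [lebesgueOn, map_comap_subtype_coe hΘ]
  infer_instance

theorem lintegral_lebesgueOn (hΘ : MeasurableSet Θ) {F : Param d → ℝ≥0∞}
    (hF : ∀ θ ∉ Θ, F θ = 0) : ∫⁻ θ : Θ, F θ ∂(lebesgueOn Θ) = ∫⁻ θ, F θ := by
  rw [lebesgueOn, lintegral_subtype_comap hΘ, ← lintegral_indicator hΘ]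
  congr 1
  ext θ
  by_cases h : θ ∈ Θ <;> simp [h, hF]

/-- A bounded probability density on `Θ`, extended by zero and carried by a compact set `K`. -/
structure IsCompactDensity (Θ K : Set (Param d)) (g : Param d → ℝ≥0) : Prop where
  measurable : Measurable g
  bounded : ∃ M, ∀ θ, g θ ≤ M
  isCompact : IsCompact K
  subset : K ⊆ Θ
  support : ∀ θ, g θ ≠ 0 → θ ∈ K
  lintegral_eq_one : ∫⁻ θ, (g θ : ℝ≥0∞) = 1

/-- The measure on `Θ` with density `g`. -/
def densityMeasure (Θ : Set (Param d)) (g : Param d → ℝ≥0) : Measure Θ :=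
  (lebesgueOn Θ).withDensity fun θ => (g θ : ℝ≥0∞)

/-- Local boundedness becomes boundedness on the compact K, so K has finite mass and conditioning
gives a probability. The density is extended by zero to the whole space, where translations and
dilations are available. -/
theorem IsPriorMeasure.exists_density (hΘ : MeasurableSet Θ) {m : Measure Θ}
    (hm : IsPriorMeasure Θ m) {K : Set Θ} (hK : IsCompact K) (hmK : 0 < m K) :
    ∃ g, IsCompactDensity Θ ((↑) '' K) g ∧ cond m K = densityMeasure Θ g := by
  obtain ⟨-, f, hf, hf0, hloc, -, rfl⟩ := hm
  have hemb : MeasurableEmbedding ((↑) : Θ → Param d) := MeasurableEmbedding.subtype_coe hΘ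
  have hKm : MeasurableSet K := hK.measurableSet
  have hK' : IsCompact ((↑) '' K : Set (Param d)) := hK.image continuous_subtype_val
  obtain ⟨B, hB⟩ : BddAbove (f '' K) := by
    refine hK.induction_on (p := fun s => BddAbove (f '' s)) (by simp)
      (fun s t hst ht => ht.mono (Set.image_mono hst))
      (fun s t hs ht => by rw [Set.image_union]; exact hs.union ht) fun x _ => ?_
    obtain ⟨s, hs, hb⟩ := hloc x
    exact ⟨s, mem_nhdsWithin_of_mem_nhds hs, hb⟩
  set m := (lebesgueOn Θ).withDensity fun θ => ENNReal.ofReal (f θ) with hmdef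
  have hmtop : m K ≠ ∞ := by
    have hvol : lebesgueOn Θ K ≠ ∞ := by
      rw [lebesgueOn, hemb.comap_apply]
      exact hK'.measure_lt_top.ne
    rw [hmdef, withDensity_apply _ hKm]
    refine ne_top_of_le_ne_top (ENNReal.mul_ne_top (ENNReal.ofReal_ne_top (r := B)) hvol) ?_
    refine (setLIntegral_mono (g := fun _ => ENNReal.ofReal B) measurable_const fun θ hθ =>
      ENNReal.ofReal_le_ofReal (hB (Set.mem_image_of_mem f hθ))).trans_eq ?_
    simp
  set c : ℝ≥0 := (m K).toNNReal⁻¹ with hc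
  have hcm : (c : ℝ≥0∞) = (m K)⁻¹ := by
    rw [hc, ENNReal.coe_inv, ENNReal.coe_toNNReal hmtop]
    rw [ENNReal.toNNReal_ne_zero]
    exact ⟨hmK.ne', hmtop⟩
  set gΘ : Θ → ℝ≥0 := K.indicator fun θ => c * (f θ).toNNReal with hgΘ
  have hgΘm : Measurable gΘ := (hf.real_toNNReal.const_mul c).indicator hKm
  set g : Param d → ℝ≥0 := Function.extend (↑) gΘ 0 with hg
  have hgval : ∀ θ : Θ, g θ = gΘ θ := fun θ => Subtype.val_injective.extend_apply gΘ 0 θ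
  have hsupp : ∀ θ, g θ ≠ 0 → θ ∈ ((↑) '' K : Set (Param d)) := fun θ hθ => by
    by_cases h : θ ∈ Θ
    · rw [hgval ⟨θ, h⟩] at hθ
      exact ⟨⟨θ, h⟩, (Set.indicator_apply_ne_zero.1 hθ).1, rfl⟩
    · refine absurd (Function.extend_apply' _ _ _ ?_) hθ
      rintro ⟨θ', rfl⟩
      exact h θ'.2
  have hcond : cond m K = densityMeasure Θ g := by
    rw [ProbabilityTheory.cond, hmdef, restrict_withDensity hKm, ← hmdef, ← withDensity_indicator hKm,
      ← withDensity_smul _ (hf.ennreal_ofReal.indicator hKm), densityMeasure]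
    congr 1
    ext θ
    rw [hgval, ← hcm, Pi.smul_apply, hgΘ]
    by_cases h : θ ∈ K
    · simp only [Set.indicator_of_mem h, smul_eq_mul, ENNReal.coe_mul]
      rfl
    · simp [h]
  refine ⟨g, ⟨hemb.measurable_extend hgΘm measurable_zero, ⟨c * B.toNNReal, fun θ => ?_⟩, hK',
    Subtype.coe_image_subset Θ K, hsupp, ?_⟩, hcond⟩
  · by_cases h0 : g θ = 0
    · simp [h0]
    · obtain ⟨θ', hθ', rfl⟩ := hsupp θ h0
      rw [hgval, hgΘ, Set.indicator_of_mem hθ']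
      gcongr
      exact hB (Set.mem_image_of_mem f hθ')
  · have hP : IsProbabilityMeasure (cond m K) := cond_isProbabilityMeasure_of_finite hmK.ne' hmtop
    have h1 := hP.measure_univ
    rw [hcond, densityMeasure, withDensity_apply _ MeasurableSet.univ, setLIntegral_univ,
      lintegral_lebesgueOn hΘ (F := fun θ => (g θ : ℝ≥0∞))] at h1
    · exact h1
    · intro θ hθ
      by_contra h0
      exact hθ (Subtype.coe_image_subset Θ K (hsupp θ (by simpa using h0)))

theorem Prior.exists_density (hΘ : MeasurableSet Θ) (π : Prior Θ) {K : Set Θ} (hK : IsCompact K)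
    (hπ : π.Charges K) :
    ∃ g, IsCompactDensity Θ ((↑) '' K) g ∧ π.restrictNorm K = densityMeasure Θ g := by
  induction π using Quotient.inductionOn with
  | h m => exact m.2.exists_density hΘ hK hπ

namespace IsCompactDensity

variable {K : Set (Param d)} {g : Param d → ℝ≥0}

theorem eq_zero_of_notMem (hg : IsCompactDensity Θ K g) {θ : Param d} (hθ : θ ∉ Θ) : g θ = 0 := by
  by_contra h
  exact hθ (hg.subset (hg.support θ h))

theorem lintegral_densityMeasure (hg : IsCompactDensity Θ K g) (hΘ : MeasurableSet Θ)
    {F : Param d → ℝ≥0∞} (hF : Measurable F) :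
    ∫⁻ θ : Θ, F θ ∂(densityMeasure Θ g) = ∫⁻ θ, g θ * F θ := by
  refine (lintegral_withDensity_eq_lintegral_mul (lebesgueOn Θ) (f := fun θ : Θ => (g θ : ℝ≥0∞))
    (hg.measurable.comp measurable_subtype_coe).coe_nnreal_ennreal (g := fun θ : Θ => F θ)
    (hF.comp measurable_subtype_coe)).trans ?_
  exact lintegral_lebesgueOn hΘ (F := fun θ => g θ * F θ) fun θ hθ => by
    simp [hg.eq_zero_of_notMem hθ]

theorem isProbabilityMeasure (hg : IsCompactDensity Θ K g) (hΘ : MeasurableSet Θ) :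
    IsProbabilityMeasure (densityMeasure Θ g) := by
  refine ⟨?_⟩
  have := hg.lintegral_densityMeasure hΘ (F := fun _ => 1) measurable_const
  simpa [hg.lintegral_eq_one] using this

variable {Y : Type*} [MeasurableSpace Y] {μ : Measure Y} {ℓ : Param d → Y → ℝ}

theorem limitFunctional_eq (hg : IsCompactDensity Θ K g) (hΘ : MeasurableSet Θ) {α : ℝ}
    (hα₀ : 0 < α) :
    limitFunctional α μ ℓ (densityMeasure Θ g) = constC d α * ∫ θ, limitDensity α μ ℓ g θ := by
  have := sigmaFinite_lebesgueOn hΘ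
  have hrn := Measure.rnDeriv_withDensity (lebesgueOn Θ) (f := fun θ => (g θ : ℝ≥0∞))
    (hg.measurable.comp measurable_subtype_coe).coe_nnreal_ennreal
  rw [limitFunctional, ← setIntegral_eq_integral_of_forall_compl_eq_zero (s := Θ)
    fun θ hθ => by simp [limitDensity, hg.eq_zero_of_notMem hθ, (by linarith : 1 + α ≠ 0)],
    ← integral_subtype_comap hΘ]
  congr 1
  refine integral_congr_ae ?_
  filter_upwards [hrn] with θ hθ
  rw [densityMeasure, hθ, limitDensity, ENNReal.coe_toReal]

variable [SigmaFinite μ] {U : Set (Param d)} {α : ℝ}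

theorem lintegral_mixture (hg : IsCompactDensity Θ K g) (h : IsRegularOn μ ℓ Θ U) (k : ℕ) :
    ∫⁻ y : Fin k → Y, (∫⁻ θ, g θ * jlik ℓ k θ y) ∂(Measure.pi fun _ => μ) = 1 := by
  rw [lintegral_lintegral_swap, ← hg.lintegral_eq_one]
  · refine lintegral_congr fun θ => ?_
    rw [lintegral_const_mul _ (measurable_jlik h.measurable k θ)]
    rcases eq_or_ne (g θ) 0 with h0 | h0
    · simp [h0]
    · rw [lintegral_jlik h.measurable
        (h.lintegral_lik (hg.subset (hg.support θ h0))), mul_one]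
  · exact ((hg.measurable.coe_nnreal_ennreal.comp measurable_snd).mul
      (measurable_uncurry_jlik h.measurable k)).aemeasurable

theorem mixtureAffinity_le_one (hg : IsCompactDensity Θ K g) (h : IsRegularOn μ ℓ Θ U)
    (hα₀ : 0 < α) (hα₁ : α < 1) (k : ℕ) {θ : Param d} (hθ : θ ∈ Θ) :
    mixtureAffinity α μ ℓ g k θ ≤ 1 := by
  refine (ENNReal.lintegral_mul_norm_pow_le
    (measurable_mixture h.measurable hg.measurable k).aemeasurable
    (measurable_jlik h.measurable k θ).aemeasurable hα₀.le (by linarith) (by ring)).trans_eq ?_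
  rw [hg.lintegral_mixture h, lintegral_jlik h.measurable (h.lintegral_lik hθ)]
  simp

theorem ae_integrand_eq (hg : IsCompactDensity Θ K g) (hΘ : MeasurableSet Θ)
    (h : IsRegularOn μ ℓ Θ U) (k : ℕ) {θ : Param d} (hθ : θ ∈ Θ) :
    ∀ᵐ y ∂(Measure.pi fun _ : Fin k => μ),
      fAlpha α (marginal ℓ (densityMeasure Θ g) k y / jointLik ℓ k θ y) * jointLik ℓ k θ y =
      (((∫⁻ θ', g θ' * jlik ℓ k θ' y) ^ α * jlik ℓ k θ y ^ (1 - α)).toReal -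
        α * (∫⁻ θ', g θ' * jlik ℓ k θ' y).toReal - (1 - α) * (jlik ℓ k θ y).toReal) /
        (α * (α - 1)) := by
  have h1 : ∀ᵐ y ∂(Measure.pi fun _ : Fin k => μ), ∀ i, ∀ θ ∈ U, 0 < ℓ θ (y i) :=
    ae_all_iff.2 fun i => (Measure.quasiMeasurePreserving_eval (fun _ : Fin k => μ) i).ae h.pos
  filter_upwards [h1] with y hy
  have hpos : ∀ θ ∈ U, 0 < jointLik ℓ k θ y := fun θ hθ => Finset.prod_pos fun i _ => hy i θ hθ
  have hj : ∀ θ ∈ U, jointLik ℓ k θ y = (jlik ℓ k θ y).toReal := fun θ hθ => by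
    rw [jlik, ENNReal.toReal_prod, jointLik]
    exact Finset.prod_congr rfl fun i _ => (ENNReal.toReal_ofReal (hy i θ hθ).le).symm
  have hjm : Measurable fun θ => jlik ℓ k θ y :=
    (measurable_uncurry_jlik h.measurable k).comp (measurable_const.prodMk measurable_id)
  have hmarg : marginal ℓ (densityMeasure Θ g) k y = (∫⁻ θ', g θ' * jlik ℓ k θ' y).toReal := by
    rw [marginal, integral_congr_ae (ae_of_all _ fun θ' : Θ => hj θ' (h.subset θ'.2)),
      integral_toReal (f := fun θ' : Θ => jlik ℓ k θ' y)
        (hjm.comp measurable_subtype_coe).aemeasurable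
        (ae_of_all _ fun θ' => (jlik_ne_top k _ y).lt_top),
      hg.lintegral_densityMeasure hΘ hjm]
  rw [hmarg, fAlpha_div_mul ENNReal.toReal_nonneg (hpos θ (h.subset hθ)), hj θ (h.subset hθ),
    ENNReal.toReal_mul, ENNReal.toReal_rpow, ENNReal.toReal_rpow]

/-- After expansion of `fAlpha`, the two linear terms integrate to α and 1 - α because the mixture
and the likelihood have total mass one, leaving the affinity minus 1. -/
theorem alphaDiv_eq (hg : IsCompactDensity Θ K g) (hΘ : MeasurableSet Θ)
    (h : IsRegularOn μ ℓ Θ U) (hα₀ : 0 < α) (hα₁ : α < 1) (k : ℕ) {θ : Param d} (hθ : θ ∈ Θ) :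
    alphaDiv α μ ℓ (densityMeasure Θ g) k θ =
      ((mixtureAffinity α μ ℓ g k θ).toReal - 1) / (α * (α - 1)) := by
  have hP := measurable_mixture h.measurable hg.measurable k
  have hQ := measurable_jlik h.measurable k θ
  have hPQ : Measurable fun y : Fin k → Y =>
      (∫⁻ θ', g θ' * jlik ℓ k θ' y) ^ α * jlik ℓ k θ y ^ (1 - α) :=
    (hP.pow_const _).mul (hQ.pow_const _)
  have hP1 := hg.lintegral_mixture h k
  have hQ1 := lintegral_jlik h.measurable (h.lintegral_lik hθ) k
  have hPQ1 : ∫⁻ y : Fin k → Y, (∫⁻ θ', g θ' * jlik ℓ k θ' y) ^ α * jlik ℓ k θ y ^ (1 - α)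
      ∂(Measure.pi fun _ => μ) ≠ ∞ :=
    ne_top_of_le_ne_top ENNReal.one_ne_top (hg.mixtureAffinity_le_one h hα₀ hα₁ k hθ)
  have hPi := integrable_toReal_of_lintegral_ne_top hP.aemeasurable (by rw [hP1]; simp)
  have hQi := integrable_toReal_of_lintegral_ne_top hQ.aemeasurable (by rw [hQ1]; simp)
  have hPQi := integrable_toReal_of_lintegral_ne_top hPQ.aemeasurable hPQ1
  rw [alphaDiv, integral_congr_ae (hg.ae_integrand_eq hΘ h k hθ), integral_div,
    integral_sub (f := fun y => _ - _) (hPQi.sub (hPi.const_mul α)) (hQi.const_mul (1 - α)),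
    integral_sub hPQi (hPi.const_mul α), integral_const_mul, integral_const_mul,
    integral_toReal hPQ.aemeasurable (ae_lt_top hPQ hPQ1),
    integral_toReal hP.aemeasurable (ae_lt_top hP (by rw [hP1]; simp)),
    integral_toReal hQ.aemeasurable (ae_lt_top hQ (by rw [hQ1]; simp)), hP1, hQ1, mixtureAffinity]
  congr 1
  simp only [ENNReal.toReal_one]
  ring

theorem mutualInfo_eq (hg : IsCompactDensity Θ K g) (hΘ : MeasurableSet Θ)
    (h : IsRegularOn μ ℓ Θ U) (hα₀ : 0 < α) (hα₁ : α < 1) (k : ℕ) :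
    mutualInfo α μ ℓ (densityMeasure Θ g) k =
      ((∫⁻ θ, g θ * mixtureAffinity α μ ℓ g k θ).toReal - 1) / (α * (α - 1)) := by
  have hprob := hg.isProbabilityMeasure hΘ
  have hm := measurable_mixtureAffinity (α := α) (μ := μ) h.measurable hg.measurable k
  have hm' : Measurable fun θ : Θ => mixtureAffinity α μ ℓ g k θ := hm.comp measurable_subtype_coe
  have hle : ∀ θ : Θ, mixtureAffinity α μ ℓ g k θ ≤ 1 := fun θ =>
    hg.mixtureAffinity_le_one h hα₀ hα₁ k θ.2
  have hlt : ∫⁻ θ : Θ, mixtureAffinity α μ ℓ g k θ ∂(densityMeasure Θ g) ≠ ∞ :=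
    ne_top_of_le_ne_top ENNReal.one_ne_top ((lintegral_mono hle).trans_eq (by simp))
  rw [mutualInfo, integral_congr_ae (ae_of_all _ fun θ : Θ => hg.alphaDiv_eq hΘ h hα₀ hα₁ k θ.2),
    integral_div, integral_sub (integrable_toReal_of_lintegral_ne_top hm'.aemeasurable hlt)
      (integrable_const _), integral_toReal hm'.aemeasurable
      (ae_of_all _ fun θ => (hle θ).trans_lt ENNReal.one_lt_top),
    hg.lintegral_densityMeasure hΘ hm]
  simp

/-- The limit of the rescaled difference of two mutual informations. -/
theorem tendsto_mutualInfo_sub {K' : Set (Param d)} {g' : Param d → ℝ≥0}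
    (hg : IsCompactDensity Θ K g) (hg' : IsCompactDensity Θ K' g') (hΘ : MeasurableSet Θ)
    (h : IsRegularOn μ ℓ Θ U) (hα₀ : 0 < α) (hα₁ : α < 1) :
    ∃ c > 0, Tendsto (fun k : ℕ => (k : ℝ) ^ ((d : ℝ) * α / 2) *
        (mutualInfo α μ ℓ (densityMeasure Θ g) k - mutualInfo α μ ℓ (densityMeasure Θ g') k)) atTop
      (𝓝 (c * (limitFunctional α μ ℓ (densityMeasure Θ g) -
        limitFunctional α μ ℓ (densityMeasure Θ g')))) := by
  obtain ⟨M, hM⟩ := hg.bounded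
  obtain ⟨M', hM'⟩ := hg'.bounded
  obtain ⟨hgm, hlim⟩ := h.tendsto_mixtureAffinity hg.isCompact hg.subset hα₀ hα₁ hg.measurable hM
    hg.support hg.lintegral_eq_one
  obtain ⟨-, hlim'⟩ := h.tendsto_mixtureAffinity hg'.isCompact hg'.subset hα₀ hα₁ hg'.measurable
    hM' hg'.support hg'.lintegral_eq_one
  have hm : 0 < (gaussMoment d α).toReal := ENNReal.toReal_pos (gaussMoment_ne_zero d hα₀) hgm
  have hα : α * (α - 1) ≠ 0 := (mul_neg_of_pos_of_neg hα₀ (by linarith)).ne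
  have h1 : 0 < (2 * Real.pi) ^ ((d : ℝ) * α / 2) * (1 - α) ^ (-(d : ℝ) / 2) :=
    mul_pos (Real.rpow_pos_of_pos (by positivity) _) (Real.rpow_pos_of_pos (by linarith) _)
  have hC : constC d α = (2 * Real.pi) ^ ((d : ℝ) * α / 2) * (1 - α) ^ (-(d : ℝ) / 2) /
    (α * (α - 1)) := rfl
  set D := (2 * Real.pi) ^ ((d : ℝ) * α / 2) * (1 - α) ^ (-(d : ℝ) / 2)
  -- D is the positive numerator of `constC`. The common negative denominator α(α-1) occurs both in
  -- the mutual information and in the functional, so the ratio of the two limits is positive.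
  refine ⟨(gaussMoment d α).toReal / D, by positivity, ?_⟩
  refine ((hlim.sub hlim').div_const (α * (α - 1))).congr' ?_ |>.trans_eq ?_
  · refine Eventually.of_forall fun k => ?_
    beta_reduce
    rw [hg.mutualInfo_eq hΘ h hα₀ hα₁, hg'.mutualInfo_eq hΘ h hα₀ hα₁]
    ring
  · rw [hg.limitFunctional_eq hΘ hα₀, hg'.limitFunctional_eq hΘ hα₀, hC]
    congr 1
    field_simp

end IsCompactDensity

end PriorDensity

end RefPrior

end

/-! ### The equivalence. -/

theorem mainTheorem7 {d : ℕ} (hd : 1 ≤ d) {Y : Type*} [MeasurableSpace Y]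
    (μ : Measure Y) [SigmaFinite μ] (ℓ : RefPrior.Param d → Y → ℝ)
    (Θ : Set (RefPrior.Param d)) (hΘ : MeasurableSet Θ)
    (hreg : RefPrior.IsRegularModel μ ℓ Θ)
    (α : ℝ) (hα₀ : 0 < α) (hα₁ : α < 1)
    (P : Set (RefPrior.Prior Θ)) (πs : RefPrior.Prior Θ) (hπs : πs ∈ P) :
    RefPrior.IsReferencePrior α μ ℓ (fun k : ℕ => (k : ℝ) ^ ((d : ℝ) * α / 2)) P πs ↔
      ∃ K : ℕ → Set Θ, RefPrior.IsOpenlyIncreasingExhaustion K ∧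
        (∀ i, πs.Charges (K i)) ∧
        ∀ i, IsMaxOn (fun π : RefPrior.Prior Θ =>
            RefPrior.limitFunctional α μ ℓ (π.restrictNorm (K i)))
          {π | π ∈ P ∧ π.Charges (K i)} πs := by
  obtain ⟨U, hU⟩ := hreg
  constructor
  · rintro ⟨-, K, hK, hπK, hlim⟩
    refine ⟨K, hK, hπK, fun i => isMaxOn_iff.2 ?_⟩
    rintro π ⟨hπ, hπi⟩
    obtain ⟨L, hL, hLim⟩ := hlim i π hπ hπi
    obtain ⟨g, hg, hgeq⟩ := πs.exists_density hΘ (hK.1 i) (hπK i)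
    obtain ⟨g', hg', hgeq'⟩ := π.exists_density hΘ (hK.1 i) hπi
    obtain ⟨c, hc, hcl⟩ := hg.tendsto_mutualInfo_sub hg' hΘ hU hα₀ hα₁
    rw [hgeq, hgeq'] at hLim ⊢
    -- The limit demanded by the definition must be c times the difference of the functionals, so
    -- its sign is that of the difference. In the converse direction the same convergence supplies
    -- the existence of the limit.
    rw [tendsto_nhds_unique hLim hcl] at hL
    exact sub_nonneg.1 (nonneg_of_mul_nonneg_right hL hc)
  · rintro ⟨K, hK, hπK, hmax⟩
    refine ⟨hπs, K, hK, hπK, fun i π hπ hπi => ?_⟩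
    obtain ⟨g, hg, hgeq⟩ := πs.exists_density hΘ (hK.1 i) (hπK i)
    obtain ⟨g', hg', hgeq'⟩ := π.exists_density hΘ (hK.1 i) hπi
    obtain ⟨c, hc, hcl⟩ := hg.tendsto_mutualInfo_sub hg' hΘ hU hα₀ hα₁
    have hle := isMaxOn_iff.1 (hmax i) π ⟨hπ, hπi⟩
    rw [hgeq, hgeq'] at hle ⊢
    exact ⟨_, mul_nonneg hc.le (sub_nonneg.2 hle), hcl⟩
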